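/- Let $p$ be a prime, $S$ a finite $p$-group and $\mathcal F$ a saturated fusion system over $S$. **Conventions.** A fusion system $\mathcal F$ over $S$ is a category whose objects are the subgroups of $S$, whose morphisms are injective group homomorphisms, which contains all homomorphisms $P\to Q$ induced by conjugation in $S$, and in which every morphism $P\to Q$ is an isomorphism $P\to\varphi(P)$ of $\mathcal F$ followed by an inclusion. Subgroups that are isomorphic in $\mathcal F$ are called $\mathcal F$-conjugate. A subgroup $P$ is fully normalized (fully centralized) if $|N_S(P)|\ge |N_S(Q)|$ (respectively $|C_S(P)|\ge|C_S(Q)|$) for all $Q$ that are $\mathcal F$-conjugate to $P$. $\mathcal F$ is saturated if (i) every fully normalized $P$ is fully centralized and $\mathrm{Aut}_S(P)$ is a Sylow $p$-subgroup of $\mathrm{Aut}_{\mathcal F}(P)$, and (ii) if $Q$ is fully centralized, every isomorphism $\varphi:P\to Q$ in $\mathcal F$ extends to a morphism $N_\varphi\to S$ in $\mathcal F$, where $N_\varphi=\{x\in N_S(P): \varphi c_x\varphi^{-1}\in \mathrm{Aut}_S(Q)\}$. A subgroup $P$ is $\mathcal F$-centric if $C_S(Q)\le Q$ for all $Q$ that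 are $\mathcal F$-conjugate to $P$. The centric orbit category $\mathcal O^c(\mathcal F)$ has the $\mathcal F$-centric subgroups as objects and $\mathrm{Inn}(Q)\backslash \mathrm{Mor}_{\mathcal F}(P,Q)$ as the set of morphisms $P\to Q$. For a small category $\mathcal C$, an $\mathbb F_p\mathcal C$-module is a contravariant functor from $\mathcal C$ to $\mathbb F_p$-vector spaces, and $H^n(\mathcal C;M)=\lim^n_{\mathcal C}M=\mathrm{Ext}^n_{\mathbb F_p\mathcal C}(\underline{\mathbb F_p},M)$, with $\underline{\mathbb F_p}$ the constant functor. Let $\overline{s}d(\mathcal F^c)$ be the poset of $\mathcal F$-conjugacy classes $[\sigma]$ of nonempty chains $\sigma=(P_0<\dots<P_n)$ of $\mathcal F$-centric subgroups. Here $\sigma$ and $\tau=(Q_0<\dots<Q_n)$ are conjugate if there is an isomorphism $P_n\to Q_n$ in $\mathcal F$ that takes $P_i$ to $Q_i$ for all $i$, and there is a (unique) morphism $[\sigma]\to[\tau]$ if and only if $\tau$ is conjugate to a subchain of $\sigma$. Put $N_S(\sigma)=\bigcap_i N_S(P_i)$; the chain $\sigma$ is fully normalized if $|N_S(\sigma)|\ge|N_S(\tau)|$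 for all chains $\tau$ conjugate to $\sigma$. The normalizer $N_{\mathcal F}(\sigma)$ is the fusion system over $N_S(\sigma)$ in which the morphisms $P\to R$ are the homomorphisms that extend to a morphism $\tilde\varphi:P_nP\to P_nR$ of $\mathcal F$ with $\tilde\varphi(P_i)=P_i$ for all $i$. Let $M$ be an $\mathbb F_p\mathcal O^c(\mathcal F)$-module. For a class $c\in\overline{s}d(\mathcal F^c)$ let $\mathcal O_c$ be the category of pairs $(P,\rho)$ of a chain $\rho\in c$ and an $\mathcal F$-centric subgroup $P\le N_S(\rho)$; the morphisms $(P,\rho)\to(R,\rho')$ are the morphisms $P\to R$ of $\mathcal O^c(\mathcal F)$ that are represented by a morphism of $\mathcal F$ which extends to a morphism $\rho_{\max}P\to\rho'_{\max}R$ of $\mathcal F$ taking the members of $\rho$ to the members of $\rho'$, where $\rho_{\max}$ is the largest member of $\rho$. Passing to subchains gives functors $\mathcal O_c\to\mathcal O_d$ for $c\to d$, and so $c\mapsto \mathcal H^t_M(c):=H^t(\mathcal O_c;M)$ is a contravariant functor on $\overline{s}d(\mathcal F^c)$ for every $t\ge 0$. **Theorem.** (1) Every class in $\overline{s}d(\mathcal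 F^c)$ contains a fully normalized chain. (2) For a fully normalized chain $\sigma$, $\mathcal H^t_M([\sigma])$ is $H^t(\mathcal O^c(N_{\mathcal F}(\sigma));M)$ in the following sense. Let $\mathcal N_\sigma$ be the full subcategory of $\mathcal O^c(N_{\mathcal F}(\sigma))$ on the $\mathcal F$-centric subgroups of $N_S(\sigma)$. There are $\mathbb F_p\mathcal O^c(N_{\mathcal F}(\sigma))$-modules $M'$ with $M'|_{\mathcal N_\sigma}\cong M|_{\mathcal N_\sigma}$. For every $t\ge 0$ the restriction map $\mathcal H^t_M([\sigma])\to H^t(\mathcal N_\sigma;M)$ along $P\mapsto(P,\sigma)$ is an isomorphism, and for every such $M'$ and every isomorphism $M'|_{\mathcal N_\sigma}\cong M|_{\mathcal N_\sigma}$ there is an isomorphism $\mathcal H^t_M([\sigma])\cong H^t(\mathcal O^c(N_{\mathcal F}(\sigma));M')$ that is compatible with the restriction maps to $H^t(\mathcal N_\sigma;M)$. (3) There is a first quadrant cohomological spectral sequence of $\mathbb F_p$-vector spaces $$E_2^{s,t}\cong \lim_{\overline{s}d(\mathcal F^c)}{}^{\!s}\ \mathcal H^t_M\ =\ \lim_{[\sigma]\in\overline{s}d(\mathcal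 F^c)}{}^{\!\!\!s}\ H^t(\mathcal O^c(N_{\mathcal F}(\sigma));M)\ \Longrightarrow\ H^{s+t}(\mathcal O^c(\mathcal F);M).$$ Convergence means that every $H^n(\mathcal O^c(\mathcal F);M)$ has a decreasing filtration $H^n=F^0\supseteq F^1\supseteq\dots\supseteq F^{n+1}=0$ with $F^s/F^{s+1}\cong E_\infty^{s,n-s}$ for $0\le s\le n$. -/

import Mathlib

open CategoryTheory Limits Opposite

universe u

noncomputable section

/-! ### Cohomology of small categories -/

namespace CatCoh

/-- Right `kC`-modules: contravariant functors from `C` to `k`-modules. -/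
abbrev RMod (k : Type) [CommRing k] (C : Type u) [SmallCategory C] :=
  Cᵒᵖ ⥤ ModuleCat.{u} k

instance enoughInjectives_rmod (k : Type) [CommRing k] (C : Type u) [SmallCategory C] :
    EnoughInjectives (RMod k C) where
  presentation M := by
    refine ⟨⟨∏ᶜ fun x : Cᵒᵖ => (evaluationRightAdjoint (ModuleCat.{u} k) x).obj
        (Injective.under (M.obj x)), ?_,
      Pi.lift fun x => (evaluationAdjunctionLeft (ModuleCat.{u} k) x).homEquiv M _
        (Injective.ι (M.obj x)), ?_⟩⟩
    · have : ∀ x : Cᵒᵖ, Injective ((evaluationRightAdjoint (ModuleCat.{u} k) x).obj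
          (Injective.under (M.obj x))) := fun x =>
        Injective.injective_of_adjoint (evaluationAdjunctionLeft (ModuleCat.{u} k) x) _
      infer_instance
    · rw [NatTrans.mono_iff_mono_app]
      intro x
      set adj := evaluationAdjunctionLeft (ModuleCat.{u} k) x
      set l := Pi.lift fun x => (evaluationAdjunctionLeft (ModuleCat.{u} k) x).homEquiv M _
        (Injective.ι (M.obj x)) with hl
      have h : l ≫ Pi.π _ x = adj.homEquiv M _ (Injective.ι (M.obj x)) := Pi.lift_π _ _
      have h1 := (adj.homEquiv M _).symm_apply_apply (Injective.ι (M.obj x))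
      rw [← h, Adjunction.homEquiv_counit] at h1
      have h2 : l.app x ≫ ((Pi.π (fun x : Cᵒᵖ => (evaluationRightAdjoint (ModuleCat.{u} k) x).obj
        (Injective.under (M.obj x))) x).app x ≫ adj.counit.app _) = Injective.ι (M.obj x) := by
        rw [← Category.assoc]
        exact h1
      exact mono_of_mono_fac h2

instance hasExt_rmod (k : Type) [CommRing k] (C : Type u) [SmallCategory C] :
    HasExt.{u} (RMod k C) :=
  hasExt_of_enoughInjectives _

/-- The constant module with value `k`. -/
def constMod (k : Type) [CommRing k] (C : Type u) [SmallCategory C] : RMod k C :=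
  (Functor.const Cᵒᵖ).obj (ModuleCat.of k (ULift.{u} k))

/-- `H^n(C; M) = Ext^n_{kC}(k, M)`. These are also the higher limits `lim^n_C M`. -/
def coh {k : Type} [CommRing k] {C : Type u} [SmallCategory C] (M : RMod k C) (n : ℕ) :
    ModuleCat.{u} k :=
  ModuleCat.of k (Abelian.Ext.{u} (constMod k C) M n)

section functoriality

variable {k : Type} [CommRing k] {C : Type u} [SmallCategory C] {D : Type u} [SmallCategory D]
  {B : Type u} [SmallCategory B]

/-- Restriction of modules along a functor `K`. -/
abbrev res (k : Type) [CommRing k] (K : C ⥤ D) : RMod k D ⥤ RMod k C :=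
  (Functor.whiskeringLeft Cᵒᵖ Dᵒᵖ (ModuleCat.{u} k)).obj K.op

instance (K : C ⥤ D) : (res k K).Linear k where
  map_smul _ _ := by ext; rfl

/-- The identification of the constant module with the restriction of the constant module. -/
def constRes (k : Type) [CommRing k] (K : C ⥤ D) :
    constMod k C ⟶ (res k K).obj (constMod k D) where
  app _ := 𝟙 _
  naturality _ _ _ := rfl

/-- The map `H^n(D; N) ⟶ H^n(C; N')` induced by a functor `K : C ⥤ D` and a homomorphism
`α` from the restriction of `N` to `N'`: restrict along `K`, then compose with `α`. -/
def cohMap (K : C ⥤ D) {N : RMod k D} {N' : RMod k C} (α : K.op ⋙ N ⟶ N') (n : ℕ) :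
    coh N n ⟶ coh N' n :=
  ModuleCat.ofHom
    ((Abelian.Ext.postcompOfLinear (Abelian.Ext.mk₀ α) k (constMod k C) (add_zero n)) ∘ₗ
      (Abelian.Ext.precompOfLinear (Abelian.Ext.mk₀ (constRes k K)) k (K.op ⋙ N)
        (zero_add n)) ∘ₗ
      ((res k K).mapExtLinearMap k (constMod k D) N n))

lemma res_ext_id {X Y : RMod k C} {n : ℕ} (x : Abelian.Ext.{u} X Y n) :
    (x.mapExactFunctor (res k (𝟭 C)) : Abelian.Ext.{u} X Y n) = x := by
  induction n generalizing Y with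
  | zero =>
    obtain ⟨f, rfl⟩ := (Abelian.Ext.mk₀_bijective X Y).2 x
    exact Abelian.Ext.mapExactFunctor_mk₀ _ f
  | succ n ih =>
    let S := ShortComplex.mk (Injective.ι Y) (cokernel.π (Injective.ι Y)) (cokernel.condition _)
    have hS : S.ShortExact := { exact := ShortComplex.exact_cokernel _ }
    obtain ⟨z, rfl⟩ := Abelian.Ext.covariant_sequence_exact₁ X hS x
      (Abelian.Ext.eq_zero_of_injective _) rfl
    rw [Abelian.Ext.mapExactFunctor_comp, Abelian.Ext.mapExactFunctor_extClass]
    exact congrArg (fun w => Abelian.Ext.comp w hS.extClass rfl) (ih z)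

lemma res_ext_comp (K : C ⥤ D) (L : D ⥤ B) {X Y : RMod k B} {n : ℕ}
    (x : Abelian.Ext.{u} X Y n) :
    (x.mapExactFunctor (res k L)).mapExactFunctor (res k K) =
      x.mapExactFunctor (res k (K ⋙ L)) := by
  induction n generalizing Y with
  | zero =>
    obtain ⟨f, rfl⟩ := (Abelian.Ext.mk₀_bijective X Y).2 x
    rw [Abelian.Ext.mapExactFunctor_mk₀, Abelian.Ext.mapExactFunctor_mk₀,
      Abelian.Ext.mapExactFunctor_mk₀]
    rfl
  | succ n ih =>
    let S := ShortComplex.mk (Injective.ι Y) (cokernel.π (Injective.ι Y)) (cokernel.condition _)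
    have hS : S.ShortExact := { exact := ShortComplex.exact_cokernel _ }
    obtain ⟨z, rfl⟩ := Abelian.Ext.covariant_sequence_exact₁ X hS x
      (Abelian.Ext.eq_zero_of_injective _) rfl
    have e (F : RMod k B ⥤ RMod k D) [F.Additive] [PreservesFiniteLimits F]
        [PreservesFiniteColimits F] :
        (z.comp hS.extClass rfl).mapExactFunctor F =
          (z.mapExactFunctor F).comp (hS.map_of_exact F).extClass rfl :=
      (Abelian.Ext.mapExactFunctor_comp F z hS.extClass rfl).trans
        (congrArg (fun w => Abelian.Ext.comp (z.mapExactFunctor F) w rfl)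
          (Abelian.Ext.mapExactFunctor_extClass F hS))
    have e' : (z.comp hS.extClass rfl).mapExactFunctor (res k (K ⋙ L)) =
          (z.mapExactFunctor (res k (K ⋙ L))).comp
            (hS.map_of_exact (res k (K ⋙ L))).extClass rfl :=
      (Abelian.Ext.mapExactFunctor_comp _ z hS.extClass rfl).trans
        (congrArg (fun w => Abelian.Ext.comp (z.mapExactFunctor (res k (K ⋙ L))) w rfl)
          (Abelian.Ext.mapExactFunctor_extClass _ hS))
    have hL := hS.map_of_exact (res k L)
    have e'' : ((z.mapExactFunctor (res k L)).comp hL.extClass rfl).mapExactFunctor (res k K) =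
          ((z.mapExactFunctor (res k L)).mapExactFunctor (res k K)).comp
            (hL.map_of_exact (res k K)).extClass rfl :=
      (Abelian.Ext.mapExactFunctor_comp _ _ hL.extClass rfl).trans
        (congrArg (fun w => Abelian.Ext.comp
          ((z.mapExactFunctor (res k L)).mapExactFunctor (res k K)) w rfl)
          (Abelian.Ext.mapExactFunctor_extClass _ hL))
    refine (congrArg (Abelian.Ext.mapExactFunctor (res k K)) (e (res k L))).trans
      (e''.trans (Eq.trans ?_ e'.symm))
    exact congrArg (fun w => Abelian.Ext.comp w
      (hS.map_of_exact (res k (K ⋙ L))).extClass rfl) (ih z)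

lemma ext_assoc_aux {A : Type*} [Category* A] [Abelian A] [HasExt.{u} A] {X₁ X₂ X₃ Y₁ Y₂ Y₃ : A}
    {n : ℕ} (a : X₁ ⟶ X₂) (b : X₂ ⟶ X₃) (x : Abelian.Ext.{u} X₃ Y₁ n) (c : Y₁ ⟶ Y₂)
    (d : Y₂ ⟶ Y₃) :
    ((Abelian.Ext.mk₀ (a ≫ b)).comp x (zero_add n)).comp
        (Abelian.Ext.mk₀ (c ≫ d)) (add_zero n) =
      ((Abelian.Ext.mk₀ a).comp (((Abelian.Ext.mk₀ b).comp x (zero_add n)).comp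
        (Abelian.Ext.mk₀ c) (add_zero n)) (zero_add n)).comp
        (Abelian.Ext.mk₀ d) (add_zero n) := by
  rw [← Abelian.Ext.mk₀_comp_mk₀, ← Abelian.Ext.mk₀_comp_mk₀]
  simp

lemma cohMap_apply (K : C ⥤ D) {N : RMod k D} {N' : RMod k C} (α : K.op ⋙ N ⟶ N') (n : ℕ)
    (x : Abelian.Ext.{u} (constMod k D) N n) :
    (cohMap K α n).hom x = ((Abelian.Ext.mk₀ (constRes k K)).comp
      (x.mapExactFunctor (res k K)) (zero_add n)).comp (Abelian.Ext.mk₀ α) (add_zero n) := rfl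

lemma cohMap_id {N : RMod k C} (K : C ⥤ C) (h : K = 𝟭 C) (α : K.op ⋙ N ⟶ N)
    (hα : ∀ X : C, HEq (α.app (op X)) (𝟙 (N.obj (op X)))) (n : ℕ) :
    cohMap K α n = 𝟙 _ := by
  subst h
  have h1 : α = 𝟙 N := by
    ext X : 2
    exact eq_of_heq (hα X.unop)
  subst h1
  refine ModuleCat.hom_ext (LinearMap.ext fun (x : Abelian.Ext.{u} (constMod k C) N n) => ?_)
  exact (cohMap_apply _ _ n x).trans ((Abelian.Ext.comp_mk₀_id _).trans
    ((Abelian.Ext.mk₀_id_comp _).trans (res_ext_id x)))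

lemma cohMap_comp (K : C ⥤ D) (L : D ⥤ B) (T : C ⥤ B) (h : T = K ⋙ L)
    {N : RMod k B} {N' : RMod k D} {N'' : RMod k C}
    (α : L.op ⋙ N ⟶ N') (β : K.op ⋙ N' ⟶ N'') (γ : T.op ⋙ N ⟶ N'')
    (hγ : ∀ X : C, HEq (γ.app (op X)) (α.app (op (K.obj X)) ≫ β.app (op X))) (n : ℕ) :
    cohMap T γ n = cohMap L α n ≫ cohMap K β n := by
  subst h
  have h1 : γ = (res k K).map α ≫ β := by
    ext X : 2
    exact eq_of_heq (hγ X.unop)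
  have h2 : constRes k (K ⋙ L) = constRes k K ≫ (res k K).map (constRes k L) := by
    ext X : 2
    exact (Category.id_comp _).symm
  refine ModuleCat.hom_ext (LinearMap.ext fun (x : Abelian.Ext.{u} (constMod k B) N n) => ?_)
  have e1 : (((Abelian.Ext.mk₀ (constRes k L)).comp (x.mapExactFunctor (res k L))
      (zero_add n)).comp (Abelian.Ext.mk₀ α) (add_zero n)).mapExactFunctor (res k K) =
      ((Abelian.Ext.mk₀ ((res k K).map (constRes k L))).comp
        ((x.mapExactFunctor (res k L)).mapExactFunctor (res k K)) (zero_add n)).comp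
        (Abelian.Ext.mk₀ ((res k K).map α)) (add_zero n) :=
    (Abelian.Ext.mapExactFunctor_comp _ _ _ _).trans
      (congrArg₂ (fun y z => Abelian.Ext.comp y z (add_zero n))
        ((Abelian.Ext.mapExactFunctor_comp _ _ _ _).trans
          (congrArg (fun y => Abelian.Ext.comp y
            ((x.mapExactFunctor (res k L)).mapExactFunctor (res k K)) (zero_add n))
            (Abelian.Ext.mapExactFunctor_mk₀ _ _)))
        (Abelian.Ext.mapExactFunctor_mk₀ _ _))
  have e2 := ext_assoc_aux (constRes k K) ((res k K).map (constRes k L))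
    ((x.mapExactFunctor (res k L)).mapExactFunctor (res k K)) ((res k K).map α) β
  rw [← e1, res_ext_comp] at e2
  subst h1
  have a1 := cohMap_apply L α n x
  have a2 := cohMap_apply K β n (((Abelian.Ext.mk₀ (constRes k L)).comp
    (x.mapExactFunctor (res k L)) (zero_add n)).comp (Abelian.Ext.mk₀ α) (add_zero n))
  have a3 := (congrArg (fun y => (cohMap K β n).hom y) a1).trans a2
  have a4 := cohMap_apply (K ⋙ L) (N := N) ((res k K).map α ≫ β) n x
  rw [h2] at a4
  exact a4.trans (e2.trans a3.symm)

end functoriality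

end CatCoh

/-! ### Convergence of first quadrant cohomological spectral sequences -/

/-- A first quadrant spectral sequence `E` converges to `H`: every `H n` has a decreasing
filtration `H n = Fil 0 ⊇ Fil 1 ⊇ ⋯ ⊇ Fil (n + 1) = 0` with `Fil s / Fil (s + 1) ≅ E_∞^{s, n - s}`.
In the first quadrant, `E_∞^{s,t}` is `E_r^{s,t}` for any `r > max s (t + 1)`. -/
def SpectralSequenceConverges {k : Type} [CommRing k]
    (E : E₂CohomologicalSpectralSequenceNat (ModuleCat.{u} k)) (H : ℕ → ModuleCat.{u} k) : Prop :=
  ∀ n : ℕ, ∃ Fil : ℕ → Submodule k (H n), Antitone Fil ∧ Fil 0 = ⊤ ∧ Fil (n + 1) = ⊥ ∧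
    ∀ s t : ℕ, s + t = n → ∀ (r : ℤ) (hr : 2 ≤ r), (s : ℤ) < r → (t : ℤ) + 1 < r →
      Nonempty ((Fil s ⧸ (Fil (s + 1)).submoduleOf (Fil s)) ≃ₗ[k] (E.page r hr).X (s, t))

/-! ### Fusion systems -/

/-- A fusion system over the group `S` (a finite `p`-group in all applications). -/
structure FusionSystem (S : Type u) [Group S] where
  /-- the morphisms `P ⟶ Q` -/
  Mor (P Q : Subgroup S) : Set (P →* Q)
  injective_of_mem {P Q : Subgroup S} {f : P →* Q} (hf : f ∈ Mor P Q) : Function.Injective f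
  conj_mem {P Q : Subgroup S} (f : P →* Q) (s : S)
    (hf : ∀ x : P, (f x : S) = s * x * s⁻¹) : f ∈ Mor P Q
  comp_mem {P Q R : Subgroup S} {f : P →* Q} {g : Q →* R} (hf : f ∈ Mor P Q)
    (hg : g ∈ Mor Q R) : g.comp f ∈ Mor P R
  /-- the inverse `f(P) ⟶ P` of a morphism `f : P ⟶ Q` is a morphism -/
  inv_mem {P Q : Subgroup S} {f : P →* Q} (hf : f ∈ Mor P Q)
    (g : (Q.subtype.comp f).range →* P) (hg : ∀ x : P, g ⟨f x, x, rfl⟩ = x) : g ∈ Mor _ P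

namespace FusionSystem

section basic

variable {S : Type u} [Group S] (F : FusionSystem S)

lemma id_mem (P : Subgroup S) : MonoidHom.id P ∈ F.Mor P P :=
  F.conj_mem _ 1 (by simp)

lemma inclusion_mem {P Q : Subgroup S} (h : P ≤ Q) : Subgroup.inclusion h ∈ F.Mor P Q :=
  F.conj_mem _ 1 (by simp)

/-- The inverse of `f`, defined on the image of `f`. -/
def imageInv {P Q : Subgroup S} {f : P →* Q} (hf : Function.Injective f) :
    (Q.subtype.comp f).range →* P :=
  (MonoidHom.ofInjective (f := Q.subtype.comp f)
    (Q.subtype_injective.comp hf)).symm.toMonoidHom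

lemma imageInv_apply {P Q : Subgroup S} {f : P →* Q} (hf : Function.Injective f) (x : P) :
    imageInv hf ⟨f x, x, rfl⟩ = x :=
  (MonoidHom.ofInjective (f := Q.subtype.comp f)
    (Q.subtype_injective.comp hf)).symm_apply_apply x

variable {F}

lemma codRestrict_mem {P Q Q' : Subgroup S} {f : P →* Q} (hf : f ∈ F.Mor P Q) (g : P →* Q')
    (h : ∀ x, (g x : S) = f x) : g ∈ F.Mor P Q' := by
  have hfi := F.injective_of_mem hf
  have h1 := F.inv_mem hf (imageInv hfi) (imageInv_apply hfi)
  have h1i := F.injective_of_mem h1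
  have h2 := F.inv_mem h1 (imageInv h1i) (imageInv_apply h1i)
  have hP : P ≤ (P.subtype.comp (imageInv hfi)).range := fun x hx =>
    ⟨⟨f ⟨x, hx⟩, ⟨x, hx⟩, rfl⟩, congrArg Subtype.val (imageInv_apply hfi ⟨x, hx⟩)⟩
  have hQ : (Q.subtype.comp f).range ≤ Q' := by
    rintro _ ⟨x, rfl⟩
    change (f x : S) ∈ Q'
    rw [← h x]
    exact (g x).2
  have h3 := F.comp_mem (F.inclusion_mem hP) (F.comp_mem h2 (F.inclusion_mem hQ))
  convert h3 using 1
  ext x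
  have h4 := imageInv_apply h1i ⟨f x, x, rfl⟩
  have h5 : (⟨(imageInv hfi ⟨f x, x, rfl⟩ : P), ⟨f x, x, rfl⟩, rfl⟩ :
      (P.subtype.comp (imageInv hfi)).range) = Subgroup.inclusion hP x :=
    Subtype.ext (congrArg (fun w : P => (w : S)) (imageInv_apply hfi x))
  rw [h5] at h4
  rw [h x]
  exact (congrArg Subtype.val h4).symm

lemma restrict_mem {P Q P' Q' : Subgroup S} {f : P →* Q} (hf : f ∈ F.Mor P Q) (hP : P' ≤ P)
    (g : P' →* Q') (h : ∀ x : P', (g x : S) = f ⟨x, hP x.2⟩) : g ∈ F.Mor P' Q' :=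
  codRestrict_mem (F.comp_mem (F.inclusion_mem hP) hf) g h

/-- Restriction of `f : P ⟶ Q` to `P' ⟶ Q'`. -/
def restr {P Q P' Q' : Subgroup S} (f : P →* Q) (hP : P' ≤ P)
    (h : ∀ x : P', (f ⟨x, hP x.2⟩ : S) ∈ Q') : P' →* Q' :=
  (Q.subtype.comp (f.comp (Subgroup.inclusion hP))).codRestrict Q' h

lemma restr_coe {P Q P' Q' : Subgroup S} (f : P →* Q) (hP : P' ≤ P)
    (h : ∀ x : P', (f ⟨x, hP x.2⟩ : S) ∈ Q') (x : P') :
    (restr f hP h x : S) = f ⟨x, hP x.2⟩ := rfl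

lemma restr_mem {P Q P' Q' : Subgroup S} {f : P →* Q} (hf : f ∈ F.Mor P Q) (hP : P' ≤ P)
    (h : ∀ x : P', (f ⟨x, hP x.2⟩ : S) ∈ Q') : restr f hP h ∈ F.Mor P' Q' :=
  restrict_mem hf hP _ (restr_coe f hP h)

lemma inverse_mem {P Q P' Q' : Subgroup S} {f : P →* Q} (hf : f ∈ F.Mor P Q) (hP : P' ≤ P)
    (g : Q' →* P') (h : ∀ y : Q', (f ⟨g y, hP (g y).2⟩ : S) = y) : g ∈ F.Mor Q' P' := by
  have hfi := F.injective_of_mem hf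
  have h1 := F.inv_mem hf (imageInv hfi) (imageInv_apply hfi)
  have hQ : Q' ≤ (Q.subtype.comp f).range := fun y hy =>
    ⟨⟨g ⟨y, hy⟩, hP (g ⟨y, hy⟩).2⟩, h ⟨y, hy⟩⟩
  refine restrict_mem h1 hQ g fun y => ?_
  have h2 := imageInv_apply hfi ⟨g y, hP (g y).2⟩
  have h3 : (⟨(f ⟨g y, hP (g y).2⟩ : S), ⟨g y, hP (g y).2⟩, rfl⟩ :
      (Q.subtype.comp f).range) = ⟨y, hQ y.2⟩ := Subtype.ext (h y)
  rw [h3] at h2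
  exact (congrArg Subtype.val h2).symm

/-- The image `f(Q)` of a subgroup `Q` under `f : A ⟶ B`. -/
def img {A B : Subgroup S} (f : A →* B) (Q : Subgroup S) : Subgroup S :=
  (Q.subgroupOf A).map (B.subtype.comp f)

lemma mem_img {A B : Subgroup S} {f : A →* B} {Q : Subgroup S} {y : S} :
    y ∈ img f Q ↔ ∃ x : A, (x : S) ∈ Q ∧ (f x : S) = y := by
  simp [img, Subgroup.mem_subgroupOf]

lemma apply_mem_img {A B : Subgroup S} (f : A →* B) {Q : Subgroup S} {x : S} (hA : x ∈ A)
    (hx : x ∈ Q) : (f ⟨x, hA⟩ : S) ∈ img f Q :=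
  mem_img.2 ⟨⟨x, hA⟩, hx, rfl⟩

lemma exists_of_mem_img {A B : Subgroup S} {f : A →* B} {Q : Subgroup S} {y : S}
    (h : y ∈ img f Q) : ∃ (x : S) (hA : x ∈ A), x ∈ Q ∧ (f ⟨x, hA⟩ : S) = y := by
  obtain ⟨⟨x, hA⟩, hx, hy⟩ := mem_img.1 h
  exact ⟨x, hA, hx, hy⟩

lemma img_mono {A B : Subgroup S} (f : A →* B) {Q Q' : Subgroup S} (h : Q ≤ Q') :
    img f Q ≤ img f Q' := fun y hy => by
  obtain ⟨x, hx, rfl⟩ := mem_img.1 hy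
  exact mem_img.2 ⟨x, h hx, rfl⟩

lemma img_comp {A B D : Subgroup S} (f : A →* B) (g : B →* D) (Q : Subgroup S) :
    img (g.comp f) Q = img g (img f Q) := by
  ext y
  constructor
  · intro hy
    obtain ⟨x, hx, rfl⟩ := mem_img.1 hy
    exact mem_img.2 ⟨f x, mem_img.2 ⟨x, hx, rfl⟩, rfl⟩
  · intro hy
    obtain ⟨z, hz, rfl⟩ := mem_img.1 hy
    obtain ⟨x, hx, hxz⟩ := mem_img.1 hz
    exact mem_img.2 ⟨x, hx, congrArg (fun w => (g w : S)) (Subtype.ext hxz)⟩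

lemma img_congr {A B A' B' : Subgroup S} {f : A →* B} {g : A' →* B'} {Q : Subgroup S}
    (hA : Q ≤ A) (hA' : Q ≤ A')
    (h : ∀ x (hx : x ∈ Q), (f ⟨x, hA hx⟩ : S) = g ⟨x, hA' hx⟩) : img f Q = img g Q := by
  ext y
  rw [mem_img, mem_img]
  constructor
  · rintro ⟨x, hx, rfl⟩
    exact ⟨⟨x, hA' hx⟩, hx, (h x hx).symm⟩
  · rintro ⟨x, hx, rfl⟩
    exact ⟨⟨x, hA hx⟩, hx, h x hx⟩

lemma img_eq_self {A B : Subgroup S} {f : A →* B} {Q : Subgroup S} (hA : Q ≤ A)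
    (h : ∀ x (hx : x ∈ Q), (f ⟨x, hA hx⟩ : S) = x) : img f Q = Q := by
  ext y
  rw [mem_img]
  constructor
  · rintro ⟨x, hx, rfl⟩
    rw [h x hx]
    exact hx
  · intro hy
    exact ⟨⟨y, hA hy⟩, hy, h y hy⟩

lemma img_le {A B : Subgroup S} (f : A →* B) (Q : Subgroup S) : img f Q ≤ B := fun y hy => by
  obtain ⟨x, _, rfl⟩ := mem_img.1 hy
  exact (f x).2

lemma img_sup {A B : Subgroup S} (f : A →* B) {Q Q' : Subgroup S} (h : Q ≤ A) (h' : Q' ≤ A) :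
    img f (Q ⊔ Q') = img f Q ⊔ img f Q' := by
  rw [img, Subgroup.subgroupOf_sup h h', Subgroup.map_sup]
  rfl

lemma card_img {A B : Subgroup S} {f : A →* B} (hf : Function.Injective f) {Q : Subgroup S}
    (hQ : Q ≤ A) : Nat.card (img f Q) = Nat.card Q := by
  have e1 := (Subgroup.equivMapOfInjective (Q.subgroupOf A) (B.subtype.comp f)
    (B.subtype_injective.comp hf))
  have e2 := Subgroup.subgroupOfEquivOfLe hQ
  exact Nat.card_congr (e1.symm.trans e2).toEquiv

/-- An injective homomorphism with image `B` composed with its inverse: the inverse isomorphism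
of a bijective homomorphism of subgroups. -/
def inverseHom {A B : Subgroup S} (f : A →* B) (hf : Function.Bijective f) : B →* A :=
  (MulEquiv.ofBijective f hf).symm.toMonoidHom

lemma apply_inverseHom {A B : Subgroup S} (f : A →* B) (hf : Function.Bijective f) (y : B) :
    f (inverseHom f hf y) = y :=
  (MulEquiv.ofBijective f hf).apply_symm_apply y

lemma inverseHom_apply {A B : Subgroup S} (f : A →* B) (hf : Function.Bijective f) (x : A) :
    inverseHom f hf (f x) = x :=
  (MulEquiv.ofBijective f hf).symm_apply_apply x

lemma inverseHom_mem {A B : Subgroup S} {f : A →* B} (hf : f ∈ F.Mor A B)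
    (hb : Function.Bijective f) : inverseHom f hb ∈ F.Mor B A :=
  inverse_mem hf le_rfl _ fun y => congrArg Subtype.val (apply_inverseHom f hb y)

variable (F)

/-- `P` and `Q` are `F`-conjugate. -/
def IsConj (P Q : Subgroup S) : Prop :=
  ∃ f ∈ F.Mor P Q, Function.Surjective f

/-- `P` is fully normalized in `F`. -/
def IsFullyNormalized (P : Subgroup S) : Prop :=
  ∀ Q, F.IsConj P Q →
    Nat.card (Subgroup.normalizer (Q : Set S)) ≤ Nat.card (Subgroup.normalizer (P : Set S))

/-- `P` is fully centralized in `F`. -/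
def IsFullyCentralized (P : Subgroup S) : Prop :=
  ∀ Q, F.IsConj P Q →
    Nat.card (Subgroup.centralizer (Q : Set S)) ≤ Nat.card (Subgroup.centralizer (P : Set S))

/-- The group `Aut_F(P)`. -/
def autF (P : Subgroup S) : Subgroup (MulAut P) where
  carrier := {α | α.toMonoidHom ∈ F.Mor P P}
  one_mem' := F.id_mem P
  mul_mem' {_ _} ha hb := F.comp_mem hb ha
  inv_mem' {α} hα := inverse_mem hα le_rfl _ fun y =>
    congrArg Subtype.val (MulEquiv.apply_symm_apply α y)

/-- `P` is fully automized in `F`: the group `Aut_S(P)` is a Sylow `p`-subgroup of `Aut_F(P)`. -/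
def IsFullyAutomized (p : ℕ) (P : Subgroup S) : Prop :=
  ∃ T : Sylow p (F.autF P), (T : Subgroup (F.autF P)) =
    (Subgroup.normalizerMonoidHom P).range.subgroupOf (F.autF P)

/-- The subgroup `N_f` of `N_S(P)` for a homomorphism `f : P ⟶ Q`. -/
def extensionSubgroup {P Q : Subgroup S} (f : P →* Q) : Subgroup S where
  carrier := {x | x ∈ Subgroup.normalizer (P : Set S) ∧
    ∃ y ∈ Subgroup.normalizer (img f P : Set S), ∀ z w : P, (w : S) = x * z * x⁻¹ →
      (f w : S) = y * f z * y⁻¹}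
  one_mem' := ⟨one_mem _, 1, one_mem _, fun z w h => by
    have : w = z := Subtype.ext (by simpa using h)
    simp [this]⟩
  mul_mem' := by
    rintro a b ⟨ha, y, hy, h⟩ ⟨hb, y', hy', h'⟩
    refine ⟨mul_mem ha hb, y * y', mul_mem hy hy', fun z w hw => ?_⟩
    have hz : b * z * b⁻¹ ∈ P := (Subgroup.mem_normalizer_iff.1 hb z).1 z.2
    rw [h ⟨_, hz⟩ w (by rw [hw]; group), h' z ⟨_, hz⟩ rfl]
    group
  inv_mem' := by
    rintro a ⟨ha, y, hy, h⟩
    refine ⟨Subgroup.inv_mem _ ha, y⁻¹, Subgroup.inv_mem _ hy, fun z w hw => ?_⟩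
    rw [h w z (by rw [hw]; group)]
    group

/-- `Q` is receptive: every isomorphism `f : P ⟶ Q` in `F` extends to a morphism
`N_f ⟶ S` in `F`. -/
def IsReceptive (Q : Subgroup S) : Prop :=
  ∀ (P : Subgroup S), ∀ f ∈ F.Mor P Q, Function.Surjective f →
    ∃ g ∈ F.Mor (extensionSubgroup f) ⊤,
      ∀ (x : P) (y : extensionSubgroup f), (y : S) = x → (g y : S) = f x

/-- Saturation of a fusion system over a finite `p`-group. -/
structure IsSaturated (p : ℕ) : Prop where
  fullyCentralized (P : Subgroup S) : F.IsFullyNormalized P → F.IsFullyCentralized P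
  fullyAutomized (P : Subgroup S) : F.IsFullyNormalized P → F.IsFullyAutomized p P
  receptive (P : Subgroup S) : F.IsFullyCentralized P → F.IsReceptive P

/-- `P` is `F`-centric. -/
def IsCentric (P : Subgroup S) : Prop :=
  ∀ Q, F.IsConj P Q → Subgroup.centralizer (Q : Set S) ≤ Q

/-! ### Orbit categories -/

/-- Two morphisms `P ⟶ Q` are equivalent if they differ by an inner automorphism of `Q`. -/
def innSetoid (P Q : Subgroup S) : Setoid (F.Mor P Q) where
  r f g := ∃ q : Q, ∀ x, g.1 x = q * f.1 x * q⁻¹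
  iseqv :=
    { refl := fun f => ⟨1, by simp⟩
      symm := by
        rintro f g ⟨q, h⟩
        exact ⟨q⁻¹, fun x => by rw [h x]; group⟩
      trans := by
        rintro f g h ⟨q, h1⟩ ⟨q', h2⟩
        exact ⟨q' * q, fun x => by rw [h2, h1]; group⟩ }

/-- The objects of the full subcategory of the orbit category `𝒪(F)` given by a collection `C`. -/
structure Orb (F : FusionSystem S) (C : Subgroup S → Prop) where
  /-- the underlying subgroup -/
  grp : Subgroup S
  mem : C grp

variable {F} in
/-- The class in `Inn(Q) \ Mor_F(P, Q)` of a morphism. -/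
def orbMk {P Q : Subgroup S} (f : P →* Q) (hf : f ∈ F.Mor P Q) :
    Quotient (F.innSetoid P Q) :=
  Quotient.mk (F.innSetoid P Q) ⟨f, hf⟩

variable {F} in
lemma orbMk_eq {P Q : Subgroup S} {f g : P →* Q} {hf : f ∈ F.Mor P Q} {hg : g ∈ F.Mor P Q}
    (q : Q) (h : ∀ x, g x = q * f x * q⁻¹) : orbMk f hf = orbMk g hg :=
  Quotient.sound (s := F.innSetoid P Q) ⟨q, h⟩

/-- Composition of classes of morphisms. -/
def orbComp {P Q R : Subgroup S} (f : Quotient (F.innSetoid P Q))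
    (g : Quotient (F.innSetoid Q R)) : Quotient (F.innSetoid P R) :=
  Quotient.map₂ (sa := F.innSetoid P Q) (sb := F.innSetoid Q R) (sc := F.innSetoid P R)
    (fun f g => ⟨g.1.comp f.1, F.comp_mem f.2 g.2⟩)
    (by
      rintro f f' ⟨q, h⟩ g g' ⟨r, h'⟩
      refine ⟨r * g.1 q, fun x => ?_⟩
      simp only [MonoidHom.comp_apply, h', h, map_mul, map_inv]
      group) f g

instance orbCategory (C : Subgroup S → Prop) : SmallCategory (F.Orb C) where
  Hom P Q := Quotient (F.innSetoid P.grp Q.grp)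
  id P := orbMk (MonoidHom.id P.grp) (F.id_mem P.grp)
  comp f g := F.orbComp f g
  id_comp f := by
    induction f using Quotient.inductionOn with | _ f => rfl
  comp_id f := by
    induction f using Quotient.inductionOn with | _ f => rfl
  assoc f g h := by
    induction f using Quotient.inductionOn with | _ f =>
    induction g using Quotient.inductionOn with | _ g =>
    induction h using Quotient.inductionOn with | _ h => rfl

variable {F} in
/-- Inclusion of full subcategories of the orbit category. -/
def orbIncl {C C' : Subgroup S → Prop} (h : ∀ P, C P → C' P) : F.Orb C ⥤ F.Orb C' where
  obj P := ⟨P.grp, h _ P.mem⟩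
  map f := f

/-- The centric orbit category `𝒪^c(F)`. -/
abbrev CentricOrb := F.Orb F.IsCentric

end basic

/-! ### Chains of centric subgroups -/

section chains

variable {S : Type u} [Group S] (F : FusionSystem S)

/-- A nonempty chain `P₀ < ⋯ < Pₙ` of `F`-centric subgroups, as the set of its members. -/
@[ext]
structure Chain where
  /-- the set of members `P₀, …, Pₙ` -/
  carrier : Set (Subgroup S)
  nonempty : carrier.Nonempty
  isChain : IsChain (· ≤ ·) carrier
  centric : ∀ P ∈ carrier, F.IsCentric P

variable {F}

namespace Chain

/-- The largest member `Pₙ` of the chain. -/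
def top (σ : F.Chain) : Subgroup S := sSup σ.carrier

/-- `N_S(σ)`, the intersection of the normalizers of the members of `σ`. -/
def normalizer (σ : F.Chain) : Subgroup S :=
  ⨅ P ∈ σ.carrier, Subgroup.normalizer (P : Set S)

/-- `σ` and `τ` are `F`-conjugate: an isomorphism in `F` between the largest members carries the
members of `σ` to those of `τ`. -/
def IsConj (σ τ : F.Chain) : Prop :=
  ∃ f ∈ F.Mor σ.top τ.top, Function.Surjective f ∧ img f '' σ.carrier = τ.carrier

/-- `σ` is fully `F`-normalized. -/
def IsFullyNormalized (σ : F.Chain) : Prop :=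
  ∀ τ : F.Chain, σ.IsConj τ → Nat.card τ.normalizer ≤ Nat.card σ.normalizer

lemma le_top (σ : F.Chain) {P : Subgroup S} (h : P ∈ σ.carrier) : P ≤ σ.top := le_sSup h

lemma mem_normalizer {σ : F.Chain} {x : S} :
    x ∈ σ.normalizer ↔ ∀ P ∈ σ.carrier, x ∈ Subgroup.normalizer (P : Set S) := by
  simp [normalizer, Subgroup.mem_iInf]

lemma top_mem [Finite S] (σ : F.Chain) : σ.top ∈ σ.carrier := by
  obtain ⟨m, hm⟩ := (Set.toFinite σ.carrier).exists_maximal σ.nonempty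
  have h : ∀ x ∈ σ.carrier, x ≤ m := fun x hx => by
    rcases σ.isChain.total hx hm.1 with h | h
    · exact h
    · exact hm.2 hx h
  have : σ.top = m := le_antisymm (sSup_le h) (le_sSup hm.1)
  rw [this]
  exact hm.1

lemma normalizer_anti {σ τ : F.Chain} (h : τ.carrier ⊆ σ.carrier) :
    σ.normalizer ≤ τ.normalizer := fun _ hx =>
  mem_normalizer.2 fun P hP => mem_normalizer.1 hx P (h hP)

lemma isConj_of_img [Finite S] {A B : Subgroup S} {f : A →* B} (hf : f ∈ F.Mor A B)
    {σ τ : F.Chain} (hσ : σ.top ≤ A) (h : img f '' σ.carrier = τ.carrier) : σ.IsConj τ := by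
  have htop : img f σ.top = τ.top := by
    apply le_antisymm
    · apply τ.le_top
      rw [← h]
      exact ⟨_, σ.top_mem, rfl⟩
    · have := τ.top_mem
      rw [← h] at this
      obtain ⟨Q, hQ, hQ'⟩ := this
      rw [← hQ']
      exact img_mono f (σ.le_top hQ)
  have hg : ∀ x : σ.top, (f ⟨x, hσ x.2⟩ : S) ∈ τ.top := fun x => by
    rw [← htop]
    exact mem_img.2 ⟨_, x.2, rfl⟩
  refine ⟨restr f hσ hg, restr_mem hf hσ hg, fun y => ?_, ?_⟩
  · obtain ⟨x, hx, hxy⟩ := mem_img.1 (htop.ge y.2)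
    exact ⟨⟨x, hx⟩, Subtype.ext hxy⟩
  · rw [← h]
    refine Set.image_congr fun Q hQ => ?_
    exact img_congr (σ.le_top hQ) ((σ.le_top hQ).trans hσ) fun _ _ => rfl

lemma IsConj.refl [Finite S] (σ : F.Chain) : σ.IsConj σ :=
  isConj_of_img (F.id_mem σ.top) le_rfl (by
    conv_rhs => rw [← Set.image_id σ.carrier]
    exact Set.image_congr fun Q hQ => img_eq_self (σ.le_top hQ) fun _ _ => rfl)

lemma IsConj.trans [Finite S] {σ τ ρ : F.Chain} (h : σ.IsConj τ) (h' : τ.IsConj ρ) :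
    σ.IsConj ρ := by
  obtain ⟨f, hf, -, h1⟩ := h
  obtain ⟨g, hg, -, h2⟩ := h'
  refine isConj_of_img (F.comp_mem hf hg) le_rfl ?_
  rw [← h2, ← h1, Set.image_image]
  exact Set.image_congr fun Q _ => img_comp f g Q

lemma IsConj.symm [Finite S] {σ τ : F.Chain} (h : σ.IsConj τ) : τ.IsConj σ := by
  obtain ⟨f, hf, hs, h1⟩ := h
  have hb : Function.Bijective f := ⟨F.injective_of_mem hf, hs⟩
  refine isConj_of_img (inverseHom_mem hf hb) le_rfl ?_
  rw [← h1, Set.image_image]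
  conv_rhs => rw [← Set.image_id σ.carrier]
  refine Set.image_congr fun Q hQ => ?_
  rw [← img_comp]
  exact img_eq_self (σ.le_top hQ) fun x hx => congrArg Subtype.val (inverseHom_apply f hb _)

/-- A nonempty subset of the members of a chain, as a chain. -/
def sub (σ : F.Chain) (s : Set (Subgroup S)) (hs : s.Nonempty) (h : s ⊆ σ.carrier) :
    F.Chain where
  carrier := s
  nonempty := hs
  isChain := σ.isChain.mono h
  centric P hP := σ.centric P (h hP)

/-- A subchain is determined by its conjugacy class. -/
lemma eq_of_isConj [Finite S] {σ τ τ' : F.Chain} (h : τ.carrier ⊆ σ.carrier)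
    (h' : τ'.carrier ⊆ σ.carrier) (hc : τ.IsConj τ') : τ = τ' := by
  have key : ∀ {τ τ' : F.Chain}, τ.carrier ⊆ σ.carrier → τ'.carrier ⊆ σ.carrier →
      τ.IsConj τ' → τ.carrier ⊆ τ'.carrier := by
    rintro τ τ' h h' ⟨f, hf, -, h1⟩ Q hQ
    have hQ' : img f Q ∈ τ'.carrier := h1 ▸ ⟨Q, hQ, rfl⟩
    have hcard := card_img (F.injective_of_mem hf) (τ.le_top hQ)
    have : img f Q = Q := by
      rcases σ.isChain.total (h' hQ') (h hQ) with hle | hle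
      · exact Subgroup.eq_of_le_of_card_ge hle hcard.ge
      · exact (Subgroup.eq_of_le_of_card_ge hle hcard.le).symm
    rwa [this] at hQ'
  exact Chain.ext (Set.Subset.antisymm (key h h' hc) (key h' h hc.symm))

end Chain

/-- Conjugacy of chains. -/
instance chainSetoid [Finite S] (F : FusionSystem S) : Setoid F.Chain where
  r := Chain.IsConj
  iseqv := ⟨Chain.IsConj.refl, Chain.IsConj.symm, Chain.IsConj.trans⟩

variable (F) in
/-- The set of `F`-conjugacy classes of chains of `F`-centric subgroups. -/
def SdBar [Finite S] : Type u := Quotient (chainSetoid F)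

/-- The conjugacy class of a chain. -/
def Chain.cls [Finite S] (σ : F.Chain) : F.SdBar := Quotient.mk (chainSetoid F) σ

lemma Chain.cls_eq_iff [Finite S] {σ τ : F.Chain} : σ.cls = τ.cls ↔ σ.IsConj τ :=
  Quotient.eq (r := chainSetoid F)

/-- `c ≤ d` if every chain in `c` has a subchain in `d`; by `cls_le_cls_iff` this means
`[σ] ≤ [τ]` exactly when `τ` is conjugate to a subchain of `σ`. -/
instance sdBarPartialOrder [Finite S] : PartialOrder F.SdBar where
  le c d := ∀ σ : F.Chain, σ.cls = c → ∃ τ : F.Chain, τ.cls = d ∧ τ.carrier ⊆ σ.carrier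
  le_refl c σ h := ⟨σ, h, subset_rfl⟩
  le_trans c d e h h' σ hσ := by
    obtain ⟨τ, hτ, hs⟩ := h σ hσ
    obtain ⟨ρ, hρ, hs'⟩ := h' τ hτ
    exact ⟨ρ, hρ, hs'.trans hs⟩
  le_antisymm c d h h' := by
    obtain ⟨σ, rfl⟩ := Quotient.exists_rep (s := chainSetoid F) c
    obtain ⟨τ, hτ, hs⟩ := h σ rfl
    obtain ⟨ρ, hρ, hs'⟩ := h' τ hτ
    have e := Chain.eq_of_isConj (hs'.trans hs) subset_rfl (Chain.cls_eq_iff.1 hρ)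
    subst e
    rw [← hτ]
    exact congrArg Chain.cls (Chain.ext (Set.Subset.antisymm hs' hs))

lemma cls_le_cls_iff [Finite S] {σ τ : F.Chain} :
    σ.cls ≤ τ.cls ↔ ∃ τ' : F.Chain, τ.IsConj τ' ∧ τ'.carrier ⊆ σ.carrier := by
  constructor
  · intro h
    obtain ⟨τ', h1, h2⟩ := h σ rfl
    exact ⟨τ', Chain.cls_eq_iff.1 h1.symm, h2⟩
  · rintro ⟨τ', h1, h2⟩ σ' hσ'
    obtain ⟨f, hf, -, hc⟩ := Chain.cls_eq_iff.1 hσ'.symm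
    have hsub : img f '' τ'.carrier ⊆ σ'.carrier := by
      rw [← hc]
      exact Set.image_mono h2
    refine ⟨σ'.sub _ (τ'.nonempty.image _) hsub, Chain.cls_eq_iff.2 ?_, hsub⟩
    exact (h1.trans (Chain.isConj_of_img hf (sSup_le_sSup h2) rfl)).symm

/-! ### Normalizer fusion systems of chains -/

/-- `f : P ⟶ R` extends to a morphism `Pₙ P ⟶ Qₘ R` in `F` which carries the members
`P₀, …, Pₙ` of the chain `ρ` to the members `Q₀, …, Qₘ` of the chain `ρ'`. -/
def Carries (ρ ρ' : F.Chain) {P R : Subgroup S} (f : P →* R) : Prop :=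
  ∃ g ∈ F.Mor (ρ.top ⊔ P) (ρ'.top ⊔ R),
    (∀ (x : S) (hx : x ∈ P), (g ⟨x, Subgroup.mem_sup_right hx⟩ : S) = f ⟨x, hx⟩) ∧
    img g '' ρ.carrier = ρ'.carrier

/-- Conjugation by `s` as a homomorphism `A ⟶ B`. -/
def conjHom (s : S) {A B : Subgroup S} (h : A.map (MulAut.conj s).toMonoidHom ≤ B) : A →* B :=
  ((MulAut.conj s).toMonoidHom.comp A.subtype).codRestrict B
    fun x => h (Subgroup.mem_map_of_mem _ x.2)

lemma conjHom_apply (s : S) {A B : Subgroup S} (h : A.map (MulAut.conj s).toMonoidHom ≤ B)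
    (x : A) : (conjHom s h x : S) = s * x * s⁻¹ := rfl

lemma map_conj_of_mem {s : S} {Q : Subgroup S} (h : s ∈ Subgroup.normalizer (Q : Set S)) :
    Q.map (MulAut.conj s).toMonoidHom = Q := by
  ext y
  constructor
  · rintro ⟨x, hx, rfl⟩
    exact (Subgroup.mem_normalizer_iff.1 h x).1 hx
  · intro hy
    refine ⟨s⁻¹ * y * s, ?_, by simp [mul_assoc]⟩
    refine (Subgroup.mem_normalizer_iff.1 h _).2 ?_
    simpa [mul_assoc] using hy

lemma img_conjHom {s : S} {A B : Subgroup S} (h : A.map (MulAut.conj s).toMonoidHom ≤ B)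
    {Q : Subgroup S} (hQ : Q ≤ A) (hs : s ∈ Subgroup.normalizer (Q : Set S)) :
    img (conjHom s h) Q = Q := by
  conv_rhs => rw [← map_conj_of_mem hs]
  ext y
  rw [mem_img, Subgroup.mem_map]
  constructor
  · rintro ⟨x, hx, rfl⟩
    exact ⟨x, hx, rfl⟩
  · rintro ⟨x, hx, rfl⟩
    exact ⟨⟨x, hQ hx⟩, hx, rfl⟩

/-- The normalizer fusion system `N_F(σ)` over `N_S(σ)`: its morphisms `P ⟶ R` are the
homomorphisms which extend to a morphism `Pₙ P ⟶ Pₙ R` in `F` mapping each member `Pᵢ` of `σ`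
to itself. (Such homomorphisms are themselves morphisms in `F`.) -/
def normalizerSystem [Finite S] (σ : F.Chain) : FusionSystem σ.normalizer where
  Mor P R := {f | ∃ g ∈ F.Mor (σ.top ⊔ P.map σ.normalizer.subtype)
      (σ.top ⊔ R.map σ.normalizer.subtype),
    (∀ (x : σ.normalizer) (hx : x ∈ P),
      (g ⟨x, Subgroup.mem_sup_right (Subgroup.mem_map_of_mem _ hx)⟩ : S) =
        (f ⟨x, hx⟩ : σ.normalizer)) ∧
    ∀ Q ∈ σ.carrier, img g Q = Q}
  injective_of_mem := by
    rintro P Q f ⟨g, hg, h1, -⟩ ⟨x, hx⟩ ⟨x', hx'⟩ h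
    have e := F.injective_of_mem hg (Subtype.ext ((h1 x hx).trans
      ((congrArg (fun w : Q => ((w : σ.normalizer) : S)) h).trans (h1 x' hx').symm)))
    exact Subtype.ext (Subtype.ext (Subtype.mk.inj e))
  conj_mem := by
    intro P R f s hf
    have hs := Chain.mem_normalizer.1 s.2
    have hle : (σ.top ⊔ P.map σ.normalizer.subtype).map (MulAut.conj (s : S)).toMonoidHom ≤
        σ.top ⊔ R.map σ.normalizer.subtype := by
      rw [Subgroup.map_sup, map_conj_of_mem (hs _ σ.top_mem)]
      refine sup_le_sup_left ?_ _
      rintro _ ⟨_, ⟨x, hx, rfl⟩, rfl⟩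
      refine ⟨f ⟨x, hx⟩, (f ⟨x, hx⟩).2, ?_⟩
      rw [hf]
      rfl
    refine ⟨conjHom (s : S) hle, F.conj_mem _ (s : S) (conjHom_apply (s : S) hle),
      fun x hx => ?_,
      fun Q hQ => img_conjHom hle ((σ.le_top hQ).trans le_sup_left) (hs Q hQ)⟩
    rw [conjHom_apply, hf]
    rfl
  comp_mem := by
    rintro P Q R f f' ⟨g, hg, h1, h2⟩ ⟨g', hg', h1', h2'⟩
    refine ⟨g'.comp g, F.comp_mem hg hg', fun x hx => ?_, fun T hT => ?_⟩
    · rw [MonoidHom.comp_apply, MonoidHom.comp_apply]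
      refine Eq.trans ?_ (h1' (f ⟨x, hx⟩) (f ⟨x, hx⟩).2)
      exact congrArg (fun w => (g' w : S)) (Subtype.ext (h1 x hx))
    · rw [img_comp, h2 T hT, h2' T hT]
  inv_mem := by
    rintro P R f ⟨g, hg, h1, h2⟩ f' hf'
    have hgi := F.injective_of_mem hg
    have hle : σ.top ⊔ ((R.subtype.comp f).range).map σ.normalizer.subtype ≤
        ((σ.top ⊔ R.map σ.normalizer.subtype).subtype.comp g).range := by
      refine sup_le ?_ ?_
      · intro y hy
        rw [← h2 _ σ.top_mem] at hy
        obtain ⟨x, hA, -, hx⟩ := exists_of_mem_img hy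
        exact ⟨⟨x, hA⟩, hx⟩
      · rintro _ ⟨_, ⟨⟨x, hx⟩, rfl⟩, rfl⟩
        exact ⟨_, h1 x hx⟩
    have hinv := F.inv_mem hg (imageInv hgi) (imageInv_apply hgi)
    have key : ∀ (x : ↥(σ.top ⊔ P.map σ.normalizer.subtype)) (y : S)
        (hy : y ∈ σ.top ⊔ ((R.subtype.comp f).range).map σ.normalizer.subtype),
        y = g x → imageInv hgi (Subgroup.inclusion hle ⟨y, hy⟩) = x := by
      rintro x y hy rfl
      exact imageInv_apply hgi x
    refine ⟨(imageInv hgi).comp (Subgroup.inclusion hle),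
      F.comp_mem (F.inclusion_mem hle) hinv, ?_, fun Q hQ => ?_⟩
    · rintro _ ⟨⟨x, hx⟩, rfl⟩
      have e := key _ _ (Subgroup.mem_sup_right (Subgroup.mem_map_of_mem _ ⟨⟨x, hx⟩, rfl⟩))
        (h1 x hx).symm
      exact (congrArg (fun w : ↥(σ.top ⊔ P.map σ.normalizer.subtype) => (w : S)) e).trans
        (congrArg (fun w : P => ((w : σ.normalizer) : S)) (hf' ⟨x, hx⟩).symm)
    · ext y
      constructor
      · intro hy
        obtain ⟨w, hA, hw, rfl⟩ := exists_of_mem_img hy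
        rw [← h2 Q hQ] at hw
        obtain ⟨x, hA', hx, hxw⟩ := exists_of_mem_img hw
        rw [MonoidHom.comp_apply, key ⟨x, hA'⟩ w hA hxw.symm]
        exact hx
      · intro hy
        have hy' : y ∈ σ.top ⊔ P.map σ.normalizer.subtype :=
          Subgroup.mem_sup_left (σ.le_top hQ hy)
        have hgy : (g ⟨y, hy'⟩ : S) ∈ Q := (h2 Q hQ).le (apply_mem_img g hy' hy)
        refine mem_img.2 ⟨⟨g ⟨y, hy'⟩, Subgroup.mem_sup_left (σ.le_top hQ hgy)⟩, hgy, ?_⟩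
        rw [MonoidHom.comp_apply, key ⟨y, hy'⟩ _ _ rfl]

/-- The class `[σ]` seen as a category: its objects are pairs `(P, ρ)` of an `F`-centric subgroup
`P` and a chain `ρ` in the class `c` which is normalized by `P`. -/
structure ChainOrb [Finite S] (c : F.SdBar) where
  /-- the centric subgroup -/
  orb : F.CentricOrb
  /-- the chain -/
  chain : F.Chain
  cls_eq : chain.cls = c
  le : orb.grp ≤ chain.normalizer

lemma Carries.id (ρ : F.Chain) (P : Subgroup S) : Carries ρ ρ (MonoidHom.id P) :=
  ⟨MonoidHom.id _, F.id_mem _, fun _ _ => rfl, by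
    conv_rhs => rw [← Set.image_id ρ.carrier]
    exact Set.image_congr fun Q hQ =>
      img_eq_self ((ρ.le_top hQ).trans le_sup_left) fun _ _ => rfl⟩

lemma Carries.comp {ρ ρ' ρ'' : F.Chain} {P Q R : Subgroup S} {f : P →* Q} {f' : Q →* R}
    (h : Carries ρ ρ' f) (h' : Carries ρ' ρ'' f') : Carries ρ ρ'' (f'.comp f) := by
  obtain ⟨g, hg, h1, h2⟩ := h
  obtain ⟨g', hg', h1', h2'⟩ := h'
  refine ⟨g'.comp g, F.comp_mem hg hg', fun x hx => ?_, ?_⟩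
  · rw [MonoidHom.comp_apply, MonoidHom.comp_apply]
    refine Eq.trans ?_ (h1' (f ⟨x, hx⟩) (f ⟨x, hx⟩).2)
    exact congrArg (fun w => (g' w : S)) (Subtype.ext (h1 x hx))
  rw [← h2', ← h2, Set.image_image]
  exact Set.image_congr fun T _ => img_comp g g' T

/-- Morphisms `(P, ρ) ⟶ (R, ρ')` are the morphisms `P ⟶ R` of the orbit category represented by
morphisms of `F` which carry `ρ` to `ρ'`. -/
@[ext]
structure ChainOrbHom [Finite S] {c : F.SdBar} (x y : ChainOrb c) where
  /-- the morphism in the orbit category -/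
  hom : x.orb ⟶ y.orb
  carries : ∃ (f : x.orb.grp →* y.orb.grp) (hf : f ∈ F.Mor x.orb.grp y.orb.grp),
    hom = orbMk f hf ∧ Carries x.chain y.chain f

instance chainOrbCategory [Finite S] (c : F.SdBar) : SmallCategory (ChainOrb c) where
  Hom x y := ChainOrbHom x y
  id x := ⟨𝟙 x.orb, MonoidHom.id _, F.id_mem _, rfl, Carries.id _ _⟩
  comp {x y z} a b := ⟨a.hom ≫ b.hom, by
    obtain ⟨f, hf, e, h⟩ := a.carries
    obtain ⟨f', hf', e', h'⟩ := b.carries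
    refine ⟨f'.comp f, F.comp_mem hf hf', ?_, h.comp h'⟩
    rw [e, e']
    rfl⟩
  id_comp a := ChainOrbHom.ext (Category.id_comp a.hom)
  comp_id a := ChainOrbHom.ext (Category.comp_id a.hom)
  assoc a b d := ChainOrbHom.ext (Category.assoc a.hom b.hom d.hom)

/-- The functor `(P, ρ) ↦ P` to the centric orbit category. -/
def chainOrbForget [Finite S] (c : F.SdBar) : ChainOrb c ⥤ F.CentricOrb where
  obj x := x.orb
  map a := a.hom

/-- The subchain of `ρ` in the class `d`. -/
def subchain [Finite S] {c d : F.SdBar} (h : c ≤ d) (ρ : F.Chain) (hρ : ρ.cls = c) : F.Chain :=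
  (h ρ hρ).choose

lemma subchain_cls [Finite S] {c d : F.SdBar} (h : c ≤ d) (ρ : F.Chain) (hρ : ρ.cls = c) :
    (subchain h ρ hρ).cls = d :=
  (h ρ hρ).choose_spec.1

lemma subchain_subset [Finite S] {c d : F.SdBar} (h : c ≤ d) (ρ : F.Chain) (hρ : ρ.cls = c) :
    (subchain h ρ hρ).carrier ⊆ ρ.carrier :=
  (h ρ hρ).choose_spec.2

lemma eq_subchain [Finite S] {c d : F.SdBar} (h : c ≤ d) (ρ : F.Chain) (hρ : ρ.cls = c)
    (τ : F.Chain) (hτ : τ.cls = d) (hs : τ.carrier ⊆ ρ.carrier) : subchain h ρ hρ = τ :=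
  Chain.eq_of_isConj (subchain_subset h ρ hρ) hs
    (Chain.cls_eq_iff.1 ((subchain_cls h ρ hρ).trans hτ.symm))

lemma Carries.mono [Finite S] {ρ ρ' τ τ' : F.Chain} {P R : Subgroup S} {f : P →* R}
    (hsub : τ.carrier ⊆ ρ.carrier) {g : ↥(ρ.top ⊔ P) →* ↥(ρ'.top ⊔ R)}
    (hg : g ∈ F.Mor (ρ.top ⊔ P) (ρ'.top ⊔ R))
    (h1 : ∀ (x : S) (hx : x ∈ P), (g ⟨x, Subgroup.mem_sup_right hx⟩ : S) = f ⟨x, hx⟩)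
    (h2 : img g '' τ.carrier = τ'.carrier) : Carries τ τ' f := by
  have htop : τ.top ≤ ρ.top := sSup_le_sSup hsub
  have hle : τ.top ⊔ P ≤ ρ.top ⊔ P := sup_le_sup_right htop P
  have hmem : img g τ.top ∈ τ'.carrier := h2 ▸ ⟨_, τ.top_mem, rfl⟩
  have himg' : img g (τ.top ⊔ P) ≤ τ'.top ⊔ R := by
    rw [img_sup g (htop.trans le_sup_left) le_sup_right]
    refine sup_le_sup (τ'.le_top hmem) fun y hy => ?_
    obtain ⟨x, hA, hx, rfl⟩ := exists_of_mem_img hy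
    rw [h1 x hx]
    exact (f ⟨x, hx⟩).2
  have hm : ∀ x : ↥(τ.top ⊔ P), (g ⟨x, hle x.2⟩ : S) ∈ τ'.top ⊔ R := fun x =>
    himg' (apply_mem_img g (hle x.2) x.2)
  refine ⟨restr g hle hm, restr_mem hg hle hm,
    fun x hx => (restr_coe g hle hm _).trans (h1 x hx), ?_⟩
  rw [← h2]
  refine Set.image_congr fun Q hQ => ?_
  exact img_congr ((τ.le_top hQ).trans le_sup_left)
    (((τ.le_top hQ).trans htop).trans le_sup_left) fun _ _ => restr_coe g hle hm _

lemma Carries.subchain [Finite S] {c d : F.SdBar} (h : c ≤ d) {ρ ρ' : F.Chain}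
    (hρ : ρ.cls = c) (hρ' : ρ'.cls = c) {P R : Subgroup S} {f : P →* R}
    (hf : Carries ρ ρ' f) :
    Carries (FusionSystem.subchain h ρ hρ) (FusionSystem.subchain h ρ' hρ') f := by
  obtain ⟨g, hg, h1, h2⟩ := hf
  have hcls := subchain_cls h ρ hρ
  have hsub := subchain_subset h ρ hρ
  generalize FusionSystem.subchain h ρ hρ = τ at hcls hsub
  have himg : img g '' τ.carrier ⊆ ρ'.carrier := by
    rw [← h2]
    exact Set.image_mono hsub
  obtain ⟨τ', hτ'⟩ : ∃ τ' : F.Chain, img g '' τ.carrier = τ'.carrier :=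
    ⟨ρ'.sub (img g '' τ.carrier) (τ.nonempty.image _) himg, rfl⟩
  have hconj : τ.IsConj τ' :=
    Chain.isConj_of_img hg ((sSup_le_sSup hsub).trans le_sup_left) hτ'
  rw [eq_subchain h ρ' hρ' τ' ((Chain.cls_eq_iff.2 hconj).symm.trans hcls) (hτ' ▸ himg)]
  exact Carries.mono hsub hg h1 hτ'

/-- For `c ≤ d`, the functor `(P, ρ) ↦ (P, ρ')` where `ρ'` is the subchain of `ρ` in `d`. -/
def chainOrbRes [Finite S] {c d : F.SdBar} (h : c ≤ d) : ChainOrb c ⥤ ChainOrb d where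
  obj x := ⟨x.orb, subchain h x.chain x.cls_eq, subchain_cls _ _ _,
    x.le.trans (Chain.normalizer_anti (subchain_subset _ _ _))⟩
  map {x y} a := ⟨a.hom, by
    obtain ⟨f, hf, e, hc⟩ := a.carries
    exact ⟨f, hf, e, hc.subchain h x.cls_eq y.cls_eq⟩⟩

lemma chainOrb_eq [Finite S] {c : F.SdBar} {x y : ChainOrb c} (h1 : x.orb = y.orb)
    (h2 : x.chain = y.chain) : x = y := by
  cases x
  cases y
  cases h1
  cases h2
  rfl

lemma chainOrb_hom_eq [Finite S] {c : F.SdBar} {x x' y y' : ChainOrb c} (hx : x = x')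
    (hy : y = y') (a : x ⟶ y) (b : x' ⟶ y') (h : HEq a.hom b.hom) :
    a = eqToHom hx ≫ b ≫ eqToHom hy.symm := by
  subst hx hy
  rw [eqToHom_refl, eqToHom_refl, Category.id_comp, Category.comp_id]
  exact ChainOrbHom.ext (eq_of_heq h)

lemma chainOrbRes_refl_obj [Finite S] {c : F.SdBar} (h : c ≤ c) (x : ChainOrb c) :
    (chainOrbRes h).obj x = x :=
  chainOrb_eq rfl (eq_subchain h x.chain x.cls_eq x.chain x.cls_eq subset_rfl)

lemma chainOrbRes_refl [Finite S] {c : F.SdBar} (h : c ≤ c) : chainOrbRes h = 𝟭 (ChainOrb c) :=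
  CategoryTheory.Functor.ext (chainOrbRes_refl_obj h) fun x y a =>
    chainOrb_hom_eq (chainOrbRes_refl_obj h x) (chainOrbRes_refl_obj h y) _ a HEq.rfl

lemma chainOrbRes_trans_obj [Finite S] {c d e : F.SdBar} (h : c ≤ d) (h' : d ≤ e) (h'' : c ≤ e)
    (x : ChainOrb c) :
    (chainOrbRes h'').obj x = (chainOrbRes h').obj ((chainOrbRes h).obj x) :=
  chainOrb_eq rfl
    (eq_subchain h'' x.chain x.cls_eq _ (subchain_cls h' _ (subchain_cls h _ x.cls_eq))
      ((subchain_subset h' _ (subchain_cls h _ x.cls_eq)).trans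
        (subchain_subset h _ x.cls_eq)))

lemma chainOrbRes_trans [Finite S] {c d e : F.SdBar} (h : c ≤ d) (h' : d ≤ e) (h'' : c ≤ e) :
    chainOrbRes h'' = chainOrbRes h ⋙ chainOrbRes h' :=
  CategoryTheory.Functor.ext (chainOrbRes_trans_obj h h' h'') fun x y a =>
    chainOrb_hom_eq (chainOrbRes_trans_obj h h' h'' x) (chainOrbRes_trans_obj h h' h'' y) _
      ((chainOrbRes h').map ((chainOrbRes h).map a)) HEq.rfl

/-- The coefficient system `[σ] ↦ H^t([σ]; M)` on the poset of conjugacy classes of chains, where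
the class `[σ]` is seen as a category. -/
def normalizerCoeff [Finite S] {k : Type} [CommRing k] (M : CatCoh.RMod k F.CentricOrb) (t : ℕ) :
    CatCoh.RMod k F.SdBar where
  obj c := CatCoh.coh ((chainOrbForget c.unop).op ⋙ M) t
  map {c d} a := CatCoh.cohMap (chainOrbRes (leOfHom a.unop))
    (N := (chainOrbForget c.unop).op ⋙ M) (N' := (chainOrbForget d.unop).op ⋙ M)
    { app := fun x => 𝟙 (M.obj (op x.unop.orb))
      naturality := fun _ _ _ => (Category.comp_id _).trans (Category.id_comp _).symm } t
  map_id _ := CatCoh.cohMap_id _ (chainOrbRes_refl _) _ (fun _ => HEq.rfl) t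
  map_comp _ _ :=
    CatCoh.cohMap_comp _ _ _ (chainOrbRes_trans _ _ _) _ _ _
      (fun _ => heq_of_eq (Category.id_comp _).symm) t

/-! ### Comparison with the orbit categories of the normalizer fusion systems -/

/-- A homomorphism of subgroups of `N` as a homomorphism of subgroups of `S`. -/
def liftHom {N : Subgroup S} {P R : Subgroup N} (f : P →* R) :
    P.map N.subtype →* R.map N.subtype :=
  (R.equivMapOfInjective N.subtype N.subtype_injective).toMonoidHom.comp
    (f.comp (P.equivMapOfInjective N.subtype N.subtype_injective).symm.toMonoidHom)

lemma liftHom_apply {N : Subgroup S} {P R : Subgroup N} (f : P →* R) (x : P) :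
    liftHom f (P.equivMapOfInjective N.subtype N.subtype_injective x) =
      R.equivMapOfInjective N.subtype N.subtype_injective (f x) := by
  simp [liftHom]

lemma liftHom_coe {N : Subgroup S} {P R : Subgroup N} (f : P →* R) (x : P)
    (y : P.map N.subtype) (h : (y : S) = (x : N)) :
    (liftHom f y : S) = (f x : N) := by
  have : y = P.equivMapOfInjective N.subtype N.subtype_injective x := Subtype.ext h
  rw [this, liftHom_apply]
  rfl

lemma exists_eq_coe {N : Subgroup S} {P : Subgroup N} (y : P.map N.subtype) :
    ∃ x : P, (y : S) = (x : N) := by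
  obtain ⟨_, x, hx, rfl⟩ := y
  exact ⟨⟨x, hx⟩, rfl⟩

lemma liftHom_mem [Finite S] {σ : F.Chain} {P R : Subgroup σ.normalizer} {f : P →* R}
    (hf : f ∈ (normalizerSystem σ).Mor P R) : liftHom f ∈ F.Mor _ _ := by
  obtain ⟨g, hg, h1, -⟩ := hf
  refine restrict_mem hg le_sup_right _ ?_
  rintro ⟨_, x, hx, rfl⟩
  exact (liftHom_coe f ⟨x, hx⟩ _ rfl).trans (h1 x hx).symm

lemma carries_liftHom [Finite S] {σ : F.Chain} {P R : Subgroup σ.normalizer} {f : P →* R}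
    (hf : f ∈ (normalizerSystem σ).Mor P R) : Carries σ σ (liftHom f) := by
  obtain ⟨g, hg, h1, h2⟩ := hf
  refine ⟨g, hg, ?_, ?_⟩
  · rintro _ ⟨x, hx, rfl⟩
    exact (h1 x hx).trans (liftHom_coe f ⟨x, hx⟩ _ rfl).symm
  · conv_rhs => rw [← Set.image_id σ.carrier]
    exact Set.image_congr h2

/-- A subgroup of `N_S(σ)` which is `F`-centric is `N_F(σ)`-centric. -/
lemma isCentric_normalizerSystem [Finite S] (σ : F.Chain) (P : Subgroup σ.normalizer)
    (h : F.IsCentric (P.map σ.normalizer.subtype)) : (normalizerSystem σ).IsCentric P := by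
  rintro Q ⟨f, hf, hs⟩ z hz
  have hc : F.IsConj (P.map σ.normalizer.subtype) (Q.map σ.normalizer.subtype) := by
    refine ⟨liftHom f, liftHom_mem hf, fun y => ?_⟩
    obtain ⟨x', hx'⟩ := exists_eq_coe y
    obtain ⟨x, rfl⟩ := hs x'
    exact ⟨P.equivMapOfInjective _ σ.normalizer.subtype_injective x, by
      rw [liftHom_apply]
      exact Subtype.ext hx'.symm⟩
  have hz' : (z : S) ∈ Subgroup.centralizer (Q.map σ.normalizer.subtype : Set S) := by
    rw [Subgroup.mem_centralizer_iff] at hz ⊢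
    rintro _ ⟨w, hw, rfl⟩
    exact congrArg Subtype.val (hz w hw)
  obtain ⟨w, hw, hwz⟩ := h _ hc hz'
  have : w = z := Subtype.ext hwz
  exact this ▸ hw

/-- The full subcategory of the orbit category of `N_F(σ)` on the subgroups of `N_S(σ)` which are
`F`-centric. -/
abbrev NormOrb [Finite S] (σ : F.Chain) :=
  (normalizerSystem σ).Orb fun P => F.IsCentric (P.map σ.normalizer.subtype)

/-- Its inclusion into the centric orbit category `𝒪^c(N_F(σ))`. -/
def normOrbIncl [Finite S] (σ : F.Chain) : NormOrb σ ⥤ (normalizerSystem σ).CentricOrb :=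
  orbIncl (isCentric_normalizerSystem σ)

/-- The functor `P ↦ (P, σ)`. -/
def normOrbToChainOrb [Finite S] (σ : F.Chain) : NormOrb σ ⥤ ChainOrb σ.cls where
  obj P := ⟨⟨P.grp.map σ.normalizer.subtype, P.mem⟩, σ, rfl, Subgroup.map_subtype_le _⟩
  map {P R} a := ⟨Quotient.map (sa := (normalizerSystem σ).innSetoid P.grp R.grp)
      (sb := F.innSetoid _ _) (fun f => ⟨liftHom f.1, liftHom_mem f.2⟩)
      (by
        rintro f g ⟨q, h⟩
        refine ⟨R.grp.equivMapOfInjective _ σ.normalizer.subtype_injective q, fun y => ?_⟩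
        obtain ⟨x, hx⟩ := exists_eq_coe y
        obtain rfl : y = P.grp.equivMapOfInjective _ σ.normalizer.subtype_injective x :=
          Subtype.ext hx
        simp only [liftHom_apply, h, map_mul, map_inv]) a, by
    induction a using Quotient.inductionOn with | _ f =>
    exact ⟨liftHom f.1, liftHom_mem f.2, rfl, carries_liftHom f.2⟩⟩
  map_id P := by
    refine ChainOrbHom.ext (Quotient.sound (s := F.innSetoid _ _) ⟨1, fun y => ?_⟩)
    obtain ⟨x, hx⟩ := exists_eq_coe y
    obtain rfl : y = P.grp.equivMapOfInjective _ σ.normalizer.subtype_injective x :=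
      Subtype.ext hx
    simp [liftHom_apply]
  map_comp {P Q R} a b := by
    induction a using Quotient.inductionOn with | _ f =>
    induction b using Quotient.inductionOn with | _ g =>
    refine ChainOrbHom.ext (Quotient.sound (s := F.innSetoid _ _) ⟨1, fun y => ?_⟩)
    obtain ⟨x, hx⟩ := exists_eq_coe y
    obtain rfl : y = P.grp.equivMapOfInjective _ σ.normalizer.subtype_injective x :=
      Subtype.ext hx
    simp [liftHom_apply]

/-- The functor from `NormOrb σ` to the centric orbit category of `F`, `P ↦ P`. -/
def normOrbForget [Finite S] (σ : F.Chain) : NormOrb σ ⥤ F.CentricOrb :=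
  normOrbToChainOrb σ ⋙ chainOrbForget σ.cls

/-- The restriction map `H^t([σ]; M) ⟶ H^t(NormOrb σ; M)`. -/
def classRes [Finite S] {k : Type} [CommRing k] (M : CatCoh.RMod k F.CentricOrb) (σ : F.Chain)
    (t : ℕ) :
    (normalizerCoeff M t).obj (op σ.cls) ⟶ CatCoh.coh ((normOrbForget σ).op ⋙ M) t :=
  CatCoh.cohMap (normOrbToChainOrb σ) (N := (chainOrbForget σ.cls).op ⋙ M)
    (𝟙 ((normOrbForget σ).op ⋙ M)) t

/-- The restriction map `H^t(𝒪^c(N_F(σ)); M') ⟶ H^t(NormOrb σ; M)` for a module `M'` over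
`𝒪^c(N_F(σ))` which agrees with `M` on the `F`-centric subgroups of `N_S(σ)`. -/
def centricRes [Finite S] {k : Type} [CommRing k] (M : CatCoh.RMod k F.CentricOrb) (σ : F.Chain)
    (M' : CatCoh.RMod k (normalizerSystem σ).CentricOrb)
    (e : (normOrbIncl σ).op ⋙ M' ≅ (normOrbForget σ).op ⋙ M) (t : ℕ) :
    CatCoh.coh M' t ⟶ CatCoh.coh ((normOrbForget σ).op ⋙ M) t :=
  CatCoh.cohMap (normOrbIncl σ) e.hom t

end chains

end FusionSystem

end

-- The spectral sequence is the Leray spectral sequence of a projection to `SdBar`. Let X be the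
-- category `ChainPair` of pairs (P, ρ), where ρ is a chain of centric subgroups and P is a centric
-- subgroup of N_S(ρ); its morphisms (P, ρ) → (Q, ρ') are the morphisms P → Q of the orbit category
-- that carry some subchain of ρ to ρ'. It projects to `SdBar` by (P, ρ) ↦ [ρ] and to 𝒪^c(F) by (P,
-- ρ) ↦ P.
--
-- For a functor π : C → J, restriction of modules is exact and has a right adjoint R, the right Kan
-- extension, which therefore preserves injectives. If I is an injective resolution of N, then R I
-- is a bounded below complex of injectives, and morphisms from the constant module to its shifts in
-- the derived category are H^*(C; N). Truncating R I gives a hyper-Ext spectral sequence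
-- (`exists_hyperExt_spectralSequence`). The t-th cohomology of R I at c is Ext^t(k[J(π -, c)], N),
-- whence `exists_leray_spectralSequence`. For X → `SdBar` the module k[J(π -, c)] is the free
-- module on the sieve of pairs with [ρ] ≤ c, and its Ext groups are the cohomology of the class c,
-- because a pair in the sieve has an initial arrow to the class: pass to the unique subchain lying
-- in c.
--
-- All comparisons of cohomology rest on one principle: restriction along K : C → D is an
-- isomorphism if every comma category d ↓ K is contractible (`isIso_cohMap`, and
-- `bijective_ext_freeMod` relative to a sieve). It follows by dimension shifting along coinduced
-- injectives, whose restrictions to C are acyclic as their Ext groups are controlled by the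
-- categories d ↓ K with constant coefficients.
--
-- Abutment: X → 𝒪^c(F) factors through the category `SubPair` of pairs (P, R) of centric subgroups
-- with P normalizing R, by taking the smallest member of the chain, and both factors have
-- contractible comma categories.
--
-- Coefficients: for σ fully normalized, `NormOrb σ` is equivalent to the class [σ]. Both `NormOrb
-- σ` and 𝒪^c(N_F(σ)) contain the full subcategory of the subgroups containing the smallest member Q
-- of σ, which is reflective by P ↦ PQ.
--
-- The group theory needed for contractibility is `exists_conj_of_eq_on_centric`: two morphisms
-- agreeing on a centric subgroup P differ by conjugation with an element of Z(P). Its proof uses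
-- only that automorphisms of p-power order are conjugate in F to automorphisms induced by S
-- (`PAutomorphismsInduced`). This property passes from a saturated F to N_F(σ) for fully normalized
-- σ, so saturation of N_F(σ) is not needed.

universe w

noncomputable section

/-! ### Spectral objects and convergence of their first quadrant spectral sequences -/

namespace CategoryTheory

open Pretriangulated ComposableArrows

/-- The spectral object in an abelian category obtained by applying a homological functor to a
spectral object in a triangulated category. -/
def Triangulated.SpectralObject.mapHomologicalFunctor {C A ι : Type*} [Category* C] [Category* A]
    [Category* ι] [HasZeroObject C] [HasShift C ℤ] [Preadditive C]
    [∀ n : ℤ, (shiftFunctor C n).Additive] [Pretriangulated C] [Abelian A]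
    (X : Triangulated.SpectralObject C ι) (G : C ⥤ A) [G.IsHomological] [G.ShiftSequence ℤ] :
    Abelian.SpectralObject A ι where
  H n := X.ω₁ ⋙ G.shift n
  δ' n₀ n₁ h :=
    { app := fun D => G.homologySequenceδ (X.ω₂.obj D) n₀ n₁ h
      naturality := fun _ _ φ =>
        G.homologySequenceδ_naturality _ _ (X.ω₂.map φ) n₀ n₁ h }
  exact₁' n₀ n₁ h D :=
    (G.homologySequence_exact₁ _ (X.ω₂_obj_distinguished D) n₀ n₁ h).exact_toComposableArrows
  exact₂' n D :=
    (G.homologySequence_exact₂ _ (X.ω₂_obj_distinguished D) n).exact_toComposableArrows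
  exact₃' n₀ n₁ h D :=
    (G.homologySequence_exact₃ _ (X.ω₂_obj_distinguished D) n₀ n₁ h).exact_toComposableArrows

namespace Abelian.SpectralObject

/-- The object `E^n(i₀ ≤ i₁ ≤ i₂ ≤ i₃)` is the image of `H^n(i₀ ≤ i₂) ⟶ H^n(i₁ ≤ i₃)`. -/
lemma exists_epi_mono_factorisation_E {C ι : Type*} [Category* C] [Abelian C] [Preorder ι]
    (X : SpectralObject C ι) {i₀ i₁ i₂ i₃ : ι} (h₀₁ : i₀ ≤ i₁) (h₁₂ : i₁ ≤ i₂) (h₂₃ : i₂ ≤ i₃)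
    (n₀ n₁ n₂ : ℤ) (hn₁ : n₀ + 1 = n₁) (hn₂ : n₁ + 1 = n₂) :
    ∃ (a : (X.H n₁).obj (mk₁ (homOfLE (h₀₁.trans h₁₂))) ⟶
        X.E (homOfLE h₀₁) (homOfLE h₁₂) (homOfLE h₂₃) n₀ n₁ n₂ hn₁ hn₂)
      (b : X.E (homOfLE h₀₁) (homOfLE h₁₂) (homOfLE h₂₃) n₀ n₁ n₂ hn₁ hn₂ ⟶
        (X.H n₁).obj (mk₁ (homOfLE (h₁₂.trans h₂₃)))), Epi a ∧ Mono b ∧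
      a ≫ b = (X.H n₁).map (homMk₁ (homOfLE h₀₁) (homOfLE h₂₃) rfl) := by
  refine ⟨X.toCycles (homOfLE h₀₁) (homOfLE h₁₂) (homOfLE (h₀₁.trans h₁₂)) rfl n₁ ≫
    X.πE (homOfLE h₀₁) (homOfLE h₁₂) (homOfLE h₂₃) n₀ n₁ n₂ hn₁ hn₂,
    X.ιE (homOfLE h₀₁) (homOfLE h₁₂) (homOfLE h₂₃) n₀ n₁ n₂ hn₁ hn₂ ≫
    X.fromOpcycles (homOfLE h₁₂) (homOfLE h₂₃) (homOfLE (h₁₂.trans h₂₃)) rfl n₁,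
    inferInstance, inferInstance, ?_⟩
  rw [Category.assoc, X.πE_ιE_assoc _ _ _ n₀ n₁ n₂ hn₁ hn₂]
  simp only [X.toCycles_i_assoc, X.p_fromOpcycles]
  rw [← Functor.map_comp]
  rfl

end Abelian.SpectralObject
end CategoryTheory

namespace CategoryTheory.Abelian.SpectralObject

open ComposableArrows

section

variable {C ι : Type*} [Category* C] [Abelian C] [Preorder ι] (X : SpectralObject C ι)

instance subsingleton_composableArrows_hom {n : ℕ} (D D' : ComposableArrows ι n) :
    Subsingleton (D ⟶ D') :=
  ⟨fun _ _ => NatTrans.ext (funext fun _ => Subsingleton.elim _ _)⟩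

/-- The map `H^n(i ≤ j) ⟶ H^n(i' ≤ j')` for `i ≤ i'` and `j ≤ j'`. -/
def mapLE (n : ℤ) {i j i' j' : ι} (h : i ≤ j) (h' : i' ≤ j') (hi : i ≤ i') (hj : j ≤ j') :
    (X.H n).obj (mk₁ (homOfLE h)) ⟶ (X.H n).obj (mk₁ (homOfLE h')) :=
  (X.H n).map (homMk₁ (homOfLE hi) (homOfLE hj) rfl)

lemma map_eq_mapLE (n : ℤ) {i j i' j' : ι} (h : i ≤ j) (h' : i' ≤ j')
    (φ : mk₁ (homOfLE h) ⟶ mk₁ (homOfLE h')) :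
    (X.H n).map φ = X.mapLE n h h' (leOfHom (φ.app 0)) (leOfHom (φ.app 1)) :=
  congrArg _ (Subsingleton.elim _ _)

lemma mapLE_comp (n : ℤ) {i j i' j' i'' j'' : ι} (h : i ≤ j) (h' : i' ≤ j') (h'' : i'' ≤ j'')
    (hi : i ≤ i') (hj : j ≤ j') (hi' : i' ≤ i'') (hj' : j' ≤ j'') :
    X.mapLE n h h' hi hj ≫ X.mapLE n h' h'' hi' hj' =
      X.mapLE n h h'' (hi.trans hi') (hj.trans hj') := by
  rw [mapLE, mapLE, ← Functor.map_comp, map_eq_mapLE]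

lemma mapLE_exact (n : ℤ) {i j l : ι} (hij : i ≤ j) (hjl : j ≤ l) :
    ∃ w, (ShortComplex.mk (X.mapLE n hij (hij.trans hjl) le_rfl hjl)
      (X.mapLE n (hij.trans hjl) hjl hij le_rfl) w).Exact :=
  ⟨_, X.exact₂ (homOfLE hij) (homOfLE hjl) (homOfLE (hij.trans hjl)) rfl n⟩

lemma epi_mapLE_left (n : ℤ) {i j l : ι} (hij : i ≤ j) (hjl : j ≤ l)
    (h : IsZero ((X.H (n + 1)).obj (mk₁ (homOfLE hij)))) :
    Epi (X.mapLE n (hij.trans hjl) hjl hij le_rfl) :=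
  (X.exact₃ (homOfLE hij) (homOfLE hjl) (homOfLE (hij.trans hjl)) rfl n (n + 1)).epi_f
    (h.eq_of_tgt _ _)

lemma epi_mapLE_right (n : ℤ) {i j l : ι} (hij : i ≤ j) (hjl : j ≤ l)
    (h : IsZero ((X.H n).obj (mk₁ (homOfLE hjl)))) :
    Epi (X.mapLE n hij (hij.trans hjl) le_rfl hjl) :=
  (X.exact₂ (homOfLE hij) (homOfLE hjl) (homOfLE (hij.trans hjl)) rfl n).epi_f
    (h.eq_of_tgt _ _)

lemma mono_mapLE_right (n : ℤ) {i j l : ι} (hij : i ≤ j) (hjl : j ≤ l)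
    (h : IsZero ((X.H (n - 1)).obj (mk₁ (homOfLE hjl)))) :
    Mono (X.mapLE n hij (hij.trans hjl) le_rfl hjl) :=
  (X.exact₁ (homOfLE hij) (homOfLE hjl) (homOfLE (hij.trans hjl)) rfl (n - 1) n).mono_g
    (h.eq_of_src _ _)

end

/-- Both sides are the image of `g ∘ f`: the left one by the isomorphism theorem, and `E` through
the epi-mono factorisation `v ∘ u`. -/
lemma nonempty_quotient_equiv {k : Type*} [CommRing k] {A H B E : Type*} [AddCommGroup A]
    [Module k A] [AddCommGroup H] [Module k H] [AddCommGroup B] [Module k B] [AddCommGroup E]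
    [Module k E] (f : A →ₗ[k] H) (g : H →ₗ[k] B) (u : A →ₗ[k] E) (v : E →ₗ[k] B)
    (hu : Function.Surjective u) (hv : Function.Injective v) (h : v ∘ₗ u = g ∘ₗ f) :
    Nonempty ((f.range ⧸ (g.ker).submoduleOf f.range) ≃ₗ[k] E) := by
  have e1 : (g.ker).submoduleOf f.range = (g ∘ₗ f.range.subtype).ker := rfl
  have e2 : (g ∘ₗ f.range.subtype).range = v.range := by
    rw [LinearMap.range_comp, Submodule.range_subtype, ← LinearMap.range_comp, ← h,
      LinearMap.range_comp, LinearMap.range_eq_top.2 hu, Submodule.map_top]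
  exact ⟨(Submodule.quotEquivOfEq _ _ e1).trans ((LinearMap.quotKerEquivRange _).trans
    ((LinearEquiv.ofEq _ _ e2).trans (LinearEquiv.ofInjective v hv).symm))⟩

section

variable {k : Type} [CommRing k] (X : SpectralObject (ModuleCat.{u} k) EInt) [X.IsFirstQuadrant]

/-- The `E₂` spectral sequence of a first quadrant spectral object converges to
`H^n(-∞ ≤ ∞)`. -/
lemma spectralSequenceConverges :
    SpectralSequenceConverges (X.spectralSequence coreE₂CohomologicalNat)
      (fun n => (X.H (n : ℤ)).obj (mk₁ (homOfLE (bot_le : (⊥ : EInt) ≤ ⊤)))) := by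
  intro n
  have hb (i : EInt) : (⊥ : EInt) ≤ i := bot_le
  have ht (i : EInt) : i ≤ (⊤ : EInt) := le_top
  -- `Fil s` is the image of the part below degree n + 1 - s. At s = 0 the remaining part is zero in
  -- degree n; at s = n + 1 the index is 0, below the first quadrant.
  let e (s : ℕ) : EInt := ((n : ℤ) + 1 - s : ℤ)
  let R (j : EInt) := (X.mapLE n (hb j) bot_le le_rfl (ht j)).hom.range
  refine ⟨fun s => R (e s), ?_, ?_, ?_, ?_⟩
  · intro s s' hs
    have h : e s' ≤ e s := by
      simp only [e, WithBotTop.coe_le_coe]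
      lia
    dsimp only [R]
    rw [← X.mapLE_comp n (hb (e s')) (hb (e s)) bot_le le_rfl h le_rfl (ht _), ModuleCat.hom_comp]
    exact LinearMap.range_comp_le_range _ _
  · have := X.epi_mapLE_right n (hb (e 0)) (ht _)
      (X.isZero₂_of_isFirstQuadrant _ _ _ _ (by
        simp only [e]
        exact WithBotTop.coe_lt_coe.2 (by lia)))
    exact LinearMap.range_eq_top.2 ((ModuleCat.epi_iff_surjective _).1 this)
  · have h := X.isZero₁_of_isFirstQuadrant _ _ (hb (e (n + 1))) (by
      simp only [e, WithBotTop.coe_le_coe]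
      lia) n
    dsimp only [R]
    rw [h.eq_of_src (X.mapLE n _ _ _ _) 0]
    exact LinearMap.range_zero
  · intro s t hst r hr hsr htr
    have e1 : e s = ((t + 1 : ℤ) : EInt) := by simp only [e]; congr 1; lia
    have e2 : e (s + 1) = ((t : ℤ) : EInt) := by simp only [e]; congr 1; lia
    change Nonempty ((R (e s) ⧸ (R (e (s + 1))).submoduleOf (R (e s))) ≃ₗ[k]
      ((X.spectralSequence coreE₂CohomologicalNat).page r hr).X (s, t))
    rw [e1, e2]
    -- The term E_r^{s,t} belongs to the indices t - r + 2 ≤ t ≤ t + 1 ≤ t + r - 1.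
    have h12 : ((t : ℤ) : EInt) ≤ ((t + 1 : ℤ) : EInt) := WithBotTop.coe_le_coe.2 (by lia)
    have h01 : (((t : ℤ) - r + 2 : ℤ) : EInt) ≤ ((t : ℤ) : EInt) :=
      WithBotTop.coe_le_coe.2 (by lia)
    have h23 : ((t + 1 : ℤ) : EInt) ≤ (((t : ℤ) + r - 1 : ℤ) : EInt) :=
      WithBotTop.coe_le_coe.2 (by lia)
    -- By exactness the next filtration step is a kernel, so the graded piece is the image of H^n(-∞
    -- ≤ t + 1) in H^n(t ≤ ∞).
    have hker : R ((t : ℤ) : EInt) =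
        (X.mapLE n bot_le (ht ((t : ℤ) : EInt)) bot_le le_rfl).hom.ker := by
      obtain ⟨w, hw⟩ := X.mapLE_exact n (hb ((t : ℤ) : EInt)) (ht _)
      exact (ShortComplex.moduleCat_exact_iff_range_eq_ker _).1 hw
    rw [hker]
    obtain ⟨a, b, ha, hb', hab⟩ := X.exists_epi_mono_factorisation_E h01 h12 h23
      (n - 1) n (n + 1) (by lia) rfl
    let i := X.spectralSequencePageXIso coreE₂CohomologicalNat r hr (s, t)
      (((t : ℤ) - r + 2 : ℤ) : EInt) ((t : ℤ) : EInt) ((t + 1 : ℤ) : EInt)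
      (((t : ℤ) + r - 1 : ℤ) : EInt) rfl rfl rfl rfl (n - 1) n (n + 1)
      (show (n : ℤ) = (s : ℤ) + (t : ℤ) by lia)
    -- The condition t + 1 < r gives t - r + 2 ≤ 0, where the spectral object vanishes.
    have h1 := X.epi_mapLE_left n (hb _) (h01.trans h12)
      (X.isZero₁_of_isFirstQuadrant _ _ _ (by
        exact WithBotTop.coe_le_coe.2 (by lia)) _)
    -- The condition s < r gives n - 1 < t + r - 1, so the obstruction to injectivity vanishes.
    have h2 := X.mono_mapLE_right n (h12.trans h23) (ht _)
      (X.isZero₂_of_isFirstQuadrant _ _ _ _ (by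
        exact WithBotTop.coe_lt_coe.2 (by lia)))
    refine nonempty_quotient_equiv _ _ ((X.mapLE n (hb _) (h01.trans h12) (hb _) le_rfl ≫ a) ≫
      i.inv).hom (i.hom ≫ b ≫ X.mapLE n (h12.trans h23) (ht _) le_rfl (ht _)).hom ?_ ?_ ?_
    · exact (ModuleCat.epi_iff_surjective _).1 inferInstance
    · exact (ModuleCat.mono_iff_injective _).1 inferInstance
    · rw [← ModuleCat.hom_comp, ← ModuleCat.hom_comp]
      congr 1
      simp only [Category.assoc, Iso.inv_hom_id_assoc]
      have hab' : a ≫ b = X.mapLE n (h01.trans h12) (h12.trans h23) h01 h23 := hab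
      rw [reassoc_of% hab', X.mapLE_comp, X.mapLE_comp, X.mapLE_comp]

end

end CategoryTheory.Abelian.SpectralObject

/-- Convergence only depends on the abutment up to isomorphism. -/
lemma SpectralSequenceConverges.of_equiv {k : Type} [CommRing k]
    {E : E₂CohomologicalSpectralSequenceNat (ModuleCat.{u} k)} {H H' : ℕ → ModuleCat.{u} k}
    (h : SpectralSequenceConverges E H) (e : ∀ n, Nonempty (H n ≃ₗ[k] H' n)) :
    SpectralSequenceConverges E H' := by
  intro n
  obtain ⟨Fil, h1, h2, h3, h4⟩ := h n
  obtain ⟨e⟩ := e n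
  refine ⟨fun s => (Fil s).map e.toLinearMap, fun s s' hs => Submodule.map_mono (h1 hs), ?_, ?_,
    fun s t hst r hr hs ht => ?_⟩
  · dsimp only
    rw [h2, Submodule.map_top, LinearEquiv.range]
  · dsimp only
    rw [h3, Submodule.map_bot]
  · obtain ⟨i⟩ := h4 s t hst r hr hs ht
    refine ⟨(Submodule.Quotient.equiv _ _ (e.submoduleMap (Fil s)) ?_).symm.trans i⟩
    ext ⟨x, hx⟩
    constructor
    · rintro ⟨y, hy, hyx⟩
      have := congrArg Subtype.val hyx
      exact ⟨y, hy, this⟩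
    · rintro ⟨y, hy, hyx⟩
      obtain ⟨z, hz, rfl⟩ := hx
      have : y = z := e.injective hyx
      subst this
      exact ⟨⟨y, hz⟩, hy, rfl⟩

/-! ### Homological Hom functors with values in small modules -/

namespace CategoryTheory

open Pretriangulated

section

variable {D : Type*} [Category* D] [Preadditive D] (k : Type) [CommRing k] [Linear k D] (A : D)
  [∀ Y : D, Small.{u} (A ⟶ Y)]

/-- The functor `Hom(A, -)` with values in `ModuleCat.{u} k`, for an object `A` such that
all the types `Hom(A, Y)` are `u`-small. -/
def shrinkLinearCoyoneda : D ⥤ ModuleCat.{u} k where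
  obj Y := ModuleCat.of k (Shrink.{u} (A ⟶ Y))
  map f := ModuleCat.ofHom ((Shrink.linearEquiv k _).symm.toLinearMap ∘ₗ
    Linear.rightComp k A f ∘ₗ (Shrink.linearEquiv k _).toLinearMap)
  map_id Y := by
    ext x
    obtain ⟨x, rfl⟩ := (Shrink.linearEquiv k (A ⟶ Y)).symm.surjective x
    simp
  map_comp f g := by
    ext x
    obtain ⟨x, rfl⟩ := (Shrink.linearEquiv k (A ⟶ _)).symm.surjective x
    simp

/-- The linear bijection between the values of `shrinkLinearCoyoneda` and the types of
morphisms. -/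
def shrinkLinearCoyonedaEquiv (Y : D) : (shrinkLinearCoyoneda.{u} k A).obj Y ≃ₗ[k] (A ⟶ Y) :=
  Shrink.linearEquiv k _

lemma shrinkLinearCoyonedaEquiv_map {Y Z : D} (f : Y ⟶ Z)
    (x : (shrinkLinearCoyoneda.{u} k A).obj Y) :
    shrinkLinearCoyonedaEquiv k A Z ((shrinkLinearCoyoneda.{u} k A).map f x) =
      shrinkLinearCoyonedaEquiv k A Y x ≫ f :=
  (Shrink.linearEquiv k (A ⟶ Z)).apply_symm_apply _

instance : (shrinkLinearCoyoneda.{u} k A).Additive where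
  map_add {Y Z f g} := by
    refine ModuleCat.hom_ext (LinearMap.ext fun x => (shrinkLinearCoyonedaEquiv k A Z).injective ?_)
    refine (shrinkLinearCoyonedaEquiv_map k A (f + g) x).trans ?_
    rw [Preadditive.comp_add]
    refine Eq.trans ?_ (map_add _ _ _).symm
    exact congrArg₂ (· + ·) (shrinkLinearCoyonedaEquiv_map k A f x).symm
      (shrinkLinearCoyonedaEquiv_map k A g x).symm

instance [HasZeroObject D] [HasShift D ℤ] [∀ n : ℤ, (shiftFunctor D n).Additive]
    [Pretriangulated D] : (shrinkLinearCoyoneda.{u} k A).IsHomological where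
  exact T hT := by
    rw [ShortComplex.moduleCat_exact_iff]
    intro x hx
    have h1 : shrinkLinearCoyonedaEquiv k A _ x ≫ T.mor₂ = 0 :=
      (shrinkLinearCoyonedaEquiv_map k A T.mor₂ x).symm.trans
        ((congrArg _ hx).trans (map_zero _))
    obtain ⟨y, hy⟩ := Triangle.coyoneda_exact₂ T hT _ h1
    refine ⟨(shrinkLinearCoyonedaEquiv k A _).symm y,
      (shrinkLinearCoyonedaEquiv k A _).injective ?_⟩
    refine (shrinkLinearCoyonedaEquiv_map k A T.mor₁ _).trans ?_
    exact (congrArg (· ≫ T.mor₁) (LinearEquiv.apply_symm_apply _ y)).trans hy.symm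

end

end CategoryTheory

/-! ### Truncations in the derived category and the hyper-Ext spectral sequence -/

namespace DerivedCategory

open Pretriangulated ComposableArrows

variable {B : Type*} [Category* B] [Abelian B] [HasDerivedCategory.{w} B]

/-- The third vertex of the truncation triangle lives in degrees at least n + 1, so it has no
cohomology in degrees n - 1 and n, and the long exact sequence applies. -/
instance isIso_homologyFunctor_map_truncLTι (X : DerivedCategory B) (n : ℤ) :
    IsIso ((homologyFunctor B n).map ((TStructure.t.truncLTι (n + 1)).app X)) := by
  have hT := TStructure.t.triangleLTGE_distinguished (n + 1) X
  have : IsGE ((TStructure.t.triangleLTGE (n + 1)).obj X).obj₃ (n + 1) :=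
    inferInstanceAs (IsGE ((TStructure.t.truncGE (n + 1)).obj X) (n + 1))
  have h1 : Epi ((homologyFunctor B n).map ((TStructure.t.triangleLTGE (n + 1)).obj X).mor₁) :=
    (HomologySequence.epi_homologyMap_mor₁_iff _ hT n).2
      ((isZero_of_isGE _ (n + 1) n (by lia)).eq_of_tgt _ _)
  have h2 : Mono ((homologyFunctor B n).map ((TStructure.t.triangleLTGE (n + 1)).obj X).mor₁) :=
    (HomologySequence.mono_homologyMap_mor₁_iff _ hT (n - 1) n).2
      ((isZero_of_isGE _ (n + 1) (n - 1) (by lia)).eq_of_src _ _)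
  exact isIso_of_mono_of_epi
    ((homologyFunctor B n).map ((TStructure.t.triangleLTGE (n + 1)).obj X).mor₁)

instance isIso_homologyFunctor_map_truncGEπ (X : DerivedCategory B) (n : ℤ) :
    IsIso ((homologyFunctor B n).map ((TStructure.t.truncGEπ n).app X)) := by
  have hT := TStructure.t.triangleLTGE_distinguished n X
  have : IsLE ((TStructure.t.triangleLTGE n).obj X).obj₁ (n - 1) :=
    inferInstanceAs (IsLE ((TStructure.t.truncLT n).obj X) (n - 1))
  have h1 : Epi ((homologyFunctor B n).map ((TStructure.t.triangleLTGE n).obj X).mor₂) :=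
    (HomologySequence.epi_homologyMap_mor₂_iff _ hT n (n + 1)).2
      ((isZero_of_isLE _ (n - 1) (n + 1) (by lia)).eq_of_tgt _ _)
  have h2 : Mono ((homologyFunctor B n).map ((TStructure.t.triangleLTGE n).obj X).mor₂) :=
    (HomologySequence.mono_homologyMap_mor₂_iff _ hT n).2
      ((isZero_of_isLE _ (n - 1) n (by lia)).eq_of_src _ _)
  exact isIso_of_mono_of_epi
    ((homologyFunctor B n).map ((TStructure.t.triangleLTGE n).obj X).mor₂)

lemma nonempty_homologyFunctor_singleFunctor_iso (M : B) (n : ℤ) :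
    Nonempty ((homologyFunctor B n).obj ((singleFunctor B n).obj M) ≅ M) :=
  ⟨(homologyFunctor B n).mapIso ((singleFunctorIsoCompQ B n).app M) ≪≫
    (homologyFunctorFactors B n).app _ ≪≫ HomologicalComplex.singleObjHomologySelfIso _ _ _⟩

/-- The truncation `τ^{≥ n} τ^{< n + 1} X` is `H^n(X)` in degree `n`. -/
lemma nonempty_trunc_iso (X : DerivedCategory B) (n : ℤ) :
    Nonempty ((TStructure.t.truncGE n).obj ((TStructure.t.truncLT (n + 1)).obj X) ≅
      (singleFunctor B n).obj ((homologyFunctor B n).obj X)) := by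
  let Y := (TStructure.t.truncGE n).obj ((TStructure.t.truncLT (n + 1)).obj X)
  have : Y.IsGE n := by dsimp [Y]; infer_instance
  have : IsLE ((TStructure.t.truncLT (n + 1)).obj X) n :=
    TStructure.t.isLE_truncLT_obj _ _ _ (by lia)
  have : Y.IsLE n := by dsimp [Y]; infer_instance
  obtain ⟨M, ⟨e⟩⟩ := exists_iso_singleFunctor_obj_of_isGE_of_isLE Y n
  obtain ⟨e'⟩ := nonempty_homologyFunctor_singleFunctor_iso M n
  exact ⟨e ≪≫ (singleFunctor B n).mapIso (e'.symm ≪≫ (homologyFunctor B n).mapIso e.symm ≪≫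
    (asIso ((homologyFunctor B n).map ((TStructure.t.truncGEπ n).app
      ((TStructure.t.truncLT (n + 1)).obj X)))).symm ≪≫
    asIso ((homologyFunctor B n).map ((TStructure.t.truncLTι (n + 1)).app X)))⟩

section

variable (k : Type) [CommRing k] [Linear k B] (A : B) (X : DerivedCategory B)
  [∀ Y : DerivedCategory B, Small.{u} ((singleFunctor B 0).obj A ⟶ Y)]

/-- The spectral object of the groups `Hom(A, τ X⟦n⟧)`, for the truncations `τ X` of `X`. -/
def hyperExtSpectralObject : Abelian.SpectralObject (ModuleCat.{u} k) EInt :=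
  letI : (shrinkLinearCoyoneda.{u} k ((singleFunctor B 0).obj A)).ShiftSequence ℤ :=
    Functor.ShiftSequence.tautological _ _
  (TStructure.t.spectralObject X).mapHomologicalFunctor
    (shrinkLinearCoyoneda.{u} k ((singleFunctor B 0).obj A))

lemma hyperExtSpectralObject_H_obj (n : ℤ) {i j : EInt} (hij : i ≤ j) :
    ((hyperExtSpectralObject.{u, w} k A X).H n).obj (mk₁ (homOfLE hij)) =
      (shrinkLinearCoyoneda.{u} k ((singleFunctor B 0).obj A)).obj
        (((TStructure.t.eTruncGE.obj i).obj ((TStructure.t.eTruncLT.obj j).obj X))⟦n⟧) := rfl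

/-- Truncating X below a degree j ≤ 0 gives zero. If n < i, the part of X in degrees at least i,
shifted by n, lies in degrees at least 1 and receives no morphism from an object in degree 0. -/
instance isFirstQuadrant_hyperExtSpectralObject [X.IsGE 0] :
    (hyperExtSpectralObject.{u, w} k A X).IsFirstQuadrant where
  isZero₁ i j hij hj n := by
    rw [hyperExtSpectralObject_H_obj]
    have h := TStructure.t.isZero_eTruncLT_obj_obj X 0 j hj
    exact Functor.map_isZero _ (Functor.map_isZero _ (Functor.map_isZero _ h))
  isZero₂ i j hij n hi := by
    rw [hyperExtSpectralObject_H_obj]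
    set Y := (TStructure.t.eTruncLT.obj j).obj X
    have h1 := TStructure.t.isGE_eTruncGE_obj_obj (n + 1) i (by
      induction i using WithBotTop.rec with
      | bot => simp at hi
      | coe a =>
        have := WithBotTop.coe_lt_coe.1 hi
        exact WithBotTop.coe_le_coe.2 (by lia)
      | top => exact le_top) Y
    have h2 := TStructure.t.isGE_shift ((TStructure.t.eTruncGE.obj i).obj Y) (n + 1) n 1
    have : Subsingleton ((singleFunctor B 0).obj A ⟶
        ((TStructure.t.eTruncGE.obj i).obj Y)⟦n⟧) :=
      ⟨fun f g => (TStructure.t.zero_of_isLE_of_isGE f 0 1 (by lia) inferInstance h2).trans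
        (TStructure.t.zero_of_isLE_of_isGE g 0 1 (by lia) inferInstance h2).symm⟩
    have := (shrinkLinearCoyonedaEquiv.{u} k ((singleFunctor B 0).obj A)
      (((TStructure.t.eTruncGE.obj i).obj Y)⟦n⟧)).toEquiv.subsingleton
    exact ModuleCat.isZero_of_subsingleton _

/-- The hyper-Ext spectral sequence `Ext^s(A, H^t(X)) ⟹ Hom(A, X⟦s + t⟧)` of an object
of the derived category with cohomology in nonnegative degrees. -/
theorem exists_hyperExt_spectralSequence [X.IsGE 0] [HasExt.{u} B] :
    ∃ E : E₂CohomologicalSpectralSequenceNat (ModuleCat.{u} k),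
      (∀ (hr : (2 : ℤ) ≤ 2) (s t : ℕ), Nonempty ((E.page 2 hr).X (s, t) ≅
        ModuleCat.of k (Abelian.Ext.{u} A ((homologyFunctor B (t : ℤ)).obj X) s))) ∧
      SpectralSequenceConverges E (fun n => (shrinkLinearCoyoneda.{u} k
        ((singleFunctor B 0).obj A)).obj (X⟦(n : ℤ)⟧)) := by
  refine ⟨(hyperExtSpectralObject.{u, w} k A X).spectralSequence
    Abelian.SpectralObject.coreE₂CohomologicalNat, fun _ s t => ?_, ?_⟩
  · let i := (hyperExtSpectralObject.{u, w} k A X).spectralSequenceFirstPageXIso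
      Abelian.SpectralObject.coreE₂CohomologicalNat (s, t) ((t : ℤ) : EInt) ((t + 1 : ℤ) : EInt)
      rfl rfl (s + t) rfl
    obtain ⟨e⟩ := nonempty_trunc_iso X t
    -- On the second page the truncation of X is H^t(X) placed in degree t; the shift by s + t moves
    -- it to degree 0 and leaves a shift by s.
    let e' := (shiftFunctor _ (s + t : ℤ)).mapIso e ≪≫
      (shiftFunctorAdd' (DerivedCategory B) (t : ℤ) (s : ℤ) (s + t : ℤ) (by lia)).app _ ≪≫
      (shiftFunctor _ (s : ℤ)).mapIso (((singleFunctors B).shiftIso (t : ℤ) 0 t (by lia)).app _)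
    exact ⟨i ≪≫ (shrinkLinearCoyoneda.{u} k ((singleFunctor B 0).obj A)).mapIso e' ≪≫
      ((shrinkLinearCoyonedaEquiv.{u} k ((singleFunctor B 0).obj A) _).trans
        Abelian.Ext.homLinearEquiv.symm).toModuleIso⟩
  · exact (hyperExtSpectralObject.{u, w} k A X).spectralSequenceConverges

end

end DerivedCategory

/-! ### Cocycles, Ext groups and morphisms to the image of an injective resolution -/

namespace CochainComplex

open HomComplex

section

variable {B : Type*} [Category* B] [Abelian B]

/-- The morphisms `a ⟶ K.X n` whose composition with the differential vanishes. -/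
def cocyclesFrom (a : B) (K : CochainComplex B ℤ) (n : ℤ) : AddSubgroup (a ⟶ K.X n) where
  carrier := {f | f ≫ K.d n (n + 1) = 0}
  zero_mem' := zero_comp
  add_mem' {f g} (hf : _ = _) (hg : _ = _) :=
    show _ = _ by rw [Preadditive.add_comp, hf, hg, add_zero]
  neg_mem' {f} (hf : _ = _) := show _ = _ by rw [Preadditive.neg_comp, hf, neg_zero]

variable {a : B} {K : CochainComplex B ℤ} {n : ℤ}

/-- The cohomology class of `f : a ⟶ K.X n` with `f ≫ d = 0`. -/
def cocycleClass : cocyclesFrom a K n →+ CohomologyClass ((singleFunctor B 0).obj a) K n :=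
  AddMonoidHom.mk' (fun f => .mk (Cocycle.fromSingleMk f.1 (zero_add n) (n + 1) rfl f.2))
    fun f g => (congrArg _ (Cocycle.fromSingleMk_add _ _ _ _ _ f.2 g.2)).trans
      (CohomologyClass.mk_add _ _)

lemma cocycleClass_surjective : Function.Surjective (cocycleClass (a := a) (K := K) (n := n)) := by
  intro x
  obtain ⟨x, rfl⟩ := x.mk_surjective
  obtain ⟨f, hf, rfl⟩ := Cocycle.fromSingleMk_surjective x n (zero_add n) (n + 1) rfl
  exact ⟨⟨f, hf⟩, rfl⟩

lemma cocycleClass_eq_zero_iff (f : cocyclesFrom a K n) :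
    cocycleClass f = 0 ↔ ∃ g : a ⟶ K.X (n - 1), g ≫ K.d (n - 1) n = f.1 :=
  (CohomologyClass.mk_eq_zero_iff _).trans
    (Cocycle.fromSingleMk_mem_coboundaries_iff _ _ _ _ f.2 (n - 1) (by lia))

end

section

variable {B : Type*} [Category* B] [Abelian B] [HasDerivedCategory.{w} B]

/-- Morphisms to a K-injective complex in the derived category are cohomology classes. -/
lemma nonempty_cohomologyClass_addEquiv (a : B) (L : CochainComplex B ℤ) [L.IsKInjective] (n : ℤ) :
    Nonempty (CohomologyClass ((singleFunctor B 0).obj a) L n ≃+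
      ((DerivedCategory.singleFunctor B 0).obj a ⟶ (DerivedCategory.Q.obj L)⟦n⟧)) := by
  let e1 := CohomologyClass.homAddEquiv (K := (singleFunctor B 0).obj a) (L := L) (n := n)
  let e2 := AddEquiv.ofBijective (DerivedCategory.Qh.mapAddHom
    (X := (HomotopyCategory.quotient _ _).obj ((singleFunctor B 0).obj a))
    (Y := (HomotopyCategory.quotient B (ComplexShape.up ℤ)).obj (L⟦n⟧)))
    (IsKInjective.Qh_map_bijective _ _)
  let i1 : DerivedCategory.Qh.obj ((HomotopyCategory.quotient _ _).obj
      ((singleFunctor B 0).obj a)) ≅ (DerivedCategory.singleFunctor B 0).obj a :=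
    (DerivedCategory.quotientCompQhIso B).app _ ≪≫
      ((DerivedCategory.singleFunctorIsoCompQ B 0).app a).symm
  let i2 : DerivedCategory.Qh.obj ((HomotopyCategory.quotient B (ComplexShape.up ℤ)).obj
      (L⟦n⟧)) ≅ (DerivedCategory.Q.obj L)⟦n⟧ :=
    (DerivedCategory.quotientCompQhIso B).app _ ≪≫ (DerivedCategory.Q.commShiftIso n).app L
  exact ⟨(e1.trans e2).trans
    { i1.homCongr i2 with
      map_add' := fun f g => by
        change i1.inv ≫ (f + g) ≫ i2.hom = i1.inv ≫ f ≫ i2.hom + i1.inv ≫ g ≫ i2.hom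
        rw [Preadditive.add_comp, Preadditive.comp_add] }⟩

end

end CochainComplex

namespace CategoryTheory

open CochainComplex

/-- Both groups are the quotient of `Z` by the same kernel. This compares Ext groups with derived
Hom groups through their common group of cocycles. -/
lemma nonempty_addEquiv_of_surjective {Z A₁ A₂ : Type*} [AddCommGroup Z] [AddCommGroup A₁]
    [AddCommGroup A₂] (p₁ : Z →+ A₁) (p₂ : Z →+ A₂) (h₁ : Function.Surjective p₁)
    (h₂ : Function.Surjective p₂) (h : ∀ z, p₁ z = 0 ↔ p₂ z = 0) : Nonempty (A₁ ≃+ A₂) := by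
  have hk : p₁.ker = p₂.ker := by
    ext z
    exact h z
  exact ⟨(QuotientAddGroup.quotientKerEquivOfSurjective p₁ h₁).symm.trans
    ((QuotientAddGroup.quotientAddEquivOfEq hk).trans
      (QuotientAddGroup.quotientKerEquivOfSurjective p₂ h₂))⟩

section

variable {𝒜 B : Type*} [Category* 𝒜] [Abelian 𝒜] [Category* B] [Abelian B] {F : B ⥤ 𝒜}
  {R : 𝒜 ⥤ B} [F.Additive] (adj : F ⊣ R)

lemma adj_homEquiv_symm_comp_eq_zero_iff {a : B} {y y' : 𝒜} (f : a ⟶ R.obj y) (d : y ⟶ y') :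
    (adj.homEquiv a y).symm f ≫ d = 0 ↔ f ≫ R.map d = 0 := by
  rw [← Adjunction.homEquiv_naturality_right_symm]
  exact (adj.homAddEquiv a y').symm.map_eq_zero_iff

variable [R.Additive]

/-- Cocycles `a ⟶ R K^n` correspond to cocycles `F a ⟶ K^n`. -/
def cocyclesFromAdj (a : B) (K : CochainComplex 𝒜 ℤ) (n : ℤ) :
    cocyclesFrom a ((R.mapHomologicalComplex (ComplexShape.up ℤ)).obj K) n ≃+
      cocyclesFrom (F.obj a) K n where
  toFun f := ⟨(adj.homEquiv a (K.X n)).symm f.1,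
    (adj_homEquiv_symm_comp_eq_zero_iff adj f.1 _).2 f.2⟩
  invFun g := ⟨adj.homEquiv a (K.X n) g.1, (adj_homEquiv_symm_comp_eq_zero_iff adj _ _).1
    (by rw [Equiv.symm_apply_apply]; exact g.2)⟩
  left_inv f := Subtype.ext (Equiv.apply_symm_apply _ _)
  right_inv g := Subtype.ext (Equiv.symm_apply_apply _ _)
  map_add' f g := Subtype.ext ((adj.homAddEquiv a (K.X n)).symm.map_add f.1 g.1)

variable {N : 𝒜} (I : InjectiveResolution N) [HasExt.{u} 𝒜]

/-- The image of an injective resolution under an additive functor. -/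
abbrev InjectiveResolution.mapCochainComplex (R : 𝒜 ⥤ B) [R.Additive] : CochainComplex B ℤ :=
  (R.mapHomologicalComplex (ComplexShape.up ℤ)).obj I.cochainComplex

/-- The extension class of `F a` by `N` given by a cocycle `a ⟶ R I^n`. -/
def extOfCocycle (a : B) (n : ℕ) :
    cocyclesFrom a (I.mapCochainComplex R) n →+ Abelian.Ext.{u} (F.obj a) N n :=
  (I.extAddEquivCohomologyClass.symm.toAddMonoidHom.comp cocycleClass).comp
    (cocyclesFromAdj adj a I.cochainComplex n).toAddMonoidHom

lemma extOfCocycle_surjective (a : B) (n : ℕ) :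
    Function.Surjective (extOfCocycle.{u} adj I a n) :=
  (I.extAddEquivCohomologyClass.symm.surjective.comp cocycleClass_surjective).comp
    (cocyclesFromAdj adj a I.cochainComplex n).surjective

/-- The adjunction is natural, so it matches the coboundaries from `F a` to the resolution with
those from `a` to its image under `R`. -/
lemma extOfCocycle_eq_zero_iff (a : B) (n : ℕ) (f : cocyclesFrom a (I.mapCochainComplex R) n) :
    extOfCocycle.{u} adj I a n f = 0 ↔ ∃ g : a ⟶ (I.mapCochainComplex R).X (n - 1),
      g ≫ (I.mapCochainComplex R).d (n - 1) n = f.1 := by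
  refine (EmbeddingLike.map_eq_zero_iff (f := I.extAddEquivCohomologyClass.symm)).trans
    ((cocycleClass_eq_zero_iff _).trans ?_)
  constructor
  · rintro ⟨g, hg⟩
    refine ⟨adj.homEquiv _ _ g, ?_⟩
    refine (adj.homEquiv_naturality_right g (I.cochainComplex.d (n - 1) n)).symm.trans ?_
    rw [hg]
    exact Equiv.apply_symm_apply _ _
  · rintro ⟨g, hg⟩
    refine ⟨(adj.homEquiv _ _).symm g, ?_⟩
    refine (adj.homEquiv_naturality_right_symm g (I.cochainComplex.d (n - 1) n)).symm.trans ?_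
    exact congrArg (adj.homEquiv _ _).symm hg

/-- Naturality in `a` is what later turns the objectwise description of the cohomology of `R I` into
an isomorphism of modules. -/
lemma extOfCocycle_precomp {a a' : B} (h : a' ⟶ a) (n : ℕ)
    (f : cocyclesFrom a (I.mapCochainComplex R) n)
    (f' : cocyclesFrom a' (I.mapCochainComplex R) n) (hf : f'.1 = h ≫ f.1) :
    extOfCocycle.{u} adj I a' n f' =
      (Abelian.Ext.mk₀ (F.map h)).comp (extOfCocycle.{u} adj I a n f) (zero_add n) := by
  -- The class is rewritten with `extMk`, whose behaviour under precomposition is known.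
  have key {x : 𝒜} (g : cocyclesFrom x I.cochainComplex n) :
      I.extAddEquivCohomologyClass.symm (cocycleClass g) =
        I.extMk (g.1 ≫ (I.cochainComplexXIso n n rfl).hom) (n + 1) rfl (by
          have := g.2
          change g.1 ≫ _ = 0 at this
          rw [I.cochainComplex_d n (n + 1) n (n + 1) rfl (by simp)] at this
          simpa [← Category.assoc] using this) := by
    refine congrArg (fun z => I.extEquivCohomologyClass.symm (.mk z)) ?_
    ext : 1
    simp [HomComplex.Cocycle.fromSingleMk]
  refine (key _).trans (Eq.trans ?_
    (congrArg (fun z => (Abelian.Ext.mk₀ (F.map h)).comp z (zero_add n)) (key _)).symm)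
  rw [InjectiveResolution.mk₀_comp_extMk]
  congr 1
  rw [← Category.assoc]
  congr 1
  refine Eq.trans ?_ (adj.homEquiv_naturality_left_symm h f.1)
  exact congrArg (adj.homEquiv _ _).symm hf

/-- Morphisms in the derived category to the image of an injective resolution under a right
adjoint functor which preserves injective objects. -/
lemma nonempty_ext_addEquiv_hom (adj : F ⊣ R) [HasDerivedCategory.{w} B]
    [(I.mapCochainComplex R).IsKInjective]
    (a : B) (n : ℕ) : Nonempty (Abelian.Ext.{u} (F.obj a) N n ≃+
      ((DerivedCategory.singleFunctor B 0).obj a ⟶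
        (DerivedCategory.Q.obj (I.mapCochainComplex R))⟦(n : ℤ)⟧)) := by
  obtain ⟨e⟩ := nonempty_cohomologyClass_addEquiv a (I.mapCochainComplex R) n
  refine nonempty_addEquiv_of_surjective (extOfCocycle.{u} adj I a n)
    (e.toAddMonoidHom.comp cocycleClass) (extOfCocycle_surjective adj I a n)
    (e.surjective.comp cocycleClass_surjective) fun z => ?_
  exact (extOfCocycle_eq_zero_iff adj I a n z).trans
    ((cocycleClass_eq_zero_iff z).symm.trans e.map_eq_zero_iff.symm)

end

end CategoryTheory

namespace DerivedCategory

/-- In an abelian category with enough projectives, the morphisms in the derived category from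
an object of the category form small types. -/
lemma small_singleFunctor_hom {B : Type*} [Category.{u} B] [Abelian B] [EnoughProjectives B]
    [HasDerivedCategory.{w} B] (a : B) (Y : DerivedCategory B) :
    Small.{u} ((singleFunctor B 0).obj a ⟶ Y) := by
  let P := ProjectiveResolution.of a
  let e : Qh.obj ((HomotopyCategory.quotient _ _).obj P.cochainComplex) ≅
      (singleFunctor B 0).obj a :=
    (quotientCompQhIso B).app _ ≪≫ asIso (Q.map P.π') ≪≫
      ((singleFunctorIsoCompQ B 0).app a).symm
  let e' : Qh.obj ((HomotopyCategory.quotient _ _).obj (Q.objPreimage Y)) ≅ Y :=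
    (quotientCompQhIso B).app _ ≪≫ Q.objObjPreimageIso Y
  -- Morphisms out of a K-projective resolution are represented by chain maps, and these form a type
  -- in the universe `u`.
  refine small_of_surjective (f := fun f : P.cochainComplex ⟶ Q.objPreimage Y =>
    e.inv ≫ Qh.map ((HomotopyCategory.quotient _ _).map f) ≫ e'.hom) fun g => ?_
  obtain ⟨h, hh⟩ := (CochainComplex.IsKProjective.Qh_map_bijective P.cochainComplex
    ((HomotopyCategory.quotient _ _).obj (Q.objPreimage Y))).2 (e.hom ≫ g ≫ e'.inv)
  obtain ⟨f, rfl⟩ := (HomotopyCategory.quotient _ _).map_surjective h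
  exact ⟨f, by dsimp only; rw [hh]; simp⟩

end DerivedCategory

/-! ### Projective modules and free modules over a small category -/

namespace CatCoh

/-- The left adjoint of an exact evaluation functor preserves projectives; the coproduct over all
objects of the images of projective covers of the values maps onto `M`. Enough projectives are used
to bound the size of Hom sets in the derived category. -/
instance enoughProjectives_rmod (k : Type) [CommRing k] (C : Type u) [SmallCategory C] :
    EnoughProjectives (RMod k C) where
  presentation M := by
    have hp (x : Cᵒᵖ) : Projective ((evaluationLeftAdjoint (ModuleCat.{u} k) x).obj
        (Projective.over (M.obj x))) :=
      (evaluationAdjunctionRight (ModuleCat.{u} k) x).map_projective _ inferInstance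
    refine ⟨{
      p := ∐ fun x : Cᵒᵖ => (evaluationLeftAdjoint (ModuleCat.{u} k) x).obj
        (Projective.over (M.obj x))
      f := Sigma.desc fun x => ((evaluationAdjunctionRight (ModuleCat.{u} k) x).homEquiv _ M).symm
        (Projective.π (M.obj x))
      epi := @NatTrans.epi_of_epi_app _ _ _ _ _ _ _ fun x => ?_ }⟩
    set adj := evaluationAdjunctionRight (ModuleCat.{u} k) x
    set l := Sigma.desc fun x => ((evaluationAdjunctionRight (ModuleCat.{u} k) x).homEquiv _ M).symm
        (Projective.π (M.obj x))
    have h : Sigma.ι _ x ≫ l = (adj.homEquiv _ M).symm (Projective.π (M.obj x)) :=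
      Sigma.ι_desc _ _
    have h1 := (adj.homEquiv _ M).apply_symm_apply (Projective.π (M.obj x))
    rw [← h, Adjunction.homEquiv_unit] at h1
    have h2 : (adj.unit.app _ ≫ (Sigma.ι (fun x : Cᵒᵖ =>
        (evaluationLeftAdjoint (ModuleCat.{u} k) x).obj (Projective.over (M.obj x))) x).app x) ≫
          l.app x = Projective.π (M.obj x) := by
      rw [Category.assoc]
      exact h1
    exact epi_of_epi_fac h2

section

variable (k : Type) [CommRing k] {C : Type u} [SmallCategory C]

/-- The free module on a presheaf of sets. -/
def freeMod : (Cᵒᵖ ⥤ Type u) ⥤ RMod k C where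
  obj G :=
    { obj := fun x => ModuleCat.of k (G.obj x →₀ k)
      map := fun f => ModuleCat.ofHom (Finsupp.lmapDomain k k (G.map f))
      map_id := fun x => by
        refine ModuleCat.hom_ext (Finsupp.lhom_ext fun a b => ?_)
        simp
      map_comp := fun f g => by
        refine ModuleCat.hom_ext (Finsupp.lhom_ext fun a b => ?_)
        simp }
  map τ :=
    { app := fun x => ModuleCat.ofHom (Finsupp.lmapDomain k k (τ.app x))
      naturality := fun x y f => by
        refine ModuleCat.hom_ext (Finsupp.lhom_ext fun a b => ?_)
        simp [NatTrans.naturality_apply] }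
  map_id G := by
    ext x : 2
    refine ModuleCat.hom_ext (Finsupp.lhom_ext fun a b => ?_)
    simp
  map_comp τ τ' := by
    ext x : 2
    refine ModuleCat.hom_ext (Finsupp.lhom_ext fun a b => ?_)
    simp

variable {k} {G G' : Cᵒᵖ ⥤ Type u} {N : RMod k C}

/-- The generator of the free module given by a section. -/
def freeModMk {x : Cᵒᵖ} (g : G.obj x) : ((freeMod k).obj G).obj x := Finsupp.single g 1

lemma freeMod_map_mk {x y : Cᵒᵖ} (f : x ⟶ y) (g : G.obj x) :
    ((freeMod k).obj G).map f (freeModMk g) = freeModMk (G.map f g) :=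
  Finsupp.mapDomain_single

lemma freeMod_map_app_mk (τ : G ⟶ G') {x : Cᵒᵖ} (g : G.obj x) :
    ((freeMod k).map τ).app x (freeModMk g) = freeModMk (τ.app x g) :=
  Finsupp.mapDomain_single

lemma freeMod_hom_ext {a b : (freeMod k).obj G ⟶ N}
    (h : ∀ (x : Cᵒᵖ) (g : G.obj x), a.app x (freeModMk (k := k) g) = b.app x (freeModMk g)) :
    a = b := by
  ext x : 2
  exact ModuleCat.hom_ext (Finsupp.lhom_ext' fun g => LinearMap.ext_ring (h x g))

/-- The morphism from a free module given by a compatible family of elements. -/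
def freeModLift (s : ∀ x : Cᵒᵖ, G.obj x → N.obj x)
    (hs : ∀ (x y : Cᵒᵖ) (f : x ⟶ y) (g : G.obj x), N.map f (s x g) = s y (G.map f g)) :
    (freeMod k).obj G ⟶ N where
  app x := ModuleCat.ofHom (Finsupp.linearCombination k (s x))
  naturality x y f := by
    refine ModuleCat.hom_ext (Finsupp.lhom_ext' fun g => LinearMap.ext_ring ?_)
    refine (congrArg (Finsupp.linearCombination k (s y)) (freeMod_map_mk (k := k) f g)).trans ?_
    refine (Finsupp.linearCombination_single k _ _).trans ?_
    refine Eq.trans ?_ (congrArg (N.map f) (Finsupp.linearCombination_single k 1 g)).symm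
    rw [one_smul, one_smul]
    exact (hs x y f g).symm

lemma freeModLift_mk (s : ∀ x : Cᵒᵖ, G.obj x → N.obj x)
    (hs : ∀ (x y : Cᵒᵖ) (f : x ⟶ y) (g : G.obj x), N.map f (s x g) = s y (G.map f g))
    {x : Cᵒᵖ} (g : G.obj x) : (freeModLift s hs).app x (freeModMk g) = s x g :=
  (Finsupp.linearCombination_single k 1 g).trans (one_smul _ _)

/-- The morphism `k[C(-, c)] ⟶ N` given by an element of `N(c)`. -/
def freeYonedaLift {c : C} (z : N.obj (op c)) : (freeMod k).obj (yoneda.obj c) ⟶ N :=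
  freeModLift (fun _ (f : _ ⟶ c) => N.map f.op z) fun x _ f g =>
    (ConcreteCategory.congr_hom (N.map_comp (Quiver.Hom.op (X := x.unop) (Y := c) g) f) z).symm

lemma freeYonedaLift_mk {c x : C} (z : N.obj (op c)) (f : x ⟶ c) :
    (freeYonedaLift z).app (op x) (freeModMk (G := yoneda.obj c) f) = N.map f.op z :=
  freeModLift_mk _ _ _

/-- Yoneda: the free module on a representable presheaf is generated by the identity. -/
lemma freeYoneda_hom_ext {c : C} {a b : (freeMod k).obj (yoneda.obj c) ⟶ N}
    (h : a.app (op c) (freeModMk (G := yoneda.obj c) (𝟙 c)) =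
      b.app (op c) (freeModMk (G := yoneda.obj c) (𝟙 c))) : a = b := by
  refine freeMod_hom_ext fun x g => ?_
  have key (a : (freeMod k).obj (yoneda.obj c) ⟶ N) : a.app x (freeModMk g) =
      N.map (Quiver.Hom.op (X := x.unop) (Y := c) g)
        (a.app (op c) (freeModMk (G := yoneda.obj c) (𝟙 c))) := by
    refine Eq.trans ?_ (NatTrans.naturality_apply a _ _)
    rw [freeMod_map_mk]
    congr 2
    exact (Category.comp_id (X := x.unop) (Y := c) g).symm
  rw [key a, key b, h]

lemma freeYonedaLift_surjective {c : C} (a : (freeMod k).obj (yoneda.obj c) ⟶ N) :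
    ∃ z : N.obj (op c), freeYonedaLift z = a :=
  ⟨a.app (op c) (freeModMk (G := yoneda.obj c) (𝟙 c)), freeYoneda_hom_ext (by
    rw [freeYonedaLift_mk]
    simp)⟩

lemma freeYonedaLift_injective {c : C} :
    Function.Injective (freeYonedaLift (k := k) (N := N) (c := c)) := fun z z' h => by
  have := congrArg (fun a => a.app (op c) (freeModMk (G := yoneda.obj c) (𝟙 c))) h
  simp only [freeYonedaLift_mk] at this
  simpa using this

lemma freeYonedaLift_comp {N' : RMod k C} {c : C} (z : N.obj (op c)) (f : N ⟶ N') :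
    freeYonedaLift z ≫ f = freeYonedaLift (f.app (op c) z) :=
  freeYoneda_hom_ext (by
    rw [freeYonedaLift_mk]
    refine (congrArg (f.app (op c)) (freeYonedaLift_mk z (𝟙 c))).trans ?_
    simp)

lemma map_comp_freeYonedaLift {c d : C} (a : c ⟶ d) (z : N.obj (op d)) :
    (freeMod k).map (yoneda.map a) ≫ freeYonedaLift z = freeYonedaLift (N.map a.op z) :=
  freeYoneda_hom_ext (by
    refine (congrArg ((freeYonedaLift z).app (op c))
      (freeMod_map_app_mk (k := k) (yoneda.map a) (𝟙 c))).trans ?_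
    refine (freeYonedaLift_mk z (𝟙 c ≫ a)).trans ?_
    rw [freeYonedaLift_mk]
    simp)

lemma freeYonedaLift_add {c : C} (z z' : N.obj (op c)) :
    freeYonedaLift (z + z') = freeYonedaLift z + freeYonedaLift z' :=
  freeYoneda_hom_ext (by
    change _ = (freeYonedaLift z).app _ _ + (freeYonedaLift z').app _ _
    rw [freeYonedaLift_mk, freeYonedaLift_mk, freeYonedaLift_mk, map_add])

end
end CatCoh

/-! ### The Leray spectral sequence of a functor -/

namespace CatCoh

open CochainComplex

/-- Evaluation functors are exact, hence commute with homology, and a functor is zero if all its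
values are. -/
lemma exact_of_exact_evaluation {C D : Type*} [Category* C] [Category* D] [Abelian D]
    (S : ShortComplex (C ⥤ D)) (h : ∀ x, (S.map ((evaluation C D).obj x)).Exact) : S.Exact := by
  rw [ShortComplex.exact_iff_isZero_homology, Functor.isZero_iff]
  exact fun x => ((ShortComplex.exact_iff_isZero_homology _).1 (h x)).of_iso
    (S.mapHomologyIso ((evaluation C D).obj x)).symm

section

/-- Additive equivalences of `ZMod p`-modules are linear. -/
def zmodLinearEquiv {p : ℕ} {V W : Type*} [AddCommGroup V] [AddCommGroup W] [Module (ZMod p) V]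
    [Module (ZMod p) W] (e : V ≃+ W) : V ≃ₗ[ZMod p] W :=
  { e with map_smul' := (e.toAddMonoidHom.toZModLinearMap p).map_smul' }

/-- Isomorphic objects have isomorphic Ext groups. -/
def extCongr {𝒜 : Type*} [Category* 𝒜] [Abelian 𝒜] [HasExt.{u} 𝒜] {X X' Y Y' : 𝒜} (i : X ≅ X')
    (j : Y ≅ Y') (n : ℕ) : Abelian.Ext.{u} X Y n ≃+ Abelian.Ext.{u} X' Y' n where
  toFun x := (Abelian.Ext.mk₀ i.inv).comp (x.comp (Abelian.Ext.mk₀ j.hom) (add_zero n)) (zero_add n)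
  invFun x :=
    (Abelian.Ext.mk₀ i.hom).comp (x.comp (Abelian.Ext.mk₀ j.inv) (add_zero n)) (zero_add n)
  left_inv x := by simp [← Abelian.Ext.comp_assoc_of_second_deg_zero]
  right_inv x := by simp [← Abelian.Ext.comp_assoc_of_second_deg_zero]
  map_add' x y := by simp

/-- The constant module is the restriction of the constant module. -/
def constResIso (k : Type) [CommRing k] {C D : Type u} [SmallCategory C] [SmallCategory D]
    (K : C ⥤ D) : constMod k C ≅ (res k K).obj (constMod k D) :=
  NatIso.ofComponents (fun _ => Iso.refl _) fun _ => rfl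

variable {p : ℕ}

/-- The cohomology of the complex `R I^•` in terms of Ext groups. -/
lemma nonempty_homology_iso {𝒜 : Type*} [Category* 𝒜] [Abelian 𝒜] [HasExt.{u} 𝒜] {J : Type u}
    [SmallCategory J] {F : RMod (ZMod p) J ⥤ 𝒜} {R : 𝒜 ⥤ RMod (ZMod p) J} [F.Additive]
    [R.Additive] (adj : F ⊣ R) {N : 𝒜} (I : InjectiveResolution N) (t : ℕ)
    (H : RMod (ZMod p) J)
    (θ : ∀ c : J, Abelian.Ext.{u} (F.obj ((freeMod (ZMod p)).obj (yoneda.obj c))) N t ≃+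
      H.obj (op c))
    (hθ : ∀ {c d : J} (a : c ⟶ d) (x : Abelian.Ext.{u} _ N t), H.map a.op (θ d x) =
      θ c ((Abelian.Ext.mk₀ (F.map ((freeMod (ZMod p)).map (yoneda.map a)))).comp x
        (zero_add t))) :
    Nonempty ((I.mapCochainComplex R).homology (t : ℤ) ≅ H) := by
  set L := I.mapCochainComplex R with hL
  have hd (c : J) (z : (L.cycles (t : ℤ)).obj (op c)) :
      freeYonedaLift z ≫ L.iCycles (t : ℤ) ∈ cocyclesFrom _ L t := by
    change _ = _
    rw [Category.assoc, HomologicalComplex.iCycles_d, comp_zero]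
  let f (c : J) : (L.cycles (t : ℤ)).obj (op c) →+ H.obj (op c) :=
    AddMonoidHom.mk' (fun z => θ c (extOfCocycle.{u} adj I _ t ⟨_, hd c z⟩)) fun z z' => by
      rw [← map_add, ← map_add]
      congr 2
      refine Subtype.ext ?_
      exact (congrArg (· ≫ L.iCycles (t : ℤ)) (freeYonedaLift_add z z')).trans
        (Preadditive.add_comp _ _ _ _ _ _)
  -- An element of the cycles at `c` is a cocycle out of k[J(-, c)], and `β` takes its Ext class.
  -- The kernel consists of the boundaries and `β` is onto, so `H` is the same cokernel as the
  -- homology.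
  let β : L.cycles (t : ℤ) ⟶ H :=
    { app := fun x => ModuleCat.ofHom ((f x.unop).toZModLinearMap p)
      naturality := fun x y a => by
        refine ModuleCat.hom_ext (LinearMap.ext fun z => ?_)
        refine Eq.trans ?_ (hθ a.unop (extOfCocycle.{u} adj I _ t ⟨_, hd x.unop z⟩)).symm
        refine congrArg (θ y.unop) ?_
        refine extOfCocycle_precomp adj I _ t _ _ ?_
        change freeYonedaLift _ ≫ _ = _ ≫ freeYonedaLift z ≫ _
        rw [← Category.assoc, map_comp_freeYonedaLift]
        rfl }
  have hβ (c : J) (z) : β.app (op c) z = θ c (extOfCocycle.{u} adj I _ t ⟨_, hd c z⟩) := rfl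
  have hz (c : J) (y : (L.X ((t : ℤ) - 1)).obj (op c)) (z : (L.cycles (t : ℤ)).obj (op c)) :
      (L.toCycles ((t : ℤ) - 1) t).app (op c) y = z ↔
        freeYonedaLift y ≫ L.d ((t : ℤ) - 1) t = freeYonedaLift z ≫ L.iCycles t := by
    rw [← L.toCycles_i ((t : ℤ) - 1) t, ← Category.assoc, cancel_mono, freeYonedaLift_comp]
    exact freeYonedaLift_injective.eq_iff.symm
  have hβ0 (c : J) (z) : β.app (op c) z = 0 ↔
      ∃ y, (L.toCycles ((t : ℤ) - 1) t).app (op c) y = z := by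
    rw [hβ, EmbeddingLike.map_eq_zero_iff, extOfCocycle_eq_zero_iff]
    constructor
    · rintro ⟨g, hg⟩
      obtain ⟨y, rfl⟩ := freeYonedaLift_surjective g
      exact ⟨y, (hz c y z).2 hg⟩
    · rintro ⟨y, hy⟩
      exact ⟨freeYonedaLift y, (hz c y z).1 hy⟩
  have hw : L.toCycles ((t : ℤ) - 1) t ≫ β = 0 := by
    ext x : 2
    exact ModuleCat.hom_ext (LinearMap.ext fun y => (hβ0 x.unop _).2 ⟨y, rfl⟩)
  have hex : (ShortComplex.mk _ _ hw).Exact := by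
    refine exact_of_exact_evaluation _ fun x => ?_
    rw [ShortComplex.moduleCat_exact_iff]
    exact fun z hz' => (hβ0 x.unop z).1 hz'
  have hepi : Epi β := by
    refine @NatTrans.epi_of_epi_app _ _ _ _ _ _ _ fun x => ?_
    rw [ModuleCat.epi_iff_surjective]
    intro h
    obtain ⟨e, he⟩ := (θ x.unop).surjective h
    obtain ⟨g, hg⟩ := extOfCocycle_surjective adj I _ t e
    obtain ⟨y, hy⟩ := freeYonedaLift_surjective (L.liftCycles g.1 (t + 1) (by simp) g.2)
    refine ⟨y, ?_⟩
    rw [hβ, ← he, ← hg]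
    congr 2
    refine Subtype.ext ?_
    exact (congrArg (· ≫ L.iCycles (t : ℤ)) hy).trans (L.liftCycles_i g.1 (t + 1) (by simp) g.2)
  have c1 := hex.gIsCokernel
  have c2 := L.homologyIsCokernel ((t : ℤ) - 1) t (by simp)
  exact ⟨c2.coconePointUniqueUpToIso c1⟩

/-- The Leray spectral sequence of a functor `π : C ⥤ J`. -/
theorem exists_leray_spectralSequence {C J : Type u} [SmallCategory C] [SmallCategory J]
    (π : C ⥤ J) (N : RMod (ZMod p) C) (H : ℕ → RMod (ZMod p) J)
    (θ : ∀ (t : ℕ) (c : J), Abelian.Ext.{u} ((freeMod (ZMod p)).obj (π.op ⋙ yoneda.obj c)) N t ≃+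
      (H t).obj (op c))
    (hθ : ∀ (t : ℕ) {c d : J} (a : c ⟶ d) (x : Abelian.Ext.{u} _ N t), (H t).map a.op (θ t d x) =
      θ t c ((Abelian.Ext.mk₀ ((freeMod (ZMod p)).map
        (Functor.whiskerLeft π.op (yoneda.map a)))).comp x (zero_add t))) :
    ∃ E : E₂CohomologicalSpectralSequenceNat (ModuleCat.{u} (ZMod p)),
      (∀ (hr : (2 : ℤ) ≤ 2) (s t : ℕ), Nonempty ((E.page 2 hr).X (s, t) ≅ coh (H t) s)) ∧
      SpectralSequenceConverges E (fun n => coh N n) := by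
  let _ := HasDerivedCategory.standard (RMod (ZMod p) J)
  let R := π.op.ran (H := ModuleCat.{u} (ZMod p))
  let adj : res (ZMod p) π ⊣ R := π.op.ranAdjunction (ModuleCat.{u} (ZMod p))
  have : R.Additive := adj.right_adjoint_additive
  let I := InjectiveResolution.of N
  -- The left adjoint of `R` is a restriction functor, hence exact, so `R` preserves injectives;
  -- together with the lower bound this makes the complex K-injective.
  have hinj (n : ℤ) : Injective ((I.mapCochainComplex R).X n) :=
    Injective.injective_of_adjoint adj _
  have hge : (I.mapCochainComplex R).IsStrictlyGE 0 := by
    rw [CochainComplex.isStrictlyGE_iff]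
    intro i hi
    exact R.map_isZero (CochainComplex.isZero_of_isStrictlyGE _ 0 i hi)
  have hK : (I.mapCochainComplex R).IsKInjective := isKInjective_of_injective _ 0
  have hsmall (Y : DerivedCategory (RMod (ZMod p) J)) :=
    DerivedCategory.small_singleFunctor_hom (constMod (ZMod p) J) Y
  obtain ⟨E, h1, h2⟩ := DerivedCategory.exists_hyperExt_spectralSequence.{u, _} (ZMod p)
    (constMod (ZMod p) J) (DerivedCategory.Q.obj (I.mapCochainComplex R))
  refine ⟨E, fun hr s t => ?_, h2.of_equiv fun n => ?_⟩
  · obtain ⟨i⟩ := h1 hr s t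
    -- Restricting the free module on `yoneda.obj c` along `π` gives, by definition, the free module
    -- on `π.op ⋙ yoneda.obj c`, so `θ` applies.
    obtain ⟨j⟩ := nonempty_homology_iso adj I t (H t) (θ t) (hθ t)
    let j' := (DerivedCategory.homologyFunctorFactors _ (t : ℤ)).app (I.mapCochainComplex R) ≪≫ j
    exact ⟨i ≪≫ (zmodLinearEquiv (extCongr (Iso.refl _) j' s)).toModuleIso⟩
  · obtain ⟨e⟩ := nonempty_ext_addEquiv_hom.{u, _} I adj (constMod (ZMod p) J) n
    exact ⟨zmodLinearEquiv ((shrinkLinearCoyonedaEquiv (ZMod p) _ _).toAddEquiv.trans (e.symm.trans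
      (extCongr (constResIso (ZMod p) π).symm (Iso.refl N) n)))⟩

end
end CatCoh

/-! ### Ext groups under exact functors and dimension shifting -/

namespace CategoryTheory.Abelian.Ext

section

variable {𝒜 ℬ : Type*} [Category* 𝒜] [Category* ℬ] [Abelian 𝒜] [Abelian ℬ] [HasExt.{u} 𝒜]
  [HasExt.{u} ℬ]

lemma mapExactFunctor_comp_extClass (F : 𝒜 ⥤ ℬ) [F.Additive] [PreservesFiniteLimits F]
    [PreservesFiniteColimits F] {X : 𝒜} {S : ShortComplex 𝒜} (hS : S.ShortExact) {n n' : ℕ}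
    (z : Ext.{u} X S.X₃ n) (hn : n + 1 = n') :
    (z.comp hS.extClass hn).mapExactFunctor F =
      (z.mapExactFunctor F).comp (hS.map_of_exact F).extClass hn :=
  (mapExactFunctor_comp F z hS.extClass hn).trans
    (congrArg (fun w => Ext.comp (z.mapExactFunctor F) w hn) (mapExactFunctor_extClass F hS))

/-- The action of exact functors on Ext groups is natural in the functor. -/
lemma mapExactFunctor_naturality [EnoughInjectives 𝒜] {F G : 𝒜 ⥤ ℬ} [F.Additive]
    [PreservesFiniteLimits F] [PreservesFiniteColimits F] [G.Additive]
    [PreservesFiniteLimits G] [PreservesFiniteColimits G] (α : F ⟶ G) {X Y : 𝒜} {n : ℕ}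
    (x : Ext.{u} X Y n) :
    (x.mapExactFunctor F).comp (mk₀ (α.app Y)) (add_zero n) =
      (mk₀ (α.app X)).comp (x.mapExactFunctor G) (zero_add n) := by
  induction n generalizing Y with
  | zero =>
    obtain ⟨f, rfl⟩ := (mk₀_bijective X Y).2 x
    rw [mapExactFunctor_mk₀, mapExactFunctor_mk₀, mk₀_comp_mk₀, mk₀_comp_mk₀, α.naturality]
  | succ n ih =>
    -- A class of positive degree is a product with the extension class of an embedding of `Y` in an
    -- injective, and naturality is known for both factors.
    let S := ShortComplex.mk (Injective.ι Y) (cokernel.π (Injective.ι Y)) (cokernel.condition _)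
    have hS : S.ShortExact := { exact := ShortComplex.exact_cokernel _ }
    obtain ⟨z, rfl⟩ := covariant_sequence_exact₁ X hS x (eq_zero_of_injective _) rfl
    have e := ShortComplex.ShortExact.extClass_naturality (hS.map_of_exact F) (hS.map_of_exact G)
      (S.mapNatTrans α)
    have e1 := mapExactFunctor_comp_extClass F hS z rfl
    have e2 := mapExactFunctor_comp_extClass G hS z rfl
    refine (congrArg (fun w => Ext.comp w (mk₀ (α.app Y)) (add_zero _)) e1).trans ?_
    refine Eq.trans ?_ (congrArg (fun w => (mk₀ (α.app X)).comp w (zero_add _)) e2.symm)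
    refine (comp_assoc_of_third_deg_zero _ _ _ _).trans ?_
    refine (congrArg (fun w => (z.mapExactFunctor F).comp w rfl) e).trans ?_
    refine (comp_assoc_of_second_deg_zero _ _ _ _).symm.trans ?_
    refine (congrArg (fun w => Ext.comp w (hS.map_of_exact G).extClass rfl) (ih z)).trans ?_
    exact (comp_assoc _ _ _ _ _ (by omega))

lemma subsingleton_of_iso {X X' Y Y' : 𝒜} (i : X ≅ X') (j : Y ≅ Y') (n : ℕ)
    [Subsingleton (Ext.{u} X' Y' n)] : Subsingleton (Ext.{u} X Y n) :=
  (CatCoh.extCongr i j n).toEquiv.subsingleton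

/-- `R` is exact and preserves injectives, so embedding `W` in an injective lowers the degree on
both sides of the adjunction. In degree one, a class of `R W` comes from a map to the image of the
cokernel, and this lifts because its adjoint does. -/
lemma subsingleton_succ_of_adjunction [EnoughInjectives ℬ] {L : 𝒜 ⥤ ℬ} {R : ℬ ⥤ 𝒜} [L.Additive]
    [PreservesFiniteLimits L] [R.Additive] [PreservesFiniteLimits R] [PreservesFiniteColimits R]
    (adj : L ⊣ R) (X : 𝒜) (W : ℬ) (n : ℕ) (h : Subsingleton (Ext.{u} (L.obj X) W (n + 1))) :
    Subsingleton (Ext.{u} X (R.obj W) (n + 1)) := by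
  refine subsingleton_of_forall_eq 0 fun x => ?_
  induction n generalizing W with
  | zero =>
    let S := ShortComplex.mk (Injective.ι W) (cokernel.π (Injective.ι W)) (cokernel.condition _)
    have hS : S.ShortExact := { exact := ShortComplex.exact_cokernel _ }
    have hRS := hS.map_of_exact R
    have : Injective (S.map R).X₂ := Injective.injective_of_adjoint adj (Injective.under W)
    obtain ⟨z, rfl⟩ := covariant_sequence_exact₁ X hRS x (eq_zero_of_injective _) rfl
    obtain ⟨f, rfl⟩ := (mk₀_bijective X _).2 z
    obtain ⟨g', hg'⟩ := covariant_sequence_exact₃ (L.obj X) hS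
      (mk₀ ((adj.homEquiv X S.X₃).symm f)) rfl (Subsingleton.elim _ _)
    obtain ⟨g, rfl⟩ := (mk₀_bijective _ _).2 g'
    rw [mk₀_comp_mk₀] at hg'
    have hg := (mk₀_bijective _ _).1 hg'
    have hf : f = adj.homEquiv X S.X₂ g ≫ R.map S.g := by
      rw [← Adjunction.homEquiv_naturality_right, hg]
      exact (Equiv.apply_symm_apply (adj.homEquiv X S.X₃) f).symm
    subst hf
    refine (congrArg (fun w => Ext.comp w hRS.extClass rfl)
      (mk₀_comp_mk₀ (adj.homEquiv X S.X₂ g) (S.map R).g).symm).trans ?_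
    refine (comp_assoc_of_second_deg_zero _ _ _ _).trans ?_
    exact (congrArg (fun w => Ext.comp _ w _) hRS.comp_extClass).trans (comp_zero _ _ _ _ _)
  | succ n ih =>
    let S := ShortComplex.mk (Injective.ι W) (cokernel.π (Injective.ι W)) (cokernel.condition _)
    have hS : S.ShortExact := { exact := ShortComplex.exact_cokernel _ }
    have hRS := hS.map_of_exact R
    have : Injective (S.map R).X₂ := Injective.injective_of_adjoint adj (Injective.under W)
    obtain ⟨z, rfl⟩ := covariant_sequence_exact₁ X hRS x (eq_zero_of_injective _) rfl
    have hz : z = 0 := ih S.X₃ (subsingleton_of_forall_eq 0 fun y => by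
      obtain ⟨y', rfl⟩ := covariant_sequence_exact₃ (L.obj X) hS y rfl (Subsingleton.elim _ _)
      have : y' = 0 := eq_zero_of_injective (I := Injective.under W) y'
      rw [this, zero_comp]) z
    rw [hz]
    exact zero_comp _ _ _ _ _

/-- A dimension shifting criterion for the bijectivity of `x ↦ β · G(x)` on Ext groups. -/
lemma bijective_comp_mapExactFunctor (G : 𝒜 ⥤ ℬ) [G.Additive] [PreservesFiniteLimits G]
    [PreservesFiniteColimits G] {a : 𝒜} {b : ℬ} (β : b ⟶ G.obj a)
    (h0 : ∀ W : 𝒜, Function.Bijective fun f : a ⟶ W => β ≫ G.map f)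
    (hI : ∀ W : 𝒜, ∃ (I : 𝒜) (ι : W ⟶ I), Mono ι ∧ Injective I ∧
      ∀ n, Subsingleton (Ext.{u} b (G.obj I) (n + 1))) (W : 𝒜) (n : ℕ) :
    Function.Bijective fun x : Ext.{u} a W n =>
      (mk₀ β).comp (x.mapExactFunctor G) (zero_add n) := by
  have hmap {Y Z : 𝒜} {m : ℕ} (x : Ext.{u} a Y m) (f : Y ⟶ Z) :
      (mk₀ β).comp ((x.comp (mk₀ f) (add_zero m)).mapExactFunctor G) (zero_add m) =
        ((mk₀ β).comp (x.mapExactFunctor G) (zero_add m)).comp (mk₀ (G.map f)) (add_zero m) := by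
    rw [mapExactFunctor_comp, mapExactFunctor_mk₀, comp_assoc_of_third_deg_zero]
  induction n generalizing W with
  | zero =>
    have e : (fun x : Ext.{u} a W 0 => (mk₀ β).comp (x.mapExactFunctor G) (zero_add 0)) ∘ mk₀ =
        mk₀ ∘ fun f : a ⟶ W => β ≫ G.map f := by
      funext f
      simp [mapExactFunctor_mk₀]
    have e' := ((mk₀_bijective b (G.obj W)).comp (h0 W))
    rw [← e] at e'
    exact (Function.Bijective.of_comp_iff _ (mk₀_bijective a W)).1 e'
  | succ n ih =>
    -- Compare the long exact sequences of W → I → I/W and of its image under `G`. The higher Ext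
    -- groups of `I` vanish on both sides, by injectivity and by `hsub`, so degree n + 1 reduces to
    -- degree n.
    obtain ⟨I, ι, hι, hinj, hsub⟩ := hI W
    let S := ShortComplex.mk ι (cokernel.π ι) (cokernel.condition _)
    have hS : S.ShortExact := { exact := ShortComplex.exact_cokernel _ }
    have hGS := hS.map_of_exact G
    have hmap' (z : Ext.{u} a S.X₃ n) :
        (mk₀ β).comp ((z.comp hS.extClass rfl).mapExactFunctor G) (zero_add (n + 1)) =
          ((mk₀ β).comp (z.mapExactFunctor G) (zero_add n)).comp hGS.extClass rfl := by
      rw [mapExactFunctor_comp_extClass]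
      exact (comp_assoc _ _ _ _ _ (by omega)).symm
    constructor
    · have : ∀ x : Ext.{u} a W (n + 1),
          (mk₀ β).comp (x.mapExactFunctor G) (zero_add (n + 1)) = 0 → x = 0 := fun x hx => by
        obtain ⟨z, rfl⟩ := covariant_sequence_exact₁ a hS x
          (eq_zero_of_injective (I := I) _) rfl
        rw [hmap'] at hx
        obtain ⟨w, hw⟩ := covariant_sequence_exact₃ b hGS _ rfl hx
        obtain ⟨w', rfl⟩ := (ih I).2 w
        have h1 : z = w'.comp (mk₀ S.g) (add_zero n) := (ih S.X₃).1 (by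
          refine hw.symm.trans ?_
          exact (hmap w' S.g).symm)
        rw [h1, comp_assoc_of_second_deg_zero, hS.comp_extClass, comp_zero]
      intro x x' hxx
      refine sub_eq_zero.1 (this _ ?_)
      have e := (((Ext.mk₀ β).precomp (G.obj W) (zero_add (n + 1))).comp
        (G.mapExtAddHom a W (n + 1))).map_sub x x'
      refine e.trans (sub_eq_zero.2 hxx)
    · intro y
      obtain ⟨y', rfl⟩ := covariant_sequence_exact₁ b hGS y (@Subsingleton.elim _ (hsub n) _ _) rfl
      obtain ⟨z, rfl⟩ := (ih S.X₃).2 y'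
      exact ⟨z.comp hS.extClass rfl, hmap' z⟩

end

end CategoryTheory.Abelian.Ext

/-! ### Coinduced modules and pushforward from comma categories -/

namespace CatCoh

open Abelian

variable {k : Type} [CommRing k] {C D E : Type u} [SmallCategory C] [SmallCategory D]
  [SmallCategory E]

/-- The coinduced module `y ↦ V^{Hom(d, y)}`. -/
def coind (d : D) (V : ModuleCat.{u} k) : RMod k D where
  obj y := ModuleCat.of k ((d ⟶ y.unop) → V)
  map f := ModuleCat.ofHom (LinearMap.funLeft k V fun u => u ≫ f.unop)
  map_id y := by
    refine ModuleCat.hom_ext (LinearMap.ext fun v => funext fun u => ?_)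
    change v (u ≫ 𝟙 _) = v u
    rw [Category.comp_id]
  map_comp f g := by
    refine ModuleCat.hom_ext (LinearMap.ext fun v => funext fun u => ?_)
    change v (u ≫ g.unop ≫ f.unop) = v ((u ≫ g.unop) ≫ f.unop)
    rw [Category.assoc]

/-- The morphism to a coinduced module given by a morphism `N(d) ⟶ V`. -/
def coindLift {N : RMod k D} {d : D} {V : ModuleCat.{u} k} (h : N.obj (op d) ⟶ V) :
    N ⟶ coind d V where
  app y := ModuleCat.ofHom (LinearMap.pi fun u : d ⟶ y.unop => (N.map u.op ≫ h).hom)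
  naturality y y' f := by
    refine ModuleCat.hom_ext (LinearMap.ext fun v => funext fun u => ?_)
    change h (N.map u.op (N.map f v)) = h (N.map (f ≫ u.op) v)
    rw [N.map_comp]
    rfl

lemma coindLift_apply {N : RMod k D} {d : D} {V : ModuleCat.{u} k} (h : N.obj (op d) ⟶ V)
    {y : D} (v : N.obj (op y)) (u : d ⟶ y) :
    ((coindLift h).app (op y) v : (d ⟶ y) → V) u = h (N.map u.op v) := rfl

/-- Universal property of coinduction: naturality along u : d → y moves every coordinate to the
coordinate of the identity at `d`. -/
lemma eq_coindLift {N : RMod k D} {d : D} {V : ModuleCat.{u} k} (g : N ⟶ coind d V) :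
    g = coindLift (g.app (op d) ≫ ModuleCat.ofHom (LinearMap.proj (𝟙 d))) := by
  ext y : 2
  refine ModuleCat.hom_ext (LinearMap.ext fun v => funext fun u => ?_)
  have h := congrArg (fun (a : (d ⟶ d) → V) => a (𝟙 d))
    (NatTrans.naturality_apply g (Quiver.Hom.op (X := d) (Y := y.unop) u) v)
  refine Eq.trans ?_ h.symm
  change (g.app y v : (d ⟶ y.unop) → V) u = (g.app y v : (d ⟶ y.unop) → V) (𝟙 d ≫ u)
  rw [Category.id_comp]

/-- Maps to the coinduced module are maps from the value at `d` to `V`, so extending along a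
monomorphism only requires injectivity of `V`. -/
instance injective_coind (d : D) (V : ModuleCat.{u} k) [Injective V] : Injective (coind d V) where
  factors {X Y} g i _ := by
    have : Mono (i.app (op d)) := inferInstance
    refine ⟨coindLift (Injective.factorThru (g.app (op d) ≫
      ModuleCat.ofHom (LinearMap.proj (𝟙 d))) (i.app (op d))), ?_⟩
    conv_rhs => rw [eq_coindLift g]
    ext y : 2
    refine ModuleCat.hom_ext (LinearMap.ext fun v => funext fun u => ?_)
    have h := ConcreteCategory.congr_hom (Injective.comp_factorThru (g.app (op d) ≫
      ModuleCat.ofHom (LinearMap.proj (R := k) (φ := fun _ : d ⟶ d => V) (𝟙 d)))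
      (i.app (op d))) (X.map (Quiver.Hom.op (X := d) (Y := y.unop) u) v)
    refine Eq.trans ?_ h
    refine (coindLift_apply (y := y.unop) _ (i.app y v) u).trans ?_
    rw [← NatTrans.naturality_apply i]
    rfl

section pushforward

variable (d : D) (K : C ⥤ D)

/-- The action of morphisms on the elements of the modules `StructuredArrow` pushforward. -/
lemma map_homMk_apply {K : C ⥤ D} {d : D} (W : RMod k (StructuredArrow d K)) {c c' : C}
    (f : c' ⟶ c) (u' : d ⟶ K.obj c') (v : ∀ u : d ⟶ K.obj c, W.obj (op (StructuredArrow.mk u)))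
    (u : d ⟶ K.obj c) (h : u' ≫ K.map f = u) (e : StructuredArrow.mk u' ⟶ StructuredArrow.mk u)
    (he : e.right = f) :
    W.map (StructuredArrow.homMk f rfl :
      StructuredArrow.mk u' ⟶ StructuredArrow.mk (u' ≫ K.map f)).op (v (u' ≫ K.map f)) =
    W.map e.op (v u) := by
  subst h
  congr 4
  exact StructuredArrow.hom_ext _ _ he.symm

/-- The right adjoint of the restriction along `StructuredArrow.proj d K`. -/
def pushStructuredArrow : RMod k (StructuredArrow d K) ⥤ RMod k C where
  obj W :=
    { obj := fun c => ModuleCat.of k (∀ u : d ⟶ K.obj c.unop, W.obj (op (StructuredArrow.mk u)))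
      map := fun {c c'} f => ModuleCat.ofHom (LinearMap.pi fun u : d ⟶ K.obj c'.unop =>
        (W.map (StructuredArrow.homMk f.unop rfl :
          StructuredArrow.mk u ⟶ StructuredArrow.mk (u ≫ K.map f.unop)).op).hom ∘ₗ
            LinearMap.proj (u ≫ K.map f.unop))
      map_id := fun c => by
        refine ModuleCat.hom_ext (LinearMap.ext fun v => funext fun u => ?_)
        refine (map_homMk_apply W (𝟙 c.unop) u v u (by simp) (𝟙 _) rfl).trans ?_
        simp
      map_comp := fun {c c' c''} f g => by
        refine ModuleCat.hom_ext (LinearMap.ext fun v => funext fun u => ?_)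
        refine (map_homMk_apply W (g.unop ≫ f.unop) u v ((u ≫ K.map g.unop) ≫ K.map f.unop)
          (by simp) ((StructuredArrow.homMk g.unop rfl : StructuredArrow.mk u ⟶
            StructuredArrow.mk (u ≫ K.map g.unop)) ≫ StructuredArrow.homMk f.unop rfl)
            rfl).trans ?_
        rw [op_comp, W.map_comp]
        rfl }
  map α :=
    { app := fun c => ModuleCat.ofHom (LinearMap.pi fun u : d ⟶ K.obj c.unop =>
        (α.app (op (StructuredArrow.mk u))).hom ∘ₗ LinearMap.proj u)
      naturality := fun c c' f => by
        refine ModuleCat.hom_ext (LinearMap.ext fun v => funext fun u => ?_)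
        exact NatTrans.naturality_apply α _ _ }

instance : (pushStructuredArrow (k := k) d K).Additive where
  map_add := rfl

/-- Restriction along `StructuredArrow.proj d K` is left adjoint to `pushStructuredArrow d K`. -/
def pushStructuredArrowAdjunction :
    res k (StructuredArrow.proj d K) ⊣ pushStructuredArrow (k := k) d K :=
  Adjunction.mkOfHomEquiv
    { homEquiv := fun X W =>
        { toFun := fun φ =>
            { app := fun c => ModuleCat.ofHom (LinearMap.pi fun u : d ⟶ K.obj c.unop =>
                (φ.app (op (StructuredArrow.mk u))).hom)
              naturality := fun c c' f => by
                refine ModuleCat.hom_ext (LinearMap.ext fun v => funext fun u => ?_)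
                exact NatTrans.naturality_apply φ (StructuredArrow.homMk f.unop rfl :
                  StructuredArrow.mk u ⟶ StructuredArrow.mk (u ≫ K.map f.unop)).op v }
          invFun := fun ψ =>
            { app := fun e => ψ.app (op e.unop.right) ≫
                ModuleCat.ofHom (LinearMap.proj (R := k)
                  (φ := fun u : d ⟶ K.obj e.unop.right => W.obj (op (StructuredArrow.mk u)))
                    e.unop.hom)
              naturality := fun e e' f => by
                refine ModuleCat.hom_ext (LinearMap.ext fun v => ?_)
                have h := congrFun (show _ = (_ : ∀ u : d ⟶ K.obj e'.unop.right,
                  W.obj (op (StructuredArrow.mk u))) from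
                  NatTrans.naturality_apply ψ f.unop.right.op v) e'.unop.hom
                refine h.trans ?_
                exact map_homMk_apply W f.unop.right e'.unop.hom _ e.unop.hom
                  (StructuredArrow.w f.unop) f.unop rfl }
          left_inv := fun φ => rfl
          right_inv := fun ψ => rfl }
      homEquiv_naturality_left_symm := fun _ _ => rfl
      homEquiv_naturality_right := fun _ _ => rfl }

instance : PreservesFiniteLimits (pushStructuredArrow (k := k) d K) :=
  have := (pushStructuredArrowAdjunction (k := k) d K).rightAdjoint_preservesLimits
  inferInstance

/-- The values are products of modules, and a product of surjections is surjective by choosing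
preimages coordinatewise. -/
instance : PreservesFiniteColimits (pushStructuredArrow (k := k) d K) := by
  have key : ∀ S : ShortComplex (RMod k (StructuredArrow d K)), S.ShortExact →
      (S.map (pushStructuredArrow d K)).Exact ∧ Epi ((pushStructuredArrow d K).map S.g) :=
    fun S hS => by
      refine ⟨((Functor.preservesFiniteLimits_iff_forall_exact_map_and_mono
        (pushStructuredArrow (k := k) d K)).1 inferInstance S hS).1, ?_⟩
      have := hS.epi_g
      refine @NatTrans.epi_of_epi_app _ _ _ _ _ _ _ fun c => ?_
      rw [ModuleCat.epi_iff_surjective]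
      intro v
      have h (u : d ⟶ K.obj c.unop) := (ModuleCat.epi_iff_surjective
        (S.g.app (op (StructuredArrow.mk u)))).1 inferInstance
      choose w hw using fun u => h u (v u)
      exact ⟨w, funext hw⟩
  exact (Functor.preservesFiniteColimits_iff_forall_exact_map_and_epi _).2 key

end pushforward

end CatCoh

/-! ### Contractible categories and acyclic injective modules -/

namespace CatCoh

open Abelian

variable {k : Type} [CommRing k] {C D E : Type u} [SmallCategory C] [SmallCategory D]
  [SmallCategory E]

/-- A category is contractible if its identity functor is connected with a constant functor by
natural transformations `𝟭 ⟵ T ⟶ const` or `𝟭 ⟶ T ⟵ const`. -/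
def IsContractible (E : Type u) [SmallCategory E] : Prop :=
  ∃ (T : E ⥤ E) (e : E),
    (Nonempty (T ⟶ 𝟭 E) ∧ Nonempty (T ⟶ (Functor.const E).obj e)) ∨
    (Nonempty (𝟭 E ⟶ T) ∧ Nonempty ((Functor.const E).obj e ⟶ T))

lemma isContractible_of_isInitial {e : E} (h : IsInitial e) : IsContractible E :=
  ⟨(Functor.const E).obj e, e, Or.inl
    ⟨⟨{ app := h.to, naturality := fun _ _ _ => h.hom_ext _ _ }⟩, ⟨𝟙 _⟩⟩⟩

/-- The natural transformations join every object to the fixed object `e` by a zigzag. -/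
lemma IsContractible.exists_eq (h : IsContractible E) {α : Type*} (φ : E → α)
    (hφ : ∀ {x y : E}, (x ⟶ y) → φ x = φ y) : ∃ a, ∀ x, φ x = a := by
  obtain ⟨T, e, ⟨⟨α⟩, ⟨β⟩⟩ | ⟨⟨α⟩, ⟨β⟩⟩⟩ := h
  · exact ⟨φ e, fun x => (hφ (α.app x)).symm.trans (hφ (β.app x))⟩
  · exact ⟨φ e, fun x => (hφ (α.app x)).trans (hφ (β.app x)).symm⟩

/-- The natural transformation of restriction functors given by a natural transformation. -/
abbrev resMap (k : Type) [CommRing k] {K L : C ⥤ D} (α : K ⟶ L) : res k L ⟶ res k K :=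
  (Functor.whiskeringLeft Cᵒᵖ Dᵒᵖ (ModuleCat.{u} k)).map (NatTrans.op α)

/-- A module over the one-point category is a `k`-module, and the constant one is free of rank one.
-/
instance projective_constMod_point : Projective (constMod k (Discrete PUnit.{u + 1})) where
  factors {X Y} f e _ := by
    have : Projective (ModuleCat.of k (ULift.{u} k)) := ModuleCat.projective_of_free
      (Module.Basis.ofEquivFun (ULift.moduleEquiv.trans (LinearEquiv.funUnique Unit k k).symm))
    let x : (Discrete PUnit.{u + 1})ᵒᵖ := op ⟨⟨⟩⟩
    have : Epi (e.app x) := inferInstance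
    obtain ⟨g, hg⟩ : ∃ g : ModuleCat.of k (ULift.{u} k) ⟶ X.obj x, g ≫ e.app x = f.app x :=
      Projective.factors (P := ModuleCat.of k (ULift.{u} k)) (f.app x) (e.app x)
    refine ⟨{ app := fun y => g, naturality := fun y z a => ?_ }, ?_⟩
    · obtain rfl : a = 𝟙 x := Subsingleton.elim _ _
      exact (Category.id_comp _).trans
        ((Category.comp_id g).symm.trans (congrArg (g ≫ ·) (X.map_id x).symm))
    · ext y : 2
      exact hg

/-- Homotopy invariance: on constant modules `γ` induces isomorphisms between the two restrictions,
so by naturality the two restricted classes determine each other. -/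
lemma mapExactFunctor_res_eq_zero_iff {K L : E ⥤ D} (γ : K ⟶ L) {V : ModuleCat.{u} k} {n : ℕ}
    (x : Ext.{u} (constMod k D) ((Functor.const Dᵒᵖ).obj V) n) :
    x.mapExactFunctor (res k K) = 0 ↔ x.mapExactFunctor (res k L) = 0 := by
  have hiso (V : ModuleCat.{u} k) : IsIso ((resMap k γ).app ((Functor.const Dᵒᵖ).obj V)) :=
    @NatIso.isIso_of_isIso_app _ _ _ _ _ _ _ fun x => inferInstanceAs (IsIso (𝟙 V))
  have h1 : IsIso ((resMap k γ).app (constMod k D)) := hiso (ModuleCat.of k (ULift.{u} k))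
  have h2 := hiso V
  have h := Ext.mapExactFunctor_naturality (resMap k γ) x
  constructor
  · intro h0
    rw [h0, Ext.comp_zero] at h
    have h3 := congrArg (fun y => Ext.comp y (Ext.mk₀ (inv ((resMap k γ).app
      ((Functor.const Dᵒᵖ).obj V)))) (add_zero _)) h
    simp only [Ext.zero_comp] at h3
    rwa [Ext.comp_assoc_of_second_deg_zero, Ext.mk₀_comp_mk₀, IsIso.hom_inv_id,
      Ext.comp_mk₀_id] at h3
  · intro h0
    rw [h0, Ext.zero_comp] at h
    have h3 := congrArg (fun y => (Ext.mk₀ (inv ((resMap k γ).app (constMod k D)))).comp y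
      (zero_add _)) h
    simp only [Ext.comp_zero] at h3
    rw [← Ext.comp_assoc_of_second_deg_zero, Ext.mk₀_comp_mk₀, IsIso.inv_hom_id,
      Ext.mk₀_id_comp] at h3
    exact h3.symm

/-- The cohomology of contractible categories with constant coefficients vanishes. -/
lemma IsContractible.subsingleton_ext (h : IsContractible E) (V : ModuleCat.{u} k) (n : ℕ) :
    Subsingleton (Ext.{u} (constMod k E) ((Functor.const Eᵒᵖ).obj V) (n + 1)) := by
  obtain ⟨T, e, h⟩ := h
  refine subsingleton_of_forall_eq 0 fun x => ?_
  have h0 : x.mapExactFunctor (res k ((Functor.const E).obj e)) = 0 := by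
    -- The constant functor factors through a point, where classes of positive degree vanish.
    let A : E ⥤ Discrete PUnit.{u + 1} := (Functor.const E).obj ⟨⟨⟩⟩
    let B : Discrete PUnit.{u + 1} ⥤ E := (Functor.const _).obj e
    have h1 : (x.mapExactFunctor (res k B)) = 0 :=
      Ext.eq_zero_of_projective (P := constMod k (Discrete PUnit.{u + 1})) _
    have h2 := res_ext_comp A B x
    rw [h1, Ext.mapExactFunctor_zero] at h2
    exact h2.symm
  refine (res_ext_id x).symm.trans ?_
  rcases h with ⟨⟨α⟩, ⟨β⟩⟩ | ⟨⟨α⟩, ⟨β⟩⟩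
  · exact (mapExactFunctor_res_eq_zero_iff α x).1 ((mapExactFunctor_res_eq_zero_iff β x).2 h0)
  · exact (mapExactFunctor_res_eq_zero_iff α x).2 ((mapExactFunctor_res_eq_zero_iff β x).1 h0)

lemma subsingleton_ext_of_isEmpty [IsEmpty E] (X Y : RMod k E) (n : ℕ) :
    Subsingleton (Ext.{u} X Y n) := by
  refine subsingleton_of_forall_eq 0 fun x => ?_
  have h : 𝟙 X = 0 := NatTrans.ext (funext fun x => isEmptyElim x.unop)
  rw [← Ext.mk₀_id_comp x, h, Ext.mk₀_zero, Ext.zero_comp]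

/-- A Shapiro argument: the restriction of the coinduced module along `K` is the pushforward of the
constant module `V` from the category d ↓ K, so its cohomology vanishes with that of d ↓ K. -/
lemma subsingleton_ext_res_coind (K : C ⥤ D) (d : D)
    (h : IsEmpty (StructuredArrow d K) ∨ IsContractible (StructuredArrow d K))
    (V : ModuleCat.{u} k) (n : ℕ) :
    Subsingleton (Ext.{u} (constMod k C) ((res k K).obj (coind d V)) (n + 1)) := by
  have h1 : Subsingleton (Ext.{u} (constMod k (StructuredArrow d K))
      ((Functor.const (StructuredArrow d K)ᵒᵖ).obj V) (n + 1)) := by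
    rcases h with h | h
    · exact subsingleton_ext_of_isEmpty _ _ _
    · exact h.subsingleton_ext V n
  have h2 : Subsingleton (Ext.{u} ((res k (StructuredArrow.proj d K)).obj (constMod k C))
      ((Functor.const (StructuredArrow d K)ᵒᵖ).obj V) (n + 1)) :=
    Ext.subsingleton_of_iso (constResIso k _).symm (Iso.refl _) _
  have h3 := Ext.subsingleton_succ_of_adjunction (pushStructuredArrowAdjunction (k := k) d K)
    (constMod k C) _ n h2
  let i : (res k K).obj (coind d V) ≅ (pushStructuredArrow d K).obj ((Functor.const _).obj V) :=
    NatIso.ofComponents (fun _ => Iso.refl _) fun _ => rfl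
  exact Ext.subsingleton_of_iso (Iso.refl _) i _

/-- Every module embeds in an injective module whose restriction along `K` is acyclic. -/
lemma exists_injective_res_acyclic [Finite D] (K : C ⥤ D)
    (h : ∀ d : D, IsEmpty (StructuredArrow d K) ∨ IsContractible (StructuredArrow d K))
    (W : RMod k D) : ∃ (I : RMod k D) (ι : W ⟶ I), Mono ι ∧ Injective I ∧
      ∀ n, Subsingleton (Ext.{u} (constMod k C) ((res k K).obj I) (n + 1)) := by
  obtain ⟨m, ⟨e⟩⟩ := Finite.exists_equiv_fin D
  have : HasFiniteBiproducts (RMod k D) := Abelian.hasFiniteBiproducts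
  let f (i : Fin m) : RMod k D := coind (e.symm i) (Injective.under (W.obj (op (e.symm i))))
  -- The component for an object `d` is injective on the value at `d`, as the coordinate of the
  -- identity shows. Finiteness of `D` makes a finite biproduct suffice.
  let ι : W ⟶ ⨁ f := biproduct.lift fun i => coindLift (Injective.ι (W.obj (op (e.symm i))))
  refine ⟨⨁ f, ι, Preadditive.mono_of_cancel_zero _ fun {Z} g hg => ?_, inferInstance,
    fun n => subsingleton_of_forall_eq 0 fun x => ?_⟩
  · ext y : 2
    obtain ⟨i, hi⟩ := e.symm.surjective y.unop
    obtain rfl : y = op (e.symm i) := congrArg op hi.symm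
    have h1 : g ≫ coindLift (Injective.ι (W.obj (op (e.symm i)))) = 0 := by
      have h2 := congrArg (· ≫ biproduct.π f i) hg
      simpa [ι] using h2
    rw [← cancel_mono (Injective.ι (W.obj (op (e.symm i))))]
    refine ModuleCat.hom_ext (LinearMap.ext fun z => ?_)
    have h2 := congrFun (show _ = (_ : (e.symm i ⟶ e.symm i) → _) from
      ConcreteCategory.congr_hom (congrArg (fun a => a.app (op (e.symm i))) h1) z) (𝟙 _)
    have h3 := coindLift_apply (Injective.ι (W.obj (op (e.symm i)))) (g.app _ z) (𝟙 _)
    rw [op_id, W.map_id] at h3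
    refine h3.symm.trans (h2.trans ?_)
    exact (map_zero (Injective.ι (W.obj _)).hom).symm
  -- The identity is a sum of maps through the summands, so acyclicity of each summand is enough.
  · have he : ∑ i, (res k K).map (biproduct.π f i) ≫ (res k K).map (biproduct.ι f i) = 𝟙 _ := by
      simp_rw [← Functor.map_comp]
      rw [← Functor.map_sum, biproduct.total, CategoryTheory.Functor.map_id]
    rw [← Ext.comp_mk₀_id x, ← he, Ext.mk₀_sum, Ext.comp_sum]
    refine Finset.sum_eq_zero fun i _ => ?_
    have := subsingleton_ext_res_coind K _ (h (e.symm i))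
      (Injective.under (W.obj (op (e.symm i)))) n
    rw [← Ext.mk₀_comp_mk₀, ← Ext.comp_assoc_of_second_deg_zero]
    refine (congrArg (fun y => Ext.comp y _ _) (Subsingleton.elim _ 0)).trans ?_
    exact Ext.zero_comp _ _ _ _ _

end CatCoh

/-! ### Comparison of cohomology along functors with contractible comma categories -/

namespace CatCoh

open Abelian

variable {k : Type} [CommRing k] {C D E : Type u} [SmallCategory C] [SmallCategory D]
  [SmallCategory E]

/-- The morphism from the constant module given by a compatible family of elements. -/
def constLift {N : RMod k D} (t : ∀ d : D, N.obj (op d))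
    (ht : ∀ {d d' : D} (f : d ⟶ d'), N.map f.op (t d') = t d) : constMod k D ⟶ N where
  app y := ModuleCat.ofHom (LinearMap.toSpanSingleton k _ (t y.unop) ∘ₗ
    ULift.moduleEquiv.toLinearMap)
  naturality y y' f := by
    refine ModuleCat.hom_ext (LinearMap.ext fun (a : ULift.{u} k) => ?_)
    change a.down • t y'.unop = N.map f (a.down • t y.unop)
    rw [map_smul]
    exact congrArg _ (ht f.unop).symm

/-- The generator of the constant module. -/
def constOne (d : Dᵒᵖ) : (constMod k D).obj d := ULift.up (1 : k)

lemma constLift_one {N : RMod k D} (t : ∀ d : D, N.obj (op d))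
    (ht : ∀ {d d' : D} (f : d ⟶ d'), N.map f.op (t d') = t d) (d : D) :
    (constLift t ht).app (op d) (constOne _) = t d :=
  one_smul k (t d)

lemma const_hom_ext {N : RMod k D} {a b : constMod k D ⟶ N}
    (h : ∀ d : D, a.app (op d) (constOne _) = b.app (op d) (constOne _)) : a = b := by
  ext y : 2
  refine ModuleCat.hom_ext (LinearMap.ext fun (r : ULift.{u} k) => ?_)
  have e : r = r.down • (constOne (k := k) (D := D) y : ULift.{u} k) :=
    ULift.ext _ _ (mul_one r.down).symm
  have e' (c : constMod k D ⟶ N) : c.app y r = r.down • c.app y (constOne y) :=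
    (congrArg (c.app y) e).trans (map_smul (c.app y).hom r.down _)
  exact (e' a).trans ((congrArg _ (h y.unop)).trans (e' b).symm)

lemma map_const_hom_one {N : RMod k D} (a : constMod k D ⟶ N) {d d' : D} (f : d ⟶ d') :
    N.map f.op (a.app (op d') (constOne _)) = a.app (op d) (constOne _) :=
  (NatTrans.naturality_apply a f.op (constOne _)).symm

/-- A section on `C` of a restricted module `K^*N` extends to `d` if `d ↓ K` is contractible. -/
lemma exists_map_eq {K : C ⥤ D} {N : RMod k D} (s : constMod k C ⟶ (res k K).obj N) {d : D}
    (h : IsContractible (StructuredArrow d K)) : ∃ t : N.obj (op d),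
      ∀ (c : C) (u : d ⟶ K.obj c), N.map u.op (s.app (op c) (constOne _)) = t := by
  obtain ⟨t, ht⟩ := h.exists_eq (fun e => N.map e.hom.op (s.app (op e.right) (constOne _)))
    fun {x y} f => by
      dsimp only
      rw [← map_const_hom_one s f.right]
      refine Eq.trans ?_ (congrArg (fun u : d ⟶ K.obj y.right => N.map u.op
        (s.app (op y.right) (constOne _))) (StructuredArrow.w f))
      rw [op_comp, N.map_comp]
      rfl
  exact ⟨t, fun c u => ht (StructuredArrow.mk u)⟩

/-- The homomorphism from the constant module to a restricted free module given by elements. -/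
def freeSection (k : Type) [CommRing k] (K : C ⥤ D) {G : Dᵒᵖ ⥤ Type u}
    [∀ x, Subsingleton (G.obj x)] (g : ∀ c, G.obj (op (K.obj c))) :
    constMod k C ⟶ (res k K).obj ((freeMod k).obj G) :=
  constLift (fun c => freeModMk (g c)) fun _ =>
    (freeMod_map_mk _ _).trans (congrArg _ (Subsingleton.elim _ _))

lemma freeSection_one (K : C ⥤ D) {G : Dᵒᵖ ⥤ Type u}
    [∀ x, Subsingleton (G.obj x)] (g : ∀ c, G.obj (op (K.obj c))) (c : C) :
    (freeSection k K g).app (op c) (constOne _) = freeModMk (g c) :=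
  one_smul k (freeModMk (g c))

/-- Let `G` be a sieve of objects of `D` such that `d ↓ K` is contractible for `d` in `G`, and
empty otherwise. Then the Ext groups of the free module on `G` are computed on `C`. -/
theorem bijective_ext_freeMod [Finite D] (K : C ⥤ D) {G : Dᵒᵖ ⥤ Type u}
    [∀ x, Subsingleton (G.obj x)] (g : ∀ c, G.obj (op (K.obj c)))
    (h : ∀ d, Nonempty (G.obj (op d)) → IsContractible (StructuredArrow d K))
    (N : RMod k D) (n : ℕ) : Function.Bijective fun x : Ext.{u} ((freeMod k).obj G) N n =>
      (Ext.mk₀ (freeSection k K g)).comp (x.mapExactFunctor (res k K)) (zero_add n) := by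
  refine Ext.bijective_comp_mapExactFunctor (res k K) (freeSection k K g) (fun W => ?_)
    (exists_injective_res_acyclic K fun d => ?_) N n
  -- Degree zero: a homomorphism out of k[G] is determined by its values at the objects K c, and
  -- such values glue because contractibility makes the pulled back value at `d` independent of the
  -- arrow d → K c.
  · have key (f : (freeMod k).obj G ⟶ W) (c : C) :
        (freeSection k K g ≫ (res k K).map f).app (op c) (constOne _) =
          f.app (op (K.obj c)) (freeModMk (g c)) :=
      congrArg (f.app (op (K.obj c))) (freeSection_one K g c)
    constructor
    · intro f f' hf
      refine freeMod_hom_ext fun d y => ?_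
      obtain ⟨T, e, -⟩ := h d.unop ⟨y⟩
      have key' (f : (freeMod k).obj G ⟶ W) : f.app d (freeModMk y) =
          W.map e.hom.op (f.app (op (K.obj e.right)) (freeModMk (g e.right))) := by
        refine Eq.trans ?_ (NatTrans.naturality_apply f e.hom.op _)
        rw [freeMod_map_mk]
        exact congrArg (fun z : G.obj d => f.app d (freeModMk z)) (Subsingleton.elim _ _)
      rw [key' f, key' f', ← key, ← key]
      exact congrArg (fun a : constMod k C ⟶ (res k K).obj W =>
        W.map e.hom.op (a.app (op e.right) (constOne _))) hf
    · intro s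
      choose t ht using fun (d : Dᵒᵖ) (y : G.obj d) => exists_map_eq s (h d.unop ⟨y⟩)
      refine ⟨freeModLift t fun d d' f y => ?_, const_hom_ext fun c => ?_⟩
      · obtain ⟨T, e, -⟩ := h d.unop ⟨y⟩
        rw [← ht d y _ e.hom, ← ht d' _ _ (f.unop ≫ e.hom), op_comp, W.map_comp]
        rfl
      · refine (key _ c).trans ((freeModLift_mk _ _ _).trans ?_)
        refine (ht _ _ c (𝟙 _)).symm.trans ?_
        rw [op_id, W.map_id]
        rfl
  -- Outside the sieve d ↓ K is empty, since an arrow d → K c would pull the section `g c` back to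
  -- `d`.
  · by_cases hd : Nonempty (G.obj (op d))
    · exact Or.inr (h d hd)
    · exact Or.inl ⟨fun e => hd ⟨G.map e.hom.op (g e.right)⟩⟩

/-- If all the categories `d ↓ K` are contractible, then `K` induces isomorphisms in
cohomology. -/
theorem isIso_cohMap [Finite D] (K : C ⥤ D) (h : ∀ d, IsContractible (StructuredArrow d K))
    {N : RMod k D} {N' : RMod k C} (α : K.op ⋙ N ⟶ N') [IsIso α] (n : ℕ) :
    IsIso (cohMap K α n) := by
  have h1 : Function.Bijective fun x : Ext.{u} (constMod k D) N n =>
      (Ext.mk₀ (constRes k K)).comp (x.mapExactFunctor (res k K)) (zero_add n) := by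
    refine Ext.bijective_comp_mapExactFunctor (res k K) (constRes k K) (fun W => ?_)
      (exists_injective_res_acyclic K fun d => Or.inr (h d)) N n
    have key (f : constMod k D ⟶ W) (c : C) :
        (constRes k K ≫ (res k K).map f).app (op c) (constOne _) =
          f.app (op (K.obj c)) (constOne _) := rfl
    constructor
    · intro f f' hf
      refine const_hom_ext fun d => ?_
      obtain ⟨T, e, -⟩ := h d
      rw [← map_const_hom_one f e.hom, ← map_const_hom_one f' e.hom, ← key, ← key]
      exact congrArg (fun a : constMod k C ⟶ (res k K).obj W =>
        W.map e.hom.op (a.app (op e.right) (constOne _))) hf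
    · intro s
      choose t ht using fun d => exists_map_eq s (h d)
      refine ⟨constLift t fun {d d'} f => ?_, const_hom_ext fun c => ?_⟩
      · obtain ⟨T, e, -⟩ := h d'
        rw [← ht d' _ e.hom, ← ht d _ (f ≫ e.hom), op_comp, W.map_comp]
        rfl
      · refine (key _ c).trans ((constLift_one _ _ _).trans ?_)
        refine (ht _ c (𝟙 _)).symm.trans ?_
        rw [op_id, W.map_id]
        rfl
  have h2 := (extCongr (Iso.refl (constMod k C)) (asIso α) n).bijective.comp h1
  have h3 : Function.Bijective (cohMap K α n).hom := by
    refine Eq.mp (congrArg Function.Bijective (funext fun x => ?_)) h2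
    refine Eq.trans ?_ (cohMap_apply K α n x).symm
    exact Ext.mk₀_id_comp _
  exact (ConcreteCategory.isIso_iff_bijective _).2 h3

end CatCoh

/-! ### Saturation, centric subgroups and normalizers of chains -/

/-- Sylow's theorem: every `p`-subgroup is conjugate to a subgroup of a given Sylow subgroup. -/
lemma Sylow.exists_conj_mem {p : ℕ} [Fact p.Prime] {G : Type*} [Group G] [Finite G]
    (T : Sylow p G) {D : Subgroup G} (hD : IsPGroup p D) :
    ∃ a : G, ∀ d ∈ D, a * d * a⁻¹ ∈ T := by
  obtain ⟨T', hT'⟩ := hD.exists_le_sylow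
  obtain ⟨a, rfl⟩ := MulAction.exists_smul_eq G T' T
  refine ⟨a, fun d hd => ?_⟩
  change a * d * a⁻¹ ∈ (a • T' : Sylow p G).toSubgroup
  exact Subgroup.smul_mem_pointwise_smul d (MulAut.conj a) _ (hT' hd)

namespace FusionSystem

variable {S : Type u} [Group S] {F : FusionSystem S}

lemma IsConj.trans {P Q R : Subgroup S} (h : F.IsConj P Q) (h' : F.IsConj Q R) :
    F.IsConj P R := by
  obtain ⟨f, hf, hs⟩ := h
  obtain ⟨g, hg, hs'⟩ := h'
  exact ⟨g.comp f, F.comp_mem hf hg, hs'.comp hs⟩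

lemma isConj_img {A B Q : Subgroup S} {f : A →* B} (hf : f ∈ F.Mor A B) (hQ : Q ≤ A) :
    F.IsConj Q (img f Q) :=
  ⟨restr f hQ fun x => apply_mem_img f (hQ x.2) x.2, restr_mem hf hQ _, fun ⟨y, hy⟩ => by
    obtain ⟨x, hA, hx, rfl⟩ := exists_of_mem_img hy
    exact ⟨⟨x, hx⟩, rfl⟩⟩

lemma IsCentric.of_isConj {P Q : Subgroup S} (h : F.IsCentric P) (hc : F.IsConj P Q) :
    F.IsCentric Q := fun R hR => h R (hc.trans hR)

lemma IsCentric.img {A B Q : Subgroup S} (h : F.IsCentric Q) {f : A →* B} (hf : f ∈ F.Mor A B)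
    (hQ : Q ≤ A) : F.IsCentric (img f Q) := h.of_isConj (isConj_img hf hQ)

lemma img_self_of_surjective {A B : Subgroup S} {f : A →* B} (hf : Function.Surjective f) :
    img f A = B := by
  ext y
  rw [mem_img]
  constructor
  · rintro ⟨x, -, rfl⟩
    exact (f x).2
  · intro hy
    obtain ⟨x, hx⟩ := hf ⟨y, hy⟩
    exact ⟨x, x.2, congrArg Subtype.val hx⟩

/-- A conjugate of `Q` contains a conjugate of `P`, and that one already contains its centralizer.
-/
lemma IsCentric.mono {P Q : Subgroup S} (h : F.IsCentric P) (hPQ : P ≤ Q) : F.IsCentric Q := by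
  rintro R ⟨f, hf, hs⟩
  have h1 := h _ (isConj_img hf hPQ)
  have h2 : FusionSystem.img f P ≤ R := img_le f P
  exact (Subgroup.centralizer_le h2).trans (h1.trans h2)

lemma IsCentric.centralizer_le {P : Subgroup S} (h : F.IsCentric P) :
    Subgroup.centralizer (P : Set S) ≤ P := h P ⟨MonoidHom.id P, F.id_mem P, fun x => ⟨x, rfl⟩⟩

/-- The image of an element normalizing `Q` normalizes the image of `Q`. -/
lemma apply_mem_normalizer_img {A B : Subgroup S} (f : A →* B)
    {Q : Subgroup S} (x : A) (hx : (x : S) ∈ Subgroup.normalizer (Q : Set S)) :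
    (f x : S) ∈ Subgroup.normalizer (img f Q : Set S) := by
  have key : ∀ x : A, (x : S) ∈ Subgroup.normalizer (Q : Set S) → ∀ y ∈ img f Q,
      (f x : S) * y * (f x : S)⁻¹ ∈ img f Q := by
    intro x hx y hy
    obtain ⟨z, hA, hz, rfl⟩ := exists_of_mem_img hy
    refine mem_img.2 ⟨x * ⟨z, hA⟩ * x⁻¹, (Subgroup.mem_normalizer_iff.1 hx z).1 hz, ?_⟩
    simp
  refine Subgroup.mem_normalizer_iff.2 fun y => ⟨key x hx y, fun hy => ?_⟩
  have h1 := key x⁻¹ (by simpa using hx) _ hy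
  simpa [mul_assoc] using h1

lemma Chain.apply_mem_normalizer {σ τ : F.Chain} {A B : Subgroup S} {f : A →* B}
    (h : img f '' σ.carrier = τ.carrier) (x : A) (hx : (x : S) ∈ σ.normalizer) :
    (f x : S) ∈ τ.normalizer := by
  refine Chain.mem_normalizer.2 fun Q hQ => ?_
  rw [← h] at hQ
  obtain ⟨P, hP, rfl⟩ := hQ
  exact apply_mem_normalizer_img f x (Chain.mem_normalizer.1 hx P hP)

variable [Finite S]

lemma exists_isFullyNormalized (V : Subgroup S) :
    ∃ V', F.IsConj V V' ∧ F.IsFullyNormalized V' := by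
  obtain ⟨V', h1, h2⟩ := Set.exists_max_image {Q | F.IsConj V Q}
    (fun Q => Nat.card (Subgroup.normalizer (Q : Set S))) (Set.toFinite _)
    ⟨V, MonoidHom.id V, F.id_mem V, fun x => ⟨x, rfl⟩⟩
  exact ⟨V', h1, fun Q hQ => h2 Q (h1.trans hQ)⟩

/-- In a saturated fusion system, any `p`-group of automorphisms of `V` becomes a group of
automorphisms induced by `S` on some fully normalized conjugate of `V`. -/
lemma IsSaturated.exists_iso_fullyNormalized {p : ℕ} [Fact p.Prime] (hF : F.IsSaturated p)
    {V : Subgroup S} {B : Subgroup (MulAut V)} (hB : B ≤ F.autF V) (hp : IsPGroup p B) :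
    ∃ (V' : Subgroup S) (f : V →* V'), f ∈ F.Mor V V' ∧ Function.Surjective f ∧
      F.IsFullyNormalized V' ∧ ∀ b ∈ B, ∃ y ∈ Subgroup.normalizer (V' : Set S),
        ∀ v : V, (f (b v) : S) = y * f v * y⁻¹ := by
  obtain ⟨V', ⟨f, hf, hs⟩, hV'⟩ := F.exists_isFullyNormalized V
  obtain ⟨T, hT⟩ := hF.fullyAutomized V' hV'
  have hb : Function.Bijective f := ⟨F.injective_of_mem hf, hs⟩
  let e : V ≃* V' := MulEquiv.ofBijective f hb
  have hmem : ∀ b ∈ B, MulAut.congr e b ∈ F.autF V' := fun b hbB =>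
    F.comp_mem (inverseHom_mem hf hb) (F.comp_mem (hB hbB) hf)
  -- The automorphisms of V' induced by S form a Sylow subgroup of Aut_F(V'), so some `a` in
  -- Aut_F(V') conjugates the transported `B` into it; `f` is then replaced by `a ∘ f`.
  obtain ⟨a, ha⟩ := T.exists_conj_mem
    (D := (B.map (MulAut.congr e).toMonoidHom).subgroupOf (F.autF V'))
    (IsPGroup.comap_subtype (hp.map _))
  refine ⟨V', (a : MulAut V').toMonoidHom.comp f, F.comp_mem hf a.2,
    (a : MulAut V').surjective.comp hs, hV', fun b hbB => ?_⟩
  have h1 := ha ⟨_, hmem b hbB⟩ (Subgroup.mem_map_of_mem _ hbB)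
  change _ ∈ (T : Subgroup (F.autF V')) at h1
  rw [hT] at h1
  obtain ⟨y, hy⟩ := h1
  refine ⟨y, y.2, fun v => ?_⟩
  have h2 := DFunLike.congr_fun hy ((a : MulAut V') (f v))
  have h3 : (MulAut.congr e b) (f v) = f (b v) := by
    change f (b (e.symm (e v))) = f (b v)
    rw [MulEquiv.symm_apply_apply]
  have h4 : (((a : MulAut V') * MulAut.congr e b * (a : MulAut V')⁻¹ : MulAut V')
      ((a : MulAut V') (f v)) : V') = (a : MulAut V') (f (b v)) := by
    rw [MulAut.mul_apply, MulAut.mul_apply, MulAut.inv_apply_self, h3]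
  exact (congrArg Subtype.val (h2.trans h4)).symm

namespace Chain

/-- The image of a chain under a morphism. -/
def map (σ : F.Chain) {A B : Subgroup S} {f : A →* B} (hf : f ∈ F.Mor A B) (h : σ.top ≤ A) :
    F.Chain where
  carrier := img f '' σ.carrier
  nonempty := σ.nonempty.image _
  isChain := by
    rintro _ ⟨P, hP, rfl⟩ _ ⟨Q, hQ, rfl⟩ -
    exact (σ.isChain.total hP hQ).imp (img_mono f) (img_mono f)
  centric := by
    rintro _ ⟨P, hP, rfl⟩
    exact (σ.centric P hP).img hf ((σ.le_top hP).trans h)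

lemma isConj_map (σ : F.Chain) {A B : Subgroup S} {f : A →* B} (hf : f ∈ F.Mor A B)
    (h : σ.top ≤ A) : σ.IsConj (σ.map hf h) := isConj_of_img hf h rfl

lemma img_top {σ τ : F.Chain} {A B : Subgroup S} {f : A →* B}
    (h : img f '' σ.carrier = τ.carrier) : img f σ.top = τ.top := by
  refine le_antisymm (τ.le_top (h ▸ ⟨_, σ.top_mem, rfl⟩)) ?_
  have := τ.top_mem
  rw [← h] at this
  obtain ⟨Q, hQ, hQ'⟩ := this
  rw [← hQ']
  exact img_mono f (σ.le_top hQ)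

/-- A morphism which maps a chain to itself fixes its members. -/
lemma img_eq_of_image_eq {σ : F.Chain} {A B : Subgroup S} {f : A →* B}
    (hf : Function.Injective f) (hA : σ.top ≤ A) (h : img f '' σ.carrier = σ.carrier)
    {Q : Subgroup S} (hQ : Q ∈ σ.carrier) : img f Q = Q := by
  have hQ' : img f Q ∈ σ.carrier := h ▸ ⟨Q, hQ, rfl⟩
  have hcard := card_img hf ((σ.le_top hQ).trans hA)
  rcases σ.isChain.total hQ' hQ with hle | hle
  · exact Subgroup.eq_of_le_of_card_ge hle hcard.ge
  · exact (Subgroup.eq_of_le_of_card_ge hle hcard.le).symm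

/-- The group of automorphisms of a chain. -/
def aut (σ : F.Chain) : Subgroup (MulAut σ.top) where
  carrier := {α | α ∈ F.autF σ.top ∧ ∀ Q ∈ σ.carrier, img α.toMonoidHom Q = Q}
  one_mem' := ⟨one_mem _, fun Q hQ => img_eq_self (σ.le_top hQ) fun _ _ => rfl⟩
  mul_mem' := by
    rintro a b ⟨ha, ha'⟩ ⟨hb, hb'⟩
    refine ⟨mul_mem ha hb, fun Q hQ => ?_⟩
    exact (img_comp b.toMonoidHom a.toMonoidHom Q).trans (by rw [hb' Q hQ, ha' Q hQ])
  inv_mem' := by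
    rintro a ⟨ha, ha'⟩
    refine ⟨Subgroup.inv_mem _ ha, fun Q hQ => ?_⟩
    conv_lhs => rw [← ha' Q hQ, ← img_comp]
    exact img_eq_self (σ.le_top hQ) fun x hx => congrArg Subtype.val (a.symm_apply_apply _)

/-- Every class of chains contains a chain `ω` such that the other chains `ρ` in the class are
mapped to `ω` by morphisms defined on the normalizer of `ρ`. -/
lemma exists_mor_normalizer {p : ℕ} [Fact p.Prime] (hS : IsPGroup p S) (hF : F.IsSaturated p)
    (σ : F.Chain) : ∃ ω : F.Chain, σ.IsConj ω ∧ ∀ ρ : F.Chain, ρ.IsConj σ →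
      ∃ g ∈ F.Mor (ρ.top ⊔ ρ.normalizer) ⊤, img g '' ρ.carrier = ω.carrier := by
  -- Any Sylow subgroup of Aut_F(σ) serves. The chain ω is the image of σ under a map to a fully
  -- normalized subgroup that turns `B` into automorphisms induced by S.
  let B : Sylow p σ.aut := default
  obtain ⟨X, ψ, hψ, hψs, hX, hB⟩ := hF.exists_iso_fullyNormalized
    (B := (B : Subgroup σ.aut).map σ.aut.subtype)
    (by rintro _ ⟨b, -, rfl⟩; exact b.2.1) (B.2.map _)
  refine ⟨σ.map hψ le_rfl, σ.isConj_map hψ le_rfl, ?_⟩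
  rintro ρ ⟨φ, hφ, hφs, hρ⟩
  have hb : Function.Bijective φ := ⟨F.injective_of_mem hφ, hφs⟩
  let e : ρ.top ≃* σ.top := MulEquiv.ofBijective φ hb
  have hle : ρ.normalizer ≤ Subgroup.normalizer (ρ.top : Set S) := fun x hx =>
    mem_normalizer.1 hx _ ρ.top_mem
  -- The conjugation action of N_S(ρ) on the largest member of ρ, transported to σ; its image is a
  -- p-subgroup of Aut_F(σ).
  let c : ρ.normalizer →* MulAut σ.top := (MulAut.congr e).toMonoidHom.comp
    ((Subgroup.normalizerMonoidHom ρ.top).comp (Subgroup.inclusion hle))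
  have hc : ∀ (x : ρ.normalizer) (z w : ρ.top), (w : S) = x * z * (x : S)⁻¹ →
      c x (φ z) = φ w := by
    intro x z w h
    change φ ((Subgroup.normalizerMonoidHom ρ.top (Subgroup.inclusion hle x)) (e.symm (e z))) = _
    rw [MulEquiv.symm_apply_apply]
    exact congrArg φ (Subtype.ext h.symm)
  have hconj : ∀ (x : ρ.normalizer) (z : ρ.top), (x : S) * z * (x : S)⁻¹ ∈ ρ.top := fun x z =>
    (Subgroup.mem_normalizer_iff.1 (hle x.2) z).1 z.2
  have hcmem : ∀ x, c x ∈ σ.aut := by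
    intro x
    refine ⟨F.comp_mem (inverseHom_mem hφ hb) (F.comp_mem
      (F.conj_mem (Subgroup.normalizerMonoidHom ρ.top (Subgroup.inclusion hle x)).toMonoidHom
        (x : S) fun _ => rfl) hφ), fun Q hQ => ?_⟩
    rw [← hρ] at hQ
    obtain ⟨P, hP, rfl⟩ := hQ
    have key : ∀ x : ρ.normalizer, img (c x).toMonoidHom (img φ P) ≤ img φ P := by
      intro x y hy
      obtain ⟨_, hA, hz, rfl⟩ := exists_of_mem_img hy
      obtain ⟨w, hA', hw, rfl⟩ := exists_of_mem_img hz
      have h1 := hc x ⟨w, hA'⟩ ⟨_, hconj x ⟨w, hA'⟩⟩ rfl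
      refine (congrArg (fun t : σ.top => (t : S)) h1).symm ▸ ?_
      exact apply_mem_img φ _
        ((Subgroup.mem_normalizer_iff.1 (mem_normalizer.1 x.2 P hP) w).1 hw)
    refine le_antisymm (key x) ?_
    have h2 := img_mono (c x).toMonoidHom (key x⁻¹)
    rw [← img_comp] at h2
    refine Eq.trans_le (Eq.symm (img_eq_self (img_le φ P) fun y hy => ?_)) h2
    rw [map_inv]
    exact congrArg Subtype.val ((c x).apply_symm_apply _)
  -- An automorphism `a` of σ moves this p-subgroup into `B`. Since `a` fixes the members of σ, the
  -- composite `θ` still carries ρ to ω.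
  obtain ⟨a, ha⟩ := B.exists_conj_mem (D := c.range.subgroupOf σ.aut)
    (IsPGroup.comap_subtype ((hS.to_subgroup _).of_surjective _ c.rangeRestrict_surjective))
  let θ : ρ.top →* X := ψ.comp ((a : MulAut σ.top).toMonoidHom.comp φ)
  have hθ : θ ∈ F.Mor ρ.top X := F.comp_mem (F.comp_mem hφ a.2.1) hψ
  have hθs : Function.Surjective θ := hψs.comp ((a : MulAut σ.top).surjective.comp hφs)
  have hθimg : img θ ρ.top = X := img_self_of_surjective hθs
  obtain ⟨g, hg, hgθ⟩ := hF.receptive X (hF.fullyCentralized X hX) ρ.top θ hθ hθs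
  -- For x in N_S(ρ), conjugation by x is transported by `θ` to an automorphism induced by S, so `x`
  -- lies in the domain to which saturation extends `θ`.
  have hN : ρ.normalizer ≤ extensionSubgroup θ := by
    intro x hx
    refine ⟨hle hx, ?_⟩
    have h1 := ha ⟨c ⟨x, hx⟩, hcmem _⟩ ⟨_, rfl⟩
    obtain ⟨y, hy, hy'⟩ := hB _ (Subgroup.mem_map_of_mem _ h1)
    rw [hθimg]
    refine ⟨y, hy, fun z w hzw => ?_⟩
    have h2 := hy' ((a : MulAut σ.top) (φ z))
    refine Eq.trans ?_ h2
    change ((ψ ((a : MulAut σ.top) (φ w)) : X) : S) = _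
    rw [← hc ⟨x, hx⟩ z w hzw]
    change _ = ((ψ (((a : MulAut σ.top) * c ⟨x, hx⟩ * (a : MulAut σ.top)⁻¹ : MulAut σ.top)
      ((a : MulAut σ.top) (φ z))) : X) : S)
    rw [MulAut.mul_apply, MulAut.mul_apply, MulAut.inv_apply_self]
  have hT : ρ.top ≤ extensionSubgroup θ := by
    intro x hx
    refine ⟨Subgroup.le_normalizer hx, θ ⟨x, hx⟩, ?_, fun z w hzw => ?_⟩
    · rw [hθimg]
      exact Subgroup.le_normalizer (θ ⟨x, hx⟩).2
    · have : w = ⟨x, hx⟩ * z * ⟨x, hx⟩⁻¹ := Subtype.ext hzw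
      rw [this]
      simp
  have hle' := sup_le hT hN
  refine ⟨g.comp (Subgroup.inclusion hle'), F.comp_mem (F.inclusion_mem hle') hg, ?_⟩
  have h3 : img (g.comp (Subgroup.inclusion hle')) '' ρ.carrier = img θ '' ρ.carrier :=
    Set.image_congr fun Q hQ => img_congr ((ρ.le_top hQ).trans le_sup_left) (ρ.le_top hQ)
      fun x hx => hgθ ⟨x, ρ.le_top hQ hx⟩ _ rfl
  rw [h3]
  change _ = img ψ '' σ.carrier
  rw [← hρ, Set.image_image]
  refine Set.image_congr fun Q hQ => ?_
  rw [img_comp, img_comp, a.2.2 _ (hρ ▸ ⟨Q, hQ, rfl⟩)]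

/-- If `σ` is fully normalized, the chains `ρ` conjugate to `σ` are mapped to `σ` by morphisms
between the normalizers. -/
lemma IsFullyNormalized.exists_mor_normalizer {p : ℕ} [Fact p.Prime] (hS : IsPGroup p S)
    (hF : F.IsSaturated p) {σ : F.Chain} (hσ : σ.IsFullyNormalized) {ρ : F.Chain}
    (hρ : ρ.IsConj σ) : ∃ g ∈ F.Mor (ρ.top ⊔ ρ.normalizer) (σ.top ⊔ σ.normalizer),
      img g '' ρ.carrier = σ.carrier := by
  obtain ⟨ω, hω, h⟩ := σ.exists_mor_normalizer hS hF
  obtain ⟨g, hg, hgρ⟩ := h ρ hρ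
  obtain ⟨g', hg', hgσ⟩ := h σ (IsConj.refl σ)
  have hgi := F.injective_of_mem hg'
  -- As σ is fully normalized, |N_S(ω)| ≤ |N_S(σ)|, so the injection into N_S(ω) is onto and `g'`
  -- can be inverted on all of N_S(ω).
  have h1 : img g' σ.normalizer = ω.normalizer := by
    refine Subgroup.eq_of_le_of_card_ge (fun y hy => ?_) ?_
    · obtain ⟨x, hA, hx, rfl⟩ := exists_of_mem_img hy
      exact apply_mem_normalizer hgσ ⟨x, hA⟩ hx
    · rw [card_img hgi le_sup_right]
      exact hσ ω hω
  have h2 : img g' (σ.top ⊔ σ.normalizer) = ω.top ⊔ ω.normalizer := by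
    rw [img_sup _ le_sup_left le_sup_right, h1, img_top hgσ]
  have h3 : ∀ x, (g x : S) ∈ ω.top ⊔ ω.normalizer := by
    have : img g (ρ.top ⊔ ρ.normalizer) ≤ ω.top ⊔ ω.normalizer := by
      rw [img_sup _ le_sup_left le_sup_right, img_top hgρ]
      refine sup_le_sup_left (fun y hy => ?_) _
      obtain ⟨x, hA, hx, rfl⟩ := exists_of_mem_img hy
      exact apply_mem_normalizer hgρ ⟨x, hA⟩ hx
    exact fun x => this (apply_mem_img g x.2 x.2)
  have h4 : ω.top ⊔ ω.normalizer ≤ ((⊤ : Subgroup S).subtype.comp g').range := by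
    rw [← h2]
    intro y hy
    obtain ⟨x, hA, hx, rfl⟩ := exists_of_mem_img hy
    exact ⟨⟨x, hA⟩, rfl⟩
  let r : ↥(ρ.top ⊔ ρ.normalizer) →* ((⊤ : Subgroup S).subtype.comp g').range :=
    ((⊤ : Subgroup S).subtype.comp g).codRestrict _ fun x => h4 (h3 x)
  have hr : r ∈ F.Mor _ _ := codRestrict_mem hg r fun _ => rfl
  refine ⟨(imageInv hgi).comp r, F.comp_mem hr (F.inv_mem hg' _ (imageInv_apply hgi)), ?_⟩
  have h5 : ∀ Q ∈ σ.carrier, img (imageInv hgi) (img g' Q) = Q := by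
    intro Q hQ
    have hA : Q ≤ σ.top ⊔ σ.normalizer := (σ.le_top hQ).trans le_sup_left
    ext y
    rw [mem_img]
    constructor
    · rintro ⟨⟨_, x, rfl⟩, hx', rfl⟩
      obtain ⟨z, hA, hz, hzx⟩ := exists_of_mem_img hx'
      have : x = ⟨z, hA⟩ := hgi (Subtype.ext hzx.symm)
      subst this
      exact (congrArg Subtype.val (imageInv_apply hgi ⟨z, hA⟩)).symm ▸ hz
    · intro hy
      exact ⟨⟨g' ⟨y, hA hy⟩, _, rfl⟩, apply_mem_img g' (hA hy) hy,
        congrArg Subtype.val (imageInv_apply hgi ⟨y, hA hy⟩)⟩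
  have h6 : img ((imageInv hgi).comp r) '' ρ.carrier =
      img (imageInv hgi) '' (img g '' ρ.carrier) := by
    rw [Set.image_image]
    refine Set.image_congr fun Q hQ => (img_comp _ _ _).trans ?_
    refine congrArg (img (imageInv hgi)) (img_congr ?_ ?_ fun _ _ => rfl) <;>
      exact (ρ.le_top hQ).trans le_sup_left
  rw [h6, hgρ, ← hgσ, Set.image_image]
  conv_rhs => rw [← Set.image_id σ.carrier]
  exact Set.image_congr h5

end Chain

end FusionSystem

/-! ### Morphisms which agree on a centric subgroup -/

namespace FusionSystem

variable {S : Type u} [Group S] {F : FusionSystem S}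

variable (F) in
/-- Every automorphism of `p`-power order is conjugate in `F` to one induced by `S`. -/
def PAutomorphismsInduced (p : ℕ) : Prop :=
  ∀ (V : Subgroup S) (α : MulAut V), α ∈ F.autF V → (∃ n : ℕ, α ^ p ^ n = 1) →
    ∃ (V' : Subgroup S) (f : V →* V'), f ∈ F.Mor V V' ∧
      ∃ y : S, ∀ v : V, (f (α v) : S) = y * f v * y⁻¹

/-- Apply the Sylow argument at a fully normalized conjugate to the cyclic p-group generated by the
automorphism. -/
lemma IsSaturated.pAutomorphismsInduced [Finite S] {p : ℕ} [Fact p.Prime]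
    (hF : F.IsSaturated p) : F.PAutomorphismsInduced p := by
  rintro V α hα ⟨n, hn⟩
  have hp : IsPGroup p (Subgroup.zpowers α) := by
    rintro ⟨_, k, rfl⟩
    refine ⟨n, Subtype.ext ?_⟩
    change (α ^ k) ^ p ^ n = 1
    rw [← zpow_natCast, ← zpow_mul, mul_comm, zpow_mul, zpow_natCast, hn, one_zpow]
  obtain ⟨V', f, hf, -, -, h⟩ := hF.exists_iso_fullyNormalized
    ((Subgroup.zpowers_le (H := F.autF V)).2 hα) hp
  obtain ⟨y, -, hy⟩ := h α (Subgroup.mem_zpowers α)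
  exact ⟨V', f, hf, y, hy⟩

/-- Centricity puts φ'(v) into φ(vP), so α = φ⁻¹φ' is an automorphism of N which fixes P and moves
elements only within cosets of P. It has p-power order, hence becomes conjugation by some y after a
morphism f; as y centralizes f(P), it comes from an element of Z(P). -/
lemma exists_conj_of_normal [Finite S] {p : ℕ} [Fact p.Prime] (hS : IsPGroup p S)
    (hF : F.PAutomorphismsInduced p) {P N W : Subgroup S} (hP : F.IsCentric P) (hPN : P ≤ N)
    (hN : N ≤ Subgroup.normalizer (P : Set S)) {φ φ' : N →* W} (hφ : φ ∈ F.Mor N W)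
    (hφ' : φ' ∈ F.Mor N W) (h : ∀ x (hx : x ∈ P), φ ⟨x, hPN hx⟩ = φ' ⟨x, hPN hx⟩) :
    ∃ z ∈ P, (∀ x ∈ P, z * x = x * z) ∧
      ∀ v w : N, (w : S) = z * v * z⁻¹ → φ' v = φ w := by
  have hi := F.injective_of_mem hφ
  have hi' := F.injective_of_mem hφ'
  -- Since v normalizes P, φ(v) and φ'(v) act equally on φ(P) by conjugation, so φ(v)⁻¹φ'(v)
  -- centralizes φ(P).
  have key : ∀ v : N, ∃ t : N, (t : S) ∈ P ∧ φ (v * t) = φ' v := by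
    intro v
    have h1 : ((φ v : S)⁻¹ * φ' v) ∈ Subgroup.centralizer (img φ P : Set S) := by
      rw [Subgroup.mem_centralizer_iff]
      intro y hy
      obtain ⟨x, hA, hx, rfl⟩ := exists_of_mem_img hy
      have hvx : (v : S) * x * (v : S)⁻¹ ∈ P := (Subgroup.mem_normalizer_iff.1 (hN v.2) x).1 hx
      have h2 := h _ hvx
      have h3 : (⟨_, hPN hvx⟩ : N) = v * ⟨x, hA⟩ * v⁻¹ := rfl
      rw [h3, map_mul, map_mul, map_inv, map_mul, map_mul, map_inv, ← h x hx] at h2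
      have h4 : (φ v : S) * φ ⟨x, hA⟩ * (φ v : S)⁻¹ = φ' v * φ ⟨x, hA⟩ * (φ' v : S)⁻¹ :=
        congrArg Subtype.val h2
      have h5 : (φ ⟨x, hA⟩ : S) = (φ v : S)⁻¹ * (φ' v * φ ⟨x, hA⟩ * (φ' v : S)⁻¹) * φ v := by
        rw [← h4]; group
      nth_rw 1 [h5]
      group
    obtain ⟨x, hA, hx, hx'⟩ := exists_of_mem_img ((hP.img hφ hPN).centralizer_le h1)
    refine ⟨⟨x, hA⟩, hx, Subtype.ext ?_⟩
    rw [map_mul, Subgroup.coe_mul, hx']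
    group
  have hrange : ∀ v : N, (φ' v : S) ∈ (W.subtype.comp φ).range := fun v => by
    obtain ⟨t, -, ht⟩ := key v
    exact ⟨v * t, congrArg Subtype.val ht⟩
  let r : N →* (W.subtype.comp φ).range := (W.subtype.comp φ').codRestrict _ hrange
  have hr : r ∈ F.Mor _ _ := codRestrict_mem hφ' r fun _ => rfl
  let α₀ : N →* N := (imageInv hi).comp r
  have hα₀ : α₀ ∈ F.Mor N N := F.comp_mem hr (F.inv_mem hφ _ (imageInv_apply hi))
  have hα₁ : ∀ v t : N, φ t = φ' v → α₀ v = t := fun v t ht => by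
    have : r v = ⟨φ t, t, rfl⟩ := Subtype.ext (congrArg (fun w : W => (w : S)) ht.symm)
    change imageInv hi (r v) = t
    rw [this, imageInv_apply]
  let α : MulAut N := MulEquiv.ofBijective α₀
    (Finite.injective_iff_bijective.1 (F.injective_of_mem hα₀))
  have hα : ∀ v, φ (α v) = φ' v := fun v => by
    obtain ⟨t, -, ht⟩ := key v
    rw [show α v = v * t from hα₁ v _ ht, ht]
  have hαP : ∀ x (hx : x ∈ P), α ⟨x, hPN hx⟩ = ⟨x, hPN hx⟩ := fun x hx =>
    hi ((hα _).trans (h x hx).symm)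
  obtain ⟨k, hk⟩ := IsPGroup.iff_card.1 hS
  have hpow : α ^ p ^ k = 1 := by
    ext v : 1
    obtain ⟨t, htP, ht⟩ := key v
    have h1 : α v = v * t := hα₁ v _ ht
    -- `α` fixes t, which lies in P, so iterating only multiplies by powers of t; the order of S, a
    -- power of p, kills them.
    have h2 : ∀ n : ℕ, (α ^ n) v = v * t ^ n := by
      intro n
      induction n with
      | zero => simp
      | succ n ih =>
        rw [pow_succ', MulAut.mul_apply, ih, map_mul, h1, map_pow,
          show α t = t from hαP t htP, pow_succ', mul_assoc]
    rw [h2, ← hk, MulAut.one_apply]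
    have : t ^ Nat.card S = 1 := Subtype.ext (by simp)
    rw [this, mul_one]
  obtain ⟨V', f, hf, y, hy⟩ := hF N α hα₀ ⟨k, hpow⟩
  have hyc : y ∈ Subgroup.centralizer (img f P : Set S) := by
    rw [Subgroup.mem_centralizer_iff]
    intro w hw
    obtain ⟨x, hA, hx, rfl⟩ := exists_of_mem_img hw
    have h1 := hy ⟨x, hA⟩
    rw [hαP x hx] at h1
    nth_rw 1 [h1]
    group
  obtain ⟨z, hA, hz, rfl⟩ := exists_of_mem_img ((hP.img hf hPN).centralizer_le hyc)
  have hαz : ∀ v, α v = ⟨z, hA⟩ * v * ⟨z, hA⟩⁻¹ := fun v =>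
    F.injective_of_mem hf (Subtype.ext (by simpa using hy v))
  refine ⟨z, hz, fun x hx => ?_, fun v w hw => ?_⟩
  · have h1 := congrArg Subtype.val ((hαP x hx).symm.trans (hαz ⟨x, hPN hx⟩))
    change x = z * x * z⁻¹ at h1
    nth_rw 2 [h1]
    group
  · rw [← hα v, hαz v]
    congr 1
    exact Subtype.ext hw.symm

/-- Two morphisms which agree on a centric subgroup `P` differ by conjugation with an element of
the center of `P`. -/
lemma exists_conj_of_eq_on_centric [Finite S] {p : ℕ} [Fact p.Prime] (hS : IsPGroup p S)
    (hF : F.PAutomorphismsInduced p) {P V W : Subgroup S} (hP : F.IsCentric P) (hPV : P ≤ V)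
    {φ φ' : V →* W} (hφ : φ ∈ F.Mor V W)
    (hφ' : φ' ∈ F.Mor V W) (h : ∀ x (hx : x ∈ P), φ ⟨x, hPV hx⟩ = φ' ⟨x, hPV hx⟩) :
    ∃ z ∈ P, (∀ x ∈ P, z * x = x * z) ∧
      ∀ v w : V, (w : S) = z * v * z⁻¹ → φ' v = φ w := by
  -- Induction enlarging P: in the nilpotent group V a proper P is smaller than N = N_V(P), and
  -- after conjugation by some z in Z(P) the two morphisms agree on N.
  induction hn : Nat.card S - Nat.card P using Nat.strong_induction_on generalizing P φ with
  | _ n ih =>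
  rcases hPV.eq_or_lt with rfl | hlt
  · refine ⟨1, one_mem _, fun x _ => by simp, fun v w hw => ?_⟩
    obtain rfl : w = v := Subtype.ext (by simpa using hw)
    exact (h w w.2).symm
  have hnil : Group.IsNilpotent V := (hS.to_subgroup V).isNilpotent
  have h1 : P.subgroupOf V < ⊤ := lt_top_iff_ne_top.2 fun e =>
    hlt.not_ge (Subgroup.subgroupOf_eq_top.1 e)
  have h2 := Group.normalizerCondition_of_isNilpotent (G := V) _ h1
  let N : Subgroup S := Subgroup.normalizer (P : Set S) ⊓ V
  have hNV : N ≤ V := inf_le_right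
  have hPN : P ≤ N := le_inf Subgroup.le_normalizer hPV
  have hPN' : P < N := by
    obtain ⟨x, hx, hx'⟩ := SetLike.exists_of_lt h2
    refine lt_of_le_of_ne hPN fun e => hx' ?_
    have : (x : S) ∈ N := ⟨Subgroup.mem_normalizer_iff.2 fun y => ?_, x.2⟩
    · rw [← e] at this
      exact this
    · rw [Subgroup.mem_normalizer_iff] at hx
      constructor
      · intro hy
        exact (hx ⟨y, hPV hy⟩).1 hy
      · intro hy
        have hyV : y ∈ V := by
          have := mul_mem (mul_mem (Subgroup.inv_mem _ x.2) (hPV hy)) x.2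
          simpa [mul_assoc] using this
        exact (hx ⟨y, hyV⟩).2 hy
  have hm := restr_mem hφ hNV fun x => (φ ⟨x, hNV x.2⟩).2
  have hm' := restr_mem hφ' hNV fun x => (φ' ⟨x, hNV x.2⟩).2
  obtain ⟨z, hz, hzc, hz'⟩ := exists_conj_of_normal hS hF hP hPN inf_le_left hm hm'
    fun x hx => h x hx
  let c : V →* V := (MulAut.conj (⟨z, hPV hz⟩ : V)).toMonoidHom
  have hc : c ∈ F.Mor V V := F.conj_mem c z fun _ => rfl
  have hcard : Nat.card P < Nat.card N := Set.ncard_lt_ncard hPN' (Set.toFinite _)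
  have hcard' : Nat.card N ≤ Nat.card S := Subgroup.card_le_card_group N
  obtain ⟨z', hz1, hz2, hz3⟩ := ih _ (by omega) (hP.mono hPN) hNV (φ := φ.comp c)
    (F.comp_mem hc hφ) (fun x hx => by
      have hzx : z * x * z⁻¹ ∈ N := mul_mem (mul_mem (hPN hz) hx) (Subgroup.inv_mem _ (hPN hz))
      exact Subtype.ext (congrArg Subtype.val (hz' ⟨x, hx⟩ ⟨_, hzx⟩ rfl)).symm) rfl
  -- The element from the induction is central in N, hence centralizes P, hence lies in P.
  have hzP : z' ∈ P := hP.centralizer_le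
    (Subgroup.mem_centralizer_iff.2 fun x hx => (hz2 x (hPN hx)).symm)
  refine ⟨z * z', mul_mem hz hzP, fun x hx => ?_, fun v w hw => ?_⟩
  · rw [mul_assoc, hz2 x (hPN hx), ← mul_assoc, hzc x hx, mul_assoc]
  · rw [hz3 v (⟨z', hPV hzP⟩ * v * ⟨z', hPV hzP⟩⁻¹) rfl]
    change φ (c _) = φ w
    congr 1
    refine Subtype.ext ?_
    rw [hw]
    change z * (z' * v * z'⁻¹) * z⁻¹ = _
    group

end FusionSystem

/-! ### Automorphisms of p-power order in normalizer systems -/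

namespace FusionSystem

variable {S : Type u} [Group S] {F : FusionSystem S}

/-- An automorphism whose restriction has `p`-power order can be replaced by a power of itself
which has `p`-power order and the same restriction. -/
lemma exists_pow_modEq {p : ℕ} [Fact p.Prime] {G : Type*} [Group G] [Finite G] (g : G) (n : ℕ) :
    ∃ k a : ℕ, k ≡ 1 [MOD p ^ n] ∧ (g ^ k) ^ p ^ a = 1 := by
  obtain ⟨a, m, hm, e⟩ := Nat.exists_eq_pow_mul_and_not_dvd (orderOf_pos g).ne' p
    (Fact.out : p.Prime).ne_one
  have hco : (p ^ n).Coprime m :=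
    Nat.Coprime.pow_left _ ((Nat.Prime.coprime_iff_not_dvd Fact.out).2 hm)
  -- The exponent is 1 modulo p^n, to preserve the restriction, and 0 modulo the prime-to-p part of
  -- the order, to kill it.
  obtain ⟨k, h1, h2⟩ := Nat.chineseRemainder hco 1 0
  refine ⟨k, a, h1, ?_⟩
  obtain ⟨j, rfl⟩ := (Nat.modEq_zero_iff_dvd).1 h2
  rw [← pow_mul, show m * j * p ^ a = orderOf g * j by rw [e]; ring, pow_mul, pow_orderOf_eq_one,
    one_pow]

lemma Chain.mem_top_sup {σ : F.Chain} {V : Subgroup σ.normalizer} (v : V) :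
    ((v : σ.normalizer) : S) ∈ σ.top ⊔ V.map σ.normalizer.subtype :=
  Subgroup.mem_sup_right (Subgroup.mem_map_of_mem _ v.2)

/-- This replaces saturation of N_F(σ). Extend the automorphism over the largest member of σ, make
the extension of p-power order, induce it by an element of S after a morphism in F, and bring the
image of σ back to σ. -/
lemma Chain.IsFullyNormalized.pAutomorphismsInduced [Finite S] {p : ℕ} [Fact p.Prime]
    (hS : IsPGroup p S)
    (hF : F.IsSaturated p) {σ : F.Chain} (hσ : σ.IsFullyNormalized) :
    (normalizerSystem σ).PAutomorphismsInduced p := by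
  rintro V α ⟨g, hg, hgα, hgσ⟩ ⟨n, hn⟩
  let γ : MulAut ↥(σ.top ⊔ V.map σ.normalizer.subtype) := MulEquiv.ofBijective g
    (Finite.injective_iff_bijective.1 (F.injective_of_mem hg))
  have hγF : γ ∈ F.autF _ := hg
  have hγα : ∀ (m : ℕ) (v : V), (((γ ^ m) ⟨_, Chain.mem_top_sup v⟩ :
      ↥(σ.top ⊔ V.map σ.normalizer.subtype)) : S) = ((α ^ m) v : V) := by
    intro m
    induction m with
    | zero => exact fun v => rfl
    | succ m ih =>
      intro v
      rw [pow_succ, MulAut.mul_apply, pow_succ, MulAut.mul_apply, ← ih]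
      congr 2
      exact Subtype.ext (hgα v v.2)
  have hγσ : ∀ (m : ℕ) (Q : Subgroup S), Q ∈ σ.carrier → img (γ ^ m).toMonoidHom Q = Q := by
    intro m Q hQ
    have hQ' : Q ≤ σ.top ⊔ V.map σ.normalizer.subtype := (σ.le_top hQ).trans le_sup_left
    induction m with
    | zero => exact img_eq_self hQ' fun _ _ => rfl
    | succ m ih =>
      rw [pow_succ]
      refine (img_comp γ.toMonoidHom (γ ^ m).toMonoidHom Q).trans ?_
      rw [show img γ.toMonoidHom Q = Q from hgσ Q hQ, ih]
  obtain ⟨k, a, hk, ha⟩ := exists_pow_modEq (p := p) γ n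
  have hαk : α ^ k = α := by
    conv_rhs => rw [← pow_one α]
    exact pow_eq_pow_iff_modEq.2 (hk.of_dvd (orderOf_dvd_of_pow_eq_one hn))
  obtain ⟨Y, f, hf, y, hy⟩ := hF.pAutomorphismsInduced _ (γ ^ k)
    (pow_mem hγF k) ⟨a, ha⟩
  let ρ := σ.map hf le_sup_left
  have hρ : img f '' σ.carrier = ρ.carrier := rfl
  -- Conjugation by y corresponds to the power of `γ`, which fixes every member of σ.
  have hyρ : y ∈ ρ.normalizer := by
    refine Chain.mem_normalizer.2 ?_
    rintro _ ⟨Q, hQ, rfl⟩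
    refine Subgroup.mem_normalizer_iff.2 fun w => ⟨fun hw => ?_, fun hw => ?_⟩
    · obtain ⟨q, hA, hq, rfl⟩ := exists_of_mem_img hw
      rw [← hy]
      refine apply_mem_img f _ ?_
      rw [← hγσ k Q hQ]
      exact apply_mem_img _ hA hq
    · obtain ⟨q, hA, hq, hqw⟩ := exists_of_mem_img hw
      rw [← hγσ k Q hQ] at hq
      obtain ⟨q', hA', hq', rfl⟩ := exists_of_mem_img hq
      have h1 := hy ⟨q', hA'⟩
      have h2 : y * w * y⁻¹ = y * f ⟨q', hA'⟩ * y⁻¹ := hqw.symm.trans h1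
      rw [mul_left_cancel (mul_right_cancel h2)]
      exact apply_mem_img f hA' hq'
  -- Full normalization of σ provides a map which brings ρ back to σ and is defined on N_S(ρ), in
  -- particular at `y`; its composite with `f` gives a morphism of N_F(σ), and the image of `y` lies
  -- in N_S(σ).
  obtain ⟨χ, hχ, hχρ⟩ := hσ.exists_mor_normalizer hS hF (σ.isConj_map hf le_sup_left).symm
  have hfr : ∀ x, (f x : S) ∈ ρ.top ⊔ ρ.normalizer := by
    have : img f (σ.top ⊔ V.map σ.normalizer.subtype) ≤ ρ.top ⊔ ρ.normalizer := by
      rw [img_sup _ le_sup_left le_sup_right, Chain.img_top hρ]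
      refine sup_le_sup_left (fun w hw => ?_) _
      obtain ⟨x, hA, hx, rfl⟩ := exists_of_mem_img hw
      exact Chain.apply_mem_normalizer hρ _ (Subgroup.map_subtype_le _ hx)
    exact fun x => this (apply_mem_img f x.2 x.2)
  let f' : ↥(σ.top ⊔ V.map σ.normalizer.subtype) →* ↥(ρ.top ⊔ ρ.normalizer) :=
    (Y.subtype.comp f).codRestrict _ hfr
  have hf' : f' ∈ F.Mor _ _ := codRestrict_mem hf f' fun _ => rfl
  have hρ' : img f' '' σ.carrier = ρ.carrier :=
    Set.image_congr fun Q hQ => img_congr ((σ.le_top hQ).trans le_sup_left)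
      ((σ.le_top hQ).trans le_sup_left) fun _ _ => rfl
  have hG := F.comp_mem hf' hχ
  have hGσ : img (χ.comp f') '' σ.carrier = σ.carrier := by
    refine Eq.trans ?_ hχρ
    rw [← hρ', Set.image_image]
    exact Set.image_congr fun Q _ => img_comp _ _ _
  have hT : (⊤ : Subgroup σ.normalizer).map σ.normalizer.subtype = σ.normalizer := by
    rw [← MonoidHom.range_eq_map, Subgroup.range_subtype]
  have hGV : ∀ v : V, (χ.comp f' ⟨_, Chain.mem_top_sup v⟩ : S) ∈ σ.normalizer := fun v =>
    Chain.apply_mem_normalizer hGσ _ (v : σ.normalizer).2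
  let j : V →* (⊤ : Subgroup σ.normalizer) :=
    { toFun := fun v => ⟨⟨_, hGV v⟩, trivial⟩
      map_one' := Subtype.ext (Subtype.ext (congrArg (fun w : ↥(σ.top ⊔ σ.normalizer) => (w : S))
        (map_one (χ.comp f'))))
      map_mul' := fun v w => Subtype.ext (Subtype.ext (congrArg
        (fun w : ↥(σ.top ⊔ σ.normalizer) => (w : S))
        (map_mul (χ.comp f') ⟨_, Chain.mem_top_sup v⟩ ⟨_, Chain.mem_top_sup w⟩))) }
  have hle : σ.top ⊔ σ.normalizer ≤
    σ.top ⊔ (⊤ : Subgroup σ.normalizer).map σ.normalizer.subtype := by rw [hT]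
  have hyχ : (χ ⟨y, Subgroup.mem_sup_right hyρ⟩ : S) ∈ σ.normalizer :=
    Chain.apply_mem_normalizer hχρ _ hyρ
  refine ⟨⊤, j, ⟨(Subgroup.inclusion hle).comp (χ.comp f'),
    F.comp_mem hG (F.inclusion_mem hle), fun x hx => rfl, fun Q hQ => ?_⟩,
    ⟨_, hyχ⟩, fun v => Subtype.ext ?_⟩
  · refine Eq.trans ?_ (Chain.img_eq_of_image_eq (F.injective_of_mem hG) le_sup_left hGσ hQ)
    exact img_congr ((σ.le_top hQ).trans le_sup_left) ((σ.le_top hQ).trans le_sup_left)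
      fun _ _ => rfl
  · have h1 := hy ⟨_, Chain.mem_top_sup v⟩
    have h2 : (γ ^ k) ⟨_, Chain.mem_top_sup v⟩ = ⟨_, Chain.mem_top_sup (α v)⟩ :=
      Subtype.ext ((hγα k v).trans (by rw [hαk]))
    rw [h2] at h1
    have h3 : f' ⟨_, Chain.mem_top_sup (α v)⟩ = ⟨y, Subgroup.mem_sup_right hyρ⟩ *
        f' ⟨_, Chain.mem_top_sup v⟩ * ⟨y, Subgroup.mem_sup_right hyρ⟩⁻¹ := Subtype.ext h1
    change (χ (f' ⟨_, Chain.mem_top_sup (α v)⟩) : S) = _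
    rw [h3, map_mul, map_mul, map_inv]
    rfl

end FusionSystem

/-! ### Reflective subcategories of orbit categories; classes of chains as orbit categories -/

namespace CatCoh

lemma isContractible_of_adjunction {C D : Type u} [SmallCategory C] [SmallCategory D]
    {L : D ⥤ C} {K : C ⥤ D} (adj : L ⊣ K) (d : D) : IsContractible (StructuredArrow d K) :=
  isContractible_of_isInitial (mkInitialOfLeftAdjoint K adj d)

end CatCoh

namespace FusionSystem

variable {S : Type u} [Group S] {F : FusionSystem S}

instance [Finite S] (C : Subgroup S → Prop) : Finite (F.Orb C) :=
  Finite.of_injective (fun P : F.Orb C => P.grp) fun P Q h => by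
    cases P; cases Q; cases h; rfl

lemma orbMk_exact {P Q : Subgroup S} {f g : P →* Q} {hf : f ∈ F.Mor P Q} {hg : g ∈ F.Mor P Q}
    (h : orbMk f hf = orbMk g hg) : ∃ q : Q, ∀ x, g x = q * f x * q⁻¹ :=
  Quotient.exact (s := F.innSetoid P Q) h

lemma orbMk_congr {P Q : Subgroup S} {f g : P →* Q} {hf : f ∈ F.Mor P Q} {hg : g ∈ F.Mor P Q}
    (h : ∀ x, g x = f x) : orbMk f hf = orbMk g hg :=
  orbMk_eq 1 fun x => by simpa using h x

lemma exists_liftHom_eq {N : Subgroup S} {P R : Subgroup N}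
    (f : P.map N.subtype →* R.map N.subtype) : ∃ f₀ : P →* R, liftHom f₀ = f := by
  refine ⟨(R.equivMapOfInjective _ N.subtype_injective).symm.toMonoidHom.comp
    (f.comp (P.equivMapOfInjective _ N.subtype_injective).toMonoidHom), ?_⟩
  refine MonoidHom.ext fun y => ?_
  obtain ⟨x, rfl⟩ := (P.equivMapOfInjective _ N.subtype_injective).surjective y
  rw [liftHom_apply]
  exact MulEquiv.apply_symm_apply _ _

lemma exists_orbMk {P Q : Subgroup S} (a : Quotient (F.innSetoid P Q)) :
    ∃ f hf, a = orbMk f hf := by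
  induction a using Quotient.inductionOn with | _ f => exact ⟨f.1, f.2, rfl⟩

/-- Let `C` be a collection of centric subgroups such that morphisms to subgroups which contain
`Q` extend from `P` to `PQ`. Then the subgroups containing `Q` form a reflective subcategory of
the orbit category. -/
lemma isContractible_structuredArrow_orbIncl [Finite S] {p : ℕ} [Fact p.Prime]
    (hS : IsPGroup p S) (hF : F.PAutomorphismsInduced p) {C : Subgroup S → Prop}
    (hC : ∀ P, C P → F.IsCentric P) {Q : Subgroup S} (hQ : ∀ P, Q ≤ P → C P)
    (hext : ∀ P R : Subgroup S, Q ≤ R → ∀ f ∈ F.Mor P R, ∃ g ∈ F.Mor (P ⊔ Q) R,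
      ∀ x (hx : x ∈ P), g ⟨x, Subgroup.mem_sup_left hx⟩ = f ⟨x, hx⟩) (P : F.Orb C) :
    CatCoh.IsContractible (StructuredArrow P (orbIncl (F := F) hQ)) := by
  -- The inclusion P → PQ is initial: morphisms extend by `hext`, and two extensions differ by an
  -- element of Z(P).
  let P' : F.Orb (Q ≤ ·) := ⟨P.grp ⊔ Q, le_sup_right⟩
  let i : P.grp →* P'.grp := Subgroup.inclusion le_sup_left
  let e : StructuredArrow P (orbIncl (F := F) hQ) :=
    StructuredArrow.mk (Y := P') (orbMk i (F.inclusion_mem le_sup_left))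
  have hexists (x : StructuredArrow P (orbIncl (F := F) hQ)) : Nonempty (e ⟶ x) := by
    obtain ⟨f, hf, hx⟩ := exists_orbMk x.hom
    obtain ⟨g, hg, hgf⟩ := hext P.grp x.right.grp x.right.mem f hf
    refine ⟨StructuredArrow.homMk (orbMk g hg) ?_⟩
    rw [hx]
    exact orbMk_congr fun y => (hgf y y.2).symm
  refine CatCoh.isContractible_of_isInitial (e := e) (IsInitial.ofUniqueHom
    (fun x => (hexists x).some) fun x m => ?_)
  generalize (hexists x).some = m'
  refine StructuredArrow.hom_ext _ _ ?_
  obtain ⟨f, hf, hm⟩ := exists_orbMk m.right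
  obtain ⟨f', hf', hm'⟩ := exists_orbMk m'.right
  have h1 := (StructuredArrow.w m').trans (StructuredArrow.w m).symm
  have h2 : orbMk (f'.comp i) (F.comp_mem (F.inclusion_mem le_sup_left) hf') =
      orbMk (f.comp i) (F.comp_mem (F.inclusion_mem le_sup_left) hf) := by
    have e1 : e.hom ≫ (orbIncl (F := F) hQ).map m'.right = orbMk (f'.comp i)
        (F.comp_mem (F.inclusion_mem le_sup_left) hf') :=
      congrArg (fun a => F.orbComp e.hom a) hm'
    have e2 : e.hom ≫ (orbIncl (F := F) hQ).map m.right = orbMk (f.comp i)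
        (F.comp_mem (F.inclusion_mem le_sup_left) hf) :=
      congrArg (fun a => F.orbComp e.hom a) hm
    exact e1.symm.trans (h1.trans e2)
  obtain ⟨r, hr⟩ := orbMk_exact h2
  let c : x.right.grp →* x.right.grp := (MulAut.conj r).toMonoidHom
  have hc : c ∈ F.Mor x.right.grp x.right.grp := F.conj_mem c r fun _ => rfl
  obtain ⟨z, hz, -, hz'⟩ := exists_conj_of_eq_on_centric hS hF (hC _ P.mem) le_sup_left
    (F.comp_mem hf' hc) hf fun y hy => (hr ⟨y, hy⟩).symm
  refine hm.trans (Eq.trans ?_ hm'.symm)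
  let z' : e.right.grp := ⟨z, Subgroup.mem_sup_left hz⟩
  -- The difference by `z` before `f'` becomes conjugation by `f' z'` after it, so the classes
  -- modulo inner automorphisms coincide.
  refine (orbMk_eq (r * f' z') fun v => ?_).symm
  rw [hz' v (z' * v * z'⁻¹) rfl]
  change r * f' (z' * v * z'⁻¹) * r⁻¹ = _
  rw [map_mul, map_mul, map_inv]
  group

lemma orb_comp_eq_id {C : Subgroup S → Prop} {P Q : F.Orb C} {f : P.grp →* Q.grp}
    {g : Q.grp →* P.grp} {hf : f ∈ F.Mor P.grp Q.grp} {hg : g ∈ F.Mor Q.grp P.grp}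
    (h : ∀ x, g (f x) = x) : F.orbComp (orbMk f hf) (orbMk g hg) = 𝟙 P :=
  orbMk_eq 1 fun x => by simpa using (h x).symm

section

variable [Finite S]

/-- A morphism defined on a larger subgroup carries `ρ` to `ρ'`. -/
lemma Carries.of_mor {ρ ρ' : F.Chain} {P R A B : Subgroup S} {f : P →* R} {g : A →* B}
    (hg : g ∈ F.Mor A B) (hρ : ρ.top ≤ A) (hP : P ≤ A)
    (h1 : ∀ (x : S) (hx : x ∈ P), (g ⟨x, hP hx⟩ : S) = f ⟨x, hx⟩)
    (h2 : img g '' ρ.carrier = ρ'.carrier) : Carries ρ ρ' f := by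
  have hm : ∀ x : ↥(ρ.top ⊔ P), (g ⟨x, sup_le hρ hP x.2⟩ : S) ∈ ρ'.top ⊔ R := by
    have : img g (ρ.top ⊔ P) ≤ ρ'.top ⊔ R := by
      rw [img_sup _ hρ hP, Chain.img_top h2]
      refine sup_le_sup_left (fun y hy => ?_) _
      obtain ⟨x, hA, hx, rfl⟩ := exists_of_mem_img hy
      rw [h1 x hx]
      exact (f ⟨x, hx⟩).2
    exact fun x => this (apply_mem_img g _ x.2)
  refine ⟨restr g (sup_le hρ hP) hm, restr_mem hg _ hm, fun x hx => h1 x hx, ?_⟩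
  rw [← h2]
  exact Set.image_congr fun Q hQ => img_congr ((ρ.le_top hQ).trans le_sup_left)
    ((ρ.le_top hQ).trans hρ) fun _ _ => rfl

lemma Carries.inverse {ρ ρ' : F.Chain} {P R : Subgroup S} {f : P →* R}
    (h : Carries ρ ρ' f) (hf : Function.Bijective f) : Carries ρ' ρ (inverseHom f hf) := by
  obtain ⟨g, hg, h1, h2⟩ := h
  have hgs : Function.Surjective g := by
    have : img g (ρ.top ⊔ P) = ρ'.top ⊔ R := by
      rw [img_sup _ le_sup_left le_sup_right, Chain.img_top h2]
      congr 1
      ext y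
      rw [mem_img]
      constructor
      · rintro ⟨x, hx, rfl⟩
        rw [h1 x hx]
        exact (f ⟨x, hx⟩).2
      · intro hy
        obtain ⟨x, hx⟩ := hf.2 ⟨y, hy⟩
        exact ⟨⟨x, Subgroup.mem_sup_right x.2⟩, x.2,
          (h1 x x.2).trans (congrArg Subtype.val hx)⟩
    intro y
    obtain ⟨x, -, hx⟩ := mem_img.1 (this.ge y.2)
    exact ⟨x, Subtype.ext hx⟩
  have hgb : Function.Bijective g := ⟨F.injective_of_mem hg, hgs⟩
  refine ⟨inverseHom g hgb, inverseHom_mem hg hgb, fun y hy => ?_, ?_⟩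
  · obtain ⟨x, hx⟩ := hf.2 ⟨y, hy⟩
    have h3 : (⟨y, Subgroup.mem_sup_right hy⟩ : ↥(ρ'.top ⊔ R)) =
        g ⟨x, Subgroup.mem_sup_right x.2⟩ :=
      Subtype.ext ((congrArg Subtype.val hx).symm.trans (h1 x x.2).symm)
    rw [h3, inverseHom_apply, ← hx, inverseHom_apply]
  · rw [← h2, Set.image_image]
    conv_rhs => rw [← Set.image_id ρ.carrier]
    refine Set.image_congr fun Q hQ => ?_
    rw [← img_comp]
    exact img_eq_self ((ρ.le_top hQ).trans le_sup_left) fun x hx =>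
      congrArg Subtype.val (inverseHom_apply g hgb _)

instance (σ : F.Chain) : (normOrbToChainOrb σ).Faithful where
  map_injective {P R a b} h := by
    obtain ⟨f, hf, rfl⟩ := exists_orbMk a
    obtain ⟨g, hg, rfl⟩ := exists_orbMk b
    have h1 : orbMk (liftHom f) (liftHom_mem hf) = orbMk (liftHom g) (liftHom_mem hg) :=
      congrArg ChainOrbHom.hom h
    obtain ⟨q, hq⟩ := orbMk_exact h1
    obtain ⟨r, rfl⟩ := (R.grp.equivMapOfInjective _ σ.normalizer.subtype_injective).surjective q
    refine orbMk_eq r fun x => ?_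
    have h2 := hq (P.grp.equivMapOfInjective _ σ.normalizer.subtype_injective x)
    rw [liftHom_apply, liftHom_apply, ← map_inv, ← map_mul, ← map_mul] at h2
    exact (R.grp.equivMapOfInjective _ σ.normalizer.subtype_injective).injective h2

/-- An injective map carrying the set of members of σ to itself fixes each member, by comparing
orders, so the morphism belongs to N_F(σ). -/
instance (σ : F.Chain) : (normOrbToChainOrb σ).Full where
  map_surjective {P R} b := by
    obtain ⟨f, hf, hb, g, hg, h1, h2⟩ := b.carries
    obtain ⟨f₀, hlift⟩ := exists_liftHom_eq (P := P.grp) (R := R.grp) f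
    have hf₀ : f₀ ∈ (normalizerSystem σ).Mor P.grp R.grp := by
      refine ⟨g, hg, fun x hx => ?_, fun Q hQ =>
        Chain.img_eq_of_image_eq (F.injective_of_mem hg) le_sup_left h2 hQ⟩
      refine (h1 x (Subgroup.mem_map_of_mem _ hx)).trans ?_
      refine Eq.trans ?_ (liftHom_coe f₀ ⟨x, hx⟩ ⟨x, Subgroup.mem_map_of_mem _ hx⟩ rfl)
      rw [hlift]
      rfl
    refine ⟨orbMk f₀ hf₀, ChainOrbHom.ext ?_⟩
    rw [hb]
    change orbMk (liftHom f₀) _ = orbMk f hf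
    congr 1

/-- As σ is fully normalized, a conjugate chain ρ is carried to σ by a morphism defined on N_S(ρ).
It maps P isomorphically to a subgroup of N_S(σ). -/
lemma essSurj_normOrbToChainOrb {p : ℕ} [Fact p.Prime] (hS : IsPGroup p S)
    (hF : F.IsSaturated p) {σ : F.Chain} (hσ : σ.IsFullyNormalized) :
    (normOrbToChainOrb σ).EssSurj where
  mem_essImage x := by
    obtain ⟨g, hg, hgσ⟩ := hσ.exists_mor_normalizer hS hF (Chain.cls_eq_iff.1 x.cls_eq)
    have hP : x.orb.grp ≤ x.chain.top ⊔ x.chain.normalizer := x.le.trans le_sup_right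
    have himg : img g x.orb.grp ≤ σ.normalizer := fun y hy => by
      obtain ⟨z, hA, hz, rfl⟩ := exists_of_mem_img hy
      exact Chain.apply_mem_normalizer hgσ _ (x.le hz)
    have hmap : ((img g x.orb.grp).subgroupOf σ.normalizer).map σ.normalizer.subtype =
        img g x.orb.grp := by
      rw [Subgroup.subgroupOf_map_subtype, inf_eq_left.2 himg]
    let R : NormOrb σ := ⟨(img g x.orb.grp).subgroupOf σ.normalizer, by
      rw [hmap]
      exact x.orb.mem.img hg hP⟩
    let y := (normOrbToChainOrb σ).obj R
    have hy : y.orb.grp = img g x.orb.grp := hmap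
    let f : x.orb.grp →* y.orb.grp := restr g hP fun z => by
      rw [hy]
      exact apply_mem_img g _ z.2
    have hf : f ∈ F.Mor _ _ := restr_mem hg hP _
    have hfs : Function.Bijective f := by
      refine ⟨F.injective_of_mem hf, fun w => ?_⟩
      obtain ⟨z, hA, hz, hw⟩ := exists_of_mem_img (hy.le w.2)
      exact ⟨⟨z, hz⟩, Subtype.ext hw⟩
    have hc : Carries x.chain y.chain f := Carries.of_mor hg le_sup_left hP (fun _ _ => rfl) hgσ
    exact ⟨R, ⟨{
      hom := ⟨orbMk _ (inverseHom_mem hf hfs), _, _, rfl, hc.inverse hfs⟩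
      inv := ⟨orbMk f hf, _, _, rfl, hc⟩
      hom_inv_id := ChainOrbHom.ext (orb_comp_eq_id (apply_inverseHom f hfs))
      inv_hom_id := ChainOrbHom.ext (orb_comp_eq_id (inverseHom_apply f hfs)) }⟩⟩

end

end FusionSystem

/-! ### Cohomology of normalizer fusion systems -/

namespace FusionSystem

variable {S : Type u} [Group S] {F : FusionSystem S}

/-- The smallest member of a chain. -/
def Chain.bot (σ : F.Chain) : Subgroup S := sInf σ.carrier

lemma Chain.bot_le (σ : F.Chain) {P : Subgroup S} (h : P ∈ σ.carrier) : σ.bot ≤ P := sInf_le h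

lemma Chain.bot_le_normalizer (σ : F.Chain) : σ.bot ≤ σ.normalizer := fun _ hx =>
  mem_normalizer.2 fun _ hP => Subgroup.le_normalizer (σ.bot_le hP hx)

variable [Finite S]

instance : Finite F.Chain :=
  Finite.of_injective (fun σ : F.Chain => σ.carrier) fun _ _ => Chain.ext

instance (c : F.SdBar) : Finite (ChainOrb c) :=
  Finite.of_injective (fun x : ChainOrb c => (x.orb, x.chain)) fun _ _ h =>
    chainOrb_eq (congrArg Prod.fst h) (congrArg Prod.snd h)

namespace Chain

lemma bot_mem (σ : F.Chain) : σ.bot ∈ σ.carrier := by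
  obtain ⟨m, hm⟩ := (Set.toFinite σ.carrier).exists_minimal σ.nonempty
  have h : ∀ x ∈ σ.carrier, m ≤ x := fun x hx => by
    rcases σ.isChain.total hx hm.1 with h | h
    · exact hm.2 hx h
    · exact h
  have : σ.bot = m := le_antisymm (sInf_le hm.1) (le_sInf h)
  rw [this]
  exact hm.1

/-- Every class contains a fully normalized chain. -/
lemma exists_isFullyNormalized (c : F.SdBar) :
    ∃ σ : F.Chain, σ.IsFullyNormalized ∧ σ.cls = c := by
  obtain ⟨τ, hτ⟩ := Quotient.exists_rep (s := chainSetoid F) c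
  obtain ⟨σ, h1, h2⟩ := Set.exists_max_image {σ : F.Chain | σ.cls = c}
    (fun σ => Nat.card σ.normalizer) (Set.toFinite _) ⟨τ, hτ⟩
  exact ⟨σ, fun ρ hρ => h2 ρ ((cls_eq_iff.2 hρ).symm.trans h1), h1⟩

end Chain

/-- Morphisms `P ⟶ R` of the normalizer system extend to `PQ` if `R` contains the smallest member
`Q` of the chain. -/
lemma exists_extension_normalizerSystem (σ : F.Chain) (P R : Subgroup σ.normalizer)
    (hR : σ.bot.subgroupOf σ.normalizer ≤ R) (f : P →* R)
    (hf : f ∈ (normalizerSystem σ).Mor P R) :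
    ∃ g ∈ (normalizerSystem σ).Mor (P ⊔ σ.bot.subgroupOf σ.normalizer) R,
      ∀ x (hx : x ∈ P), g ⟨x, Subgroup.mem_sup_left hx⟩ = f ⟨x, hx⟩ := by
  obtain ⟨g, hg, h1, h2⟩ := hf
  have hQ : (σ.bot.subgroupOf σ.normalizer).map σ.normalizer.subtype = σ.bot := by
    rw [Subgroup.subgroupOf_map_subtype, inf_eq_left.2 σ.bot_le_normalizer]
  have hQR : σ.bot ≤ R.map σ.normalizer.subtype := hQ.symm.le.trans (Subgroup.map_mono hR)
  have hQtop : σ.bot ≤ σ.top := σ.le_top σ.bot_mem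
  have hle : (P ⊔ σ.bot.subgroupOf σ.normalizer).map σ.normalizer.subtype ≤
      σ.top ⊔ P.map σ.normalizer.subtype := by
    rw [Subgroup.map_sup, hQ]
    exact sup_le le_sup_right (hQtop.trans le_sup_left)
  -- The extension of `f` provided by the normalizer system fixes the smallest member Q and maps P
  -- into R, and R contains Q.
  have himg : img g ((P ⊔ σ.bot.subgroupOf σ.normalizer).map σ.normalizer.subtype) ≤
      R.map σ.normalizer.subtype := by
    rw [Subgroup.map_sup, hQ, img_sup _ le_sup_right (hQtop.trans le_sup_left), h2 _ σ.bot_mem]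
    refine sup_le (fun y hy => ?_) hQR
    obtain ⟨_, hA, ⟨x, hx, rfl⟩, rfl⟩ := exists_of_mem_img hy
    exact ⟨f ⟨x, hx⟩, (f ⟨x, hx⟩).2, (h1 x hx).symm⟩
  obtain ⟨f', hf'⟩ := exists_liftHom_eq (R := R)
    (restr g hle fun x => himg (apply_mem_img g (hle x.2) x.2))
  have key (x : σ.normalizer) (hx : x ∈ P ⊔ σ.bot.subgroupOf σ.normalizer) :
      (g ⟨x, hle (Subgroup.mem_map_of_mem _ hx)⟩ : S) = (f' ⟨x, hx⟩ : σ.normalizer) := by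
    rw [← liftHom_coe f' ⟨x, hx⟩ ⟨x, Subgroup.mem_map_of_mem _ hx⟩ rfl, hf']
    rfl
  have hle' := sup_le (le_sup_left : σ.top ≤ σ.top ⊔ P.map σ.normalizer.subtype) hle
  refine ⟨f', ⟨g.comp (Subgroup.inclusion hle'), F.comp_mem (F.inclusion_mem hle') hg,
    key, fun Q hQ => ?_⟩, fun x hx => Subtype.ext (Subtype.ext ?_)⟩
  · refine Eq.trans ?_ (h2 Q hQ)
    exact img_congr ((σ.le_top hQ).trans le_sup_left) ((σ.le_top hQ).trans le_sup_left)
      fun _ _ => rfl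
  · exact (key x (Subgroup.mem_sup_left hx)).symm.trans (h1 x hx)

section

variable {p : ℕ} [Fact p.Prime] {k : Type} [CommRing k] (M : CatCoh.RMod k F.CentricOrb)
  {σ : F.Chain}

/-- Subgroups of `N_S(σ)` which contain the smallest member of `σ` are `F`-centric. -/
lemma isCentric_of_bot_le (P : Subgroup σ.normalizer)
    (h : σ.bot.subgroupOf σ.normalizer ≤ P) : F.IsCentric (P.map σ.normalizer.subtype) := by
  refine (σ.centric _ σ.bot_mem).mono ?_
  have := Subgroup.map_mono (f := σ.normalizer.subtype) h
  rwa [Subgroup.subgroupOf_map_subtype, inf_eq_left.2 σ.bot_le_normalizer] at this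

/-- The functor is an equivalence, so its comma categories have initial objects. -/
lemma isIso_classRes (hS : IsPGroup p S) (hF : F.IsSaturated p)
    (hσ : σ.IsFullyNormalized) (t : ℕ) : IsIso (classRes M σ t) := by
  have := essSurj_normOrbToChainOrb hS hF hσ
  have : (normOrbToChainOrb σ).IsEquivalence := { }
  exact CatCoh.isIso_cohMap _
    (CatCoh.isContractible_of_adjunction (normOrbToChainOrb σ).asEquivalence.symm.toAdjunction)
    (𝟙 _) t

/-- Restricting further to the subgroups containing the smallest member Q of σ is an isomorphism
from either category, by the reflection P ↦ PQ; two out of three gives the claim. -/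
lemma isIso_centricRes (hS : IsPGroup p S) (hF : F.IsSaturated p)
    (hσ : σ.IsFullyNormalized)
    (M' : CatCoh.RMod k (normalizerSystem σ).CentricOrb)
    (e : (normOrbIncl σ).op ⋙ M' ≅ (normOrbForget σ).op ⋙ M) (t : ℕ) :
    IsIso (centricRes M σ M' e t) := by
  have hK := hσ.pAutomorphismsInduced hS hF
  have hT : IsPGroup p σ.normalizer := hS.to_subgroup _
  let j₁ : (normalizerSystem σ).Orb (σ.bot.subgroupOf σ.normalizer ≤ ·) ⥤ NormOrb σ :=
    orbIncl isCentric_of_bot_le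
  let j₂ : (normalizerSystem σ).Orb (σ.bot.subgroupOf σ.normalizer ≤ ·) ⥤
      (normalizerSystem σ).CentricOrb :=
    orbIncl fun P h => isCentric_normalizerSystem σ P (isCentric_of_bot_le P h)
  let e' : j₂.op ⋙ M' ≅ j₁.op ⋙ (normOrbForget σ).op ⋙ M := Functor.isoWhiskerLeft j₁.op e
  have h1 : IsIso (CatCoh.cohMap j₁ (𝟙 (j₁.op ⋙ (normOrbForget σ).op ⋙ M)) t) :=
    CatCoh.isIso_cohMap j₁ (isContractible_structuredArrow_orbIncl hT hK
      (fun P h => isCentric_normalizerSystem σ P h) _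
      fun P R hR f hf => exists_extension_normalizerSystem σ P R hR f hf) _ t
  have h2 : IsIso (CatCoh.cohMap j₂ e'.hom t) :=
    CatCoh.isIso_cohMap j₂ (isContractible_structuredArrow_orbIncl hT hK (fun P h => h) _
      fun P R hR f hf => exists_extension_normalizerSystem σ P R hR f hf) _ t
  have h3 := CatCoh.cohMap_comp j₁ (normOrbIncl σ) j₂ rfl e.hom (𝟙 _) e'.hom
    (fun X => heq_of_eq (Category.comp_id _).symm) t
  rw [h3] at h2
  exact @IsIso.of_isIso_comp_right _ _ _ _ _ (centricRes M σ M' e t) _ h1 h2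

/-- The right Kan extension along a fully faithful functor restricts to the original module. -/
lemma exists_extension_module (σ : F.Chain) :
    ∃ M' : CatCoh.RMod k (normalizerSystem σ).CentricOrb,
      Nonempty ((normOrbIncl σ).op ⋙ M' ≅ (normOrbForget σ).op ⋙ M) := by
  have : (normOrbIncl σ).Full := ⟨fun f => ⟨f, rfl⟩⟩
  have : (normOrbIncl σ).Faithful := ⟨fun h => h⟩
  exact ⟨(normOrbIncl σ).op.ran.obj ((normOrbForget σ).op ⋙ M),
    ⟨asIso ((normOrbIncl σ).op.ranCounit.app ((normOrbForget σ).op ⋙ M))⟩⟩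

end

end FusionSystem

/-! ### The category of pairs of a subgroup and a chain -/

namespace FusionSystem

variable {S : Type u} [Group S] {F : FusionSystem S}

lemma Carries.isConj [Finite S] {ρ ρ' : F.Chain} {P R : Subgroup S} {f : P →* R}
    (h : Carries ρ ρ' f) : ρ.IsConj ρ' := by
  obtain ⟨g, hg, -, h2⟩ := h
  exact Chain.isConj_of_img hg le_sup_left h2

/-- `f` carries a subchain of `ρ` to `ρ'`. -/
def SubCarries (ρ ρ' : F.Chain) {P R : Subgroup S} (f : P →* R) : Prop :=
  ∃ τ : F.Chain, τ.carrier ⊆ ρ.carrier ∧ Carries τ ρ' f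

/-- Keep those members of the first subchain whose images belong to the second one. -/
lemma SubCarries.comp [Finite S] {ρ ρ' ρ'' : F.Chain} {P Q R : Subgroup S} {f : P →* Q}
    {f' : Q →* R} (h : SubCarries ρ ρ' f) (h' : SubCarries ρ' ρ'' f') :
    SubCarries ρ ρ'' (f'.comp f) := by
  obtain ⟨τ, hτ, g, hg, h1, h2⟩ := h
  obtain ⟨τ', hτ', hc⟩ := h'
  have himg : img g '' {T ∈ τ.carrier | img g T ∈ τ'.carrier} = τ'.carrier := by
    ext T
    constructor
    · rintro ⟨U, ⟨-, hU⟩, rfl⟩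
      exact hU
    · intro hT
      obtain ⟨U, hU, rfl⟩ := h2.ge (hτ' hT)
      exact ⟨U, ⟨hU, hT⟩, rfl⟩
  have hsub : {T ∈ τ.carrier | img g T ∈ τ'.carrier} ⊆ τ.carrier := fun _ h => h.1
  have hne : {T ∈ τ.carrier | img g T ∈ τ'.carrier}.Nonempty := by
    rw [← Set.image_nonempty, himg]
    exact τ'.nonempty
  refine ⟨τ.sub _ hne hsub, hsub.trans hτ, Carries.comp ?_ hc⟩
  exact Carries.of_mor hg ((sSup_le_sSup hsub).trans le_sup_left) le_sup_right h1 himg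

/-- Pairs of a centric subgroup and a chain of centric subgroups which it normalizes. -/
structure ChainPair (F : FusionSystem S) where
  /-- the centric subgroup -/
  orb : F.CentricOrb
  /-- the chain -/
  chain : F.Chain
  le : orb.grp ≤ chain.normalizer

/-- Morphisms of the orbit category represented by morphisms which carry a subchain to the target
chain. -/
@[ext]
structure ChainPairHom (x y : F.ChainPair) where
  /-- the morphism in the orbit category -/
  hom : x.orb ⟶ y.orb
  carries : ∃ (f : x.orb.grp →* y.orb.grp) (hf : f ∈ F.Mor x.orb.grp y.orb.grp),
    hom = orbMk f hf ∧ SubCarries x.chain y.chain f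

variable [Finite S]

instance chainPairCategory : SmallCategory F.ChainPair where
  Hom x y := ChainPairHom x y
  id x := ⟨𝟙 x.orb, MonoidHom.id _, F.id_mem _, rfl, _, subset_rfl, Carries.id _ _⟩
  comp {x y z} a b := ⟨a.hom ≫ b.hom, by
    obtain ⟨f, hf, e, h⟩ := a.carries
    obtain ⟨f', hf', e', h'⟩ := b.carries
    refine ⟨f'.comp f, F.comp_mem hf hf', ?_, h.comp h'⟩
    rw [e, e']
    rfl⟩
  id_comp a := ChainPairHom.ext (Category.id_comp a.hom)
  comp_id a := ChainPairHom.ext (Category.comp_id a.hom)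
  assoc a b d := ChainPairHom.ext (Category.assoc a.hom b.hom d.hom)

instance : Finite F.ChainPair :=
  Finite.of_injective (fun x : F.ChainPair => (x.orb, x.chain)) fun x y h => by
    cases x; cases y; cases h; rfl

variable (F) in
/-- The functor `(P, ρ) ↦ P`. -/
def chainPairForget : F.ChainPair ⥤ F.CentricOrb where
  obj x := x.orb
  map a := a.hom

variable (F) in
/-- The functor `(P, ρ) ↦ [ρ]`. -/
def chainPairCls : F.ChainPair ⥤ F.SdBar where
  obj x := x.chain.cls
  map {x y} a := homOfLE (by
    obtain ⟨f, hf, -, τ, hτ, h⟩ := a.carries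
    exact cls_le_cls_iff.2 ⟨τ, h.isConj.symm, hτ⟩)

/-- The inclusion of the pairs `(P, ρ)` with `ρ` in the class `c`. -/
def chainOrbIncl (c : F.SdBar) : ChainOrb c ⥤ F.ChainPair where
  obj x := ⟨x.orb, x.chain, x.le⟩
  map a := ⟨a.hom, by
    obtain ⟨f, hf, e, h⟩ := a.carries
    exact ⟨f, hf, e, _, subset_rfl, h⟩⟩

/-- The homomorphism which passes to a subchain. -/
def chainOrbInclRes {c d : F.SdBar} (h : c ≤ d) :
    chainOrbIncl c ⟶ chainOrbRes h ⋙ chainOrbIncl d where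
  app x := ⟨𝟙 x.orb, MonoidHom.id _, F.id_mem _, rfl, _, subchain_subset h _ x.cls_eq,
    Carries.id _ _⟩
  naturality _ _ a :=
    ChainPairHom.ext ((Category.comp_id a.hom).trans (Category.id_comp a.hom).symm)

/-- A chain has exactly one subchain in the class c, so every arrow from (P, ρ) into the class
factors uniquely through replacing ρ by this subchain: an initial object. -/
lemma isContractible_structuredArrow_chainOrbIncl (x : F.ChainPair) {c : F.SdBar}
    (h : x.chain.cls ≤ c) :
    CatCoh.IsContractible (StructuredArrow x (chainOrbIncl c)) := by
  let e' : ChainOrb c := ⟨x.orb, subchain h x.chain rfl, subchain_cls _ _ _,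
    x.le.trans (Chain.normalizer_anti (subchain_subset _ _ _))⟩
  let i : x ⟶ (chainOrbIncl c).obj e' :=
    ⟨𝟙 x.orb, MonoidHom.id _, F.id_mem _, rfl, _, subchain_subset h _ rfl, Carries.id _ _⟩
  let e : StructuredArrow x (chainOrbIncl c) := StructuredArrow.mk i
  have hexists (y : StructuredArrow x (chainOrbIncl c)) :
      ∃ b : e ⟶ y, b.right.hom = y.hom.hom := by
    obtain ⟨f, hf, hy, τ, hτ, hc⟩ := y.hom.carries
    have hτ' := eq_subchain h x.chain rfl τ ((Chain.cls_eq_iff.2 hc.isConj).trans y.right.cls_eq) hτ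
    subst hτ'
    exact ⟨StructuredArrow.homMk ⟨y.hom.hom, f, hf, hy, hc⟩
      (ChainPairHom.ext (Category.id_comp y.hom.hom)), rfl⟩
  refine CatCoh.isContractible_of_isInitial (e := e) (IsInitial.ofUniqueHom
    (fun y => (hexists y).choose) fun y m => ?_)
  refine StructuredArrow.hom_ext _ _ (ChainOrbHom.ext ?_)
  refine Eq.trans ?_ (hexists y).choose_spec.symm
  exact (Category.id_comp _).symm.trans (congrArg ChainPairHom.hom (StructuredArrow.w m))

end FusionSystem

/-! ### Ext groups of free modules on sieves and the spectral sequence of pairs -/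

namespace CatCoh

open Abelian

variable {k : Type} [CommRing k] {C C' D : Type u} [SmallCategory C] [SmallCategory C']
  [SmallCategory D]

lemma ext_comp_eq_comp {𝒜 : Type*} [Category* 𝒜] [Abelian 𝒜] [HasExt.{u} 𝒜]
    {X₁ X₂ X₃ X₄ X₅ Y Y' : 𝒜} {n : ℕ} {a : X₁ ⟶ X₂} {b : X₂ ⟶ X₃} {y : Ext.{u} X₃ Y n} {c : Y ⟶ Y'}
    {d : X₃ ⟶ X₅} {y' : Ext.{u} X₅ Y' n} {e : X₁ ⟶ X₄} {f : X₄ ⟶ X₅}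
    (h : y.comp (Ext.mk₀ c) (add_zero n) = (Ext.mk₀ d).comp y' (zero_add n))
    (h' : a ≫ b ≫ d = e ≫ f) :
    ((Ext.mk₀ a).comp ((Ext.mk₀ b).comp y (zero_add n)) (zero_add n)).comp (Ext.mk₀ c)
      (add_zero n) = (Ext.mk₀ e).comp ((Ext.mk₀ f).comp y' (zero_add n)) (zero_add n) := by
  have h1 := congrArg (fun z => (Ext.mk₀ (a ≫ b)).comp z (zero_add n)) h
  have h2 := congrArg (fun z => (Ext.mk₀ z).comp y' (zero_add n)) h'
  simp only [← Ext.mk₀_comp_mk₀] at h1 h2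
  simp at h1 h2
  simp [h1, h2]

/-- The maps `Ext(k[G], N) ⟶ H(C; N)` given by free sections are natural. -/
lemma cohMap_freeSection_comp {r : C ⥤ C'} {K : C ⥤ D} {L : C' ⥤ D} (ν : K ⟶ r ⋙ L)
    {G G' : Dᵒᵖ ⥤ Type u} [∀ x, Subsingleton (G.obj x)] [∀ x, Subsingleton (G'.obj x)]
    (τ : G ⟶ G') (g : ∀ c, G.obj (op (K.obj c))) (g' : ∀ c, G'.obj (op (L.obj c)))
    {N : RMod k D} {n : ℕ} (x : Ext.{u} ((freeMod k).obj G') N n) :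
    (cohMap r (N := L.op ⋙ N) (N' := K.op ⋙ N) ((resMap k ν).app N) n).hom
        ((Ext.mk₀ (freeSection k L g')).comp (x.mapExactFunctor (res k L)) (zero_add n)) =
      (Ext.mk₀ (freeSection k K g)).comp
        (((Ext.mk₀ ((freeMod k).map τ)).comp x (zero_add n)).mapExactFunctor (res k K))
        (zero_add n) := by
  refine (cohMap_apply r _ n _).trans ?_
  have e1 : ((Ext.mk₀ (freeSection k L g')).comp (x.mapExactFunctor (res k L))
      (zero_add n)).mapExactFunctor (res k r) =
      (Ext.mk₀ ((res k r).map (freeSection k L g'))).comp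
        (x.mapExactFunctor (res k (r ⋙ L))) (zero_add n) := by
    refine (Ext.mapExactFunctor_comp _ _ _ _).trans ?_
    rw [Ext.mapExactFunctor_mk₀, res_ext_comp]
  have e2 := Ext.mapExactFunctor_naturality (resMap k ν) x
  have e3 : ((Ext.mk₀ ((freeMod k).map τ)).comp x (zero_add n)).mapExactFunctor (res k K) =
      (Ext.mk₀ ((res k K).map ((freeMod k).map τ))).comp (x.mapExactFunctor (res k K))
        (zero_add n) := by
    refine (Ext.mapExactFunctor_comp _ _ _ _).trans ?_
    rw [Ext.mapExactFunctor_mk₀]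
  have e4 : constRes k r ≫ (res k r).map (freeSection k L g') ≫
      (resMap k ν).app ((freeMod k).obj G') =
      freeSection k K g ≫ (res k K).map ((freeMod k).map τ) := by
    refine const_hom_ext fun c => ?_
    refine (congrArg (((freeMod k).obj G').map (ν.app c).op)
      (freeSection_one L g' (r.obj c))).trans ((freeMod_map_mk _ _).trans ?_)
    refine Eq.trans ?_ (congrArg (((freeMod k).map τ).app (op (K.obj c)))
      (freeSection_one K g c)).symm
    rw [freeMod_map_app_mk]
    exact congrArg _ (Subsingleton.elim _ _)
  rw [e3]
  refine Eq.trans ?_ (ext_comp_eq_comp e2 e4)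
  exact congrArg (fun z => ((Ext.mk₀ (constRes k r)).comp z (zero_add n)).comp
    (Ext.mk₀ ((resMap k ν).app N)) (add_zero n)) e1

/-- The Ext groups of the free module on a sieve are the cohomology groups of `C`. -/
def freeSectionEquiv [Finite D] (K : C ⥤ D) {G : Dᵒᵖ ⥤ Type u}
    [∀ x, Subsingleton (G.obj x)] (g : ∀ c, G.obj (op (K.obj c)))
    (h : ∀ d, Nonempty (G.obj (op d)) → IsContractible (StructuredArrow d K))
    (N : RMod k D) (n : ℕ) :
    Ext.{u} ((freeMod k).obj G) N n ≃+ Ext.{u} (constMod k C) ((res k K).obj N) n :=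
  AddEquiv.ofBijective (AddMonoidHom.mk' (fun x : Ext.{u} ((freeMod k).obj G) N n =>
    (Ext.mk₀ (freeSection k K g)).comp (x.mapExactFunctor (res k K)) (zero_add n))
    fun x y => by rw [Ext.mapExactFunctor_add, Ext.comp_add])
    (bijective_ext_freeMod K g h N n)

end CatCoh

namespace FusionSystem

variable {S : Type u} [Group S] {F : FusionSystem S} [Finite S]

instance (c : F.SdBar) (x : F.ChainPairᵒᵖ) :
    Subsingleton (((chainPairCls F).op ⋙ yoneda.obj c).obj x) :=
  inferInstanceAs (Subsingleton ((chainPairCls F).obj x.unop ⟶ c))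

section

variable {k : Type} [CommRing k] (M : CatCoh.RMod k F.CentricOrb)

lemma cls_chainOrbIncl {c : F.SdBar} (x : ChainOrb c) :
    (chainPairCls F).obj ((chainOrbIncl c).obj x) = c := x.cls_eq

/-- The cohomology of a class `c` is the Ext of the free module of the pairs `(P, ρ)` with
`[ρ] ≤ c`. -/
def chainPairExtEquiv (t : ℕ) (c : F.SdBar) :
    Abelian.Ext.{u} ((CatCoh.freeMod k).obj ((chainPairCls F).op ⋙ yoneda.obj c))
      ((chainPairForget F).op ⋙ M) t ≃+ (normalizerCoeff M t).obj (op c) :=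
  CatCoh.freeSectionEquiv (chainOrbIncl c) (fun x => homOfLE (cls_chainOrbIncl x).le)
    (fun x ⟨h⟩ => isContractible_structuredArrow_chainOrbIncl x (leOfHom h))
    ((chainPairForget F).op ⋙ M) t

/-- Passing to the subchain is a natural transformation of inclusions which is the identity on orbit
categories, so the inclusion of sieves induces exactly the restriction maps of the coefficient
system. -/
lemma chainPairExtEquiv_naturality (t : ℕ) {c d : F.SdBar} (a : c ⟶ d)
    (x : Abelian.Ext.{u} ((CatCoh.freeMod k).obj ((chainPairCls F).op ⋙ yoneda.obj d))
      ((chainPairForget F).op ⋙ M) t) :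
    (normalizerCoeff M t).map a.op (chainPairExtEquiv M t d x) =
      chainPairExtEquiv M t c ((Abelian.Ext.mk₀ ((CatCoh.freeMod k).map
        (Functor.whiskerLeft (chainPairCls F).op (yoneda.map a)))).comp x (zero_add t)) := by
  refine Eq.trans ?_ (CatCoh.cohMap_freeSection_comp (chainOrbInclRes (leOfHom a))
    (Functor.whiskerLeft (chainPairCls F).op (yoneda.map a)) _
    (fun x => homOfLE (cls_chainOrbIncl x).le) x)
  have h : (CatCoh.resMap k (chainOrbInclRes (leOfHom a))).app
      ((chainPairForget F).op ⋙ M) =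
      { app := fun x => 𝟙 (M.obj (op x.unop.orb))
        naturality := fun _ _ _ => (Category.comp_id _).trans (Category.id_comp _).symm } := by
    ext x : 2
    exact M.map_id _
  rw [h]
  rfl

end

/-- The spectral sequence of the functor `(P, ρ) ↦ [ρ]`. -/
theorem exists_chainPair_spectralSequence {p : ℕ} [Fact p.Prime]
    (M : CatCoh.RMod (ZMod p) F.CentricOrb) :
    ∃ E : E₂CohomologicalSpectralSequenceNat (ModuleCat.{u} (ZMod p)),
      (∀ (hr : (2 : ℤ) ≤ 2) (s t : ℕ), Nonempty ((E.page 2 hr).X (s, t) ≅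
        CatCoh.coh (normalizerCoeff M t) s)) ∧
      SpectralSequenceConverges E
        (fun n => CatCoh.coh ((chainPairForget F).op ⋙ M : CatCoh.RMod (ZMod p) F.ChainPair) n) :=
  CatCoh.exists_leray_spectralSequence (chainPairCls F) ((chainPairForget F).op ⋙ M)
    (normalizerCoeff M) (chainPairExtEquiv M) fun t _ _ a x => chainPairExtEquiv_naturality M t a x

end FusionSystem

/-! ### Pairs of centric subgroups -/

namespace CatCoh

/-- A category is contractible if every object `x` receives a morphism from an object `T x` which
maps to a fixed object, such that `T` is compatible with morphisms and the morphisms from the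
objects `T x` are unique. -/
lemma isContractible_of_subsingleton {E : Type u} [SmallCategory E] (T : E → E) (e : E)
    (h : ∀ x y, Subsingleton (T x ⟶ y)) (hT : ∀ {x y : E}, (x ⟶ y) → Nonempty (T x ⟶ T y))
    (h1 : ∀ x, Nonempty (T x ⟶ x)) (h2 : ∀ x, Nonempty (T x ⟶ e)) : IsContractible E :=
  ⟨{ obj := T
     map := fun a => (hT a).some
     map_id := fun _ => Subsingleton.elim _ _
     map_comp := fun _ _ => Subsingleton.elim _ _ }, e, Or.inl
    ⟨⟨{ app := fun x => (h1 x).some, naturality := fun x y _ => (h x y).elim _ _ }⟩,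
      ⟨{ app := fun x => (h2 x).some, naturality := fun x _ _ => (h x e).elim _ _ }⟩⟩⟩

end CatCoh

namespace FusionSystem

variable {S : Type u} [Group S] {F : FusionSystem S}

/-- A bijective morphism of F is invertible in the orbit category. -/
lemma orbComp_left_cancel {C : Subgroup S → Prop} {P Q R : F.Orb C} {f : P.grp →* Q.grp}
    {hf : f ∈ F.Mor P.grp Q.grp} (hb : Function.Bijective f) {a b : Q ⟶ R}
    (h : F.orbComp (orbMk f hf) a = F.orbComp (orbMk f hf) b) : a = b := by
  let i : P ⟶ Q := orbMk f hf
  let j : Q ⟶ P := orbMk (inverseHom f hb) (inverseHom_mem hf hb)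
  have hji : j ≫ i = 𝟙 Q := orb_comp_eq_id (apply_inverseHom f hb)
  rw [← Category.id_comp a, ← Category.id_comp b, ← hji, Category.assoc, Category.assoc]
  exact congrArg (j ≫ ·) h

/-- The chain obtained by adding a smaller centric subgroup to a chain. -/
def Chain.cons (R : Subgroup S) (hR : F.IsCentric R) (σ : F.Chain) (h : R ≤ σ.bot) : F.Chain where
  carrier := insert R σ.carrier
  nonempty := Set.insert_nonempty _ _
  isChain := σ.isChain.insert fun Q hQ _ => Or.inl (h.trans (σ.bot_le hQ))
  centric := by
    rintro P (rfl | hP)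
    · exact hR
    · exact σ.centric P hP

lemma Chain.bot_cons {R : Subgroup S} (hR : F.IsCentric R) (σ : F.Chain) (h : R ≤ σ.bot) :
    (Chain.cons R hR σ h).bot = R :=
  le_antisymm (sInf_le (Set.mem_insert _ _)) (le_sInf (by
    rintro P (rfl | hP)
    · exact le_rfl
    · exact h.trans (σ.bot_le hP)))

/-- The chain with one member. -/
def Chain.single (R : Subgroup S) (hR : F.IsCentric R) : F.Chain where
  carrier := {R}
  nonempty := Set.singleton_nonempty _
  isChain := Set.pairwise_singleton _ _
  centric := by
    rintro P rfl
    exact hR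

lemma Chain.bot_single {R : Subgroup S} (hR : F.IsCentric R) : (Chain.single R hR).bot = R :=
  sInf_singleton

lemma Chain.top_single {R : Subgroup S} (hR : F.IsCentric R) : (Chain.single R hR).top = R :=
  sSup_singleton

/-- `f : P ⟶ Q` extends to a morphism `RP ⟶ R'Q` in `F` which maps `R` to `R'`. -/
def Extends (F : FusionSystem S) (R R' : Subgroup S) {P Q : Subgroup S} (f : P →* Q) : Prop :=
  ∃ g ∈ F.Mor (R ⊔ P) (R' ⊔ Q),
    (∀ (x : S) (hx : x ∈ P), (g ⟨x, Subgroup.mem_sup_right hx⟩ : S) = f ⟨x, hx⟩) ∧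
    img g R ≤ R'

lemma Extends.of_mor {R R' P Q A B : Subgroup S} {f : P →* Q} {g : A →* B} (hg : g ∈ F.Mor A B)
    (hR : R ≤ A) (hP : P ≤ A)
    (h1 : ∀ (x : S) (hx : x ∈ P), (g ⟨x, hP hx⟩ : S) = f ⟨x, hx⟩) (h2 : img g R ≤ R') :
    F.Extends R R' f := by
  have hm : ∀ x : ↥(R ⊔ P), (g ⟨x, sup_le hR hP x.2⟩ : S) ∈ R' ⊔ Q := by
    have : img g (R ⊔ P) ≤ R' ⊔ Q := by
      rw [img_sup _ hR hP]
      refine sup_le_sup h2 fun y hy => ?_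
      obtain ⟨x, hA, hx, rfl⟩ := exists_of_mem_img hy
      rw [h1 x hx]
      exact (f ⟨x, hx⟩).2
    exact fun x => this (apply_mem_img g _ x.2)
  refine ⟨restr g (sup_le hR hP) hm, restr_mem hg _ hm, fun x hx => h1 x hx, ?_⟩
  refine le_of_eq_of_le ?_ h2
  exact img_congr le_sup_left hR fun _ _ => rfl

lemma Extends.id (R P : Subgroup S) : F.Extends R R (MonoidHom.id P) :=
  .of_mor (F.id_mem (R ⊔ P)) le_sup_left le_sup_right (fun _ _ => rfl)
    (img_eq_self le_sup_left fun _ _ => rfl).le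

lemma Extends.comp {R R' R'' P Q T : Subgroup S} {f : P →* Q} {f' : Q →* T}
    (h : F.Extends R R' f) (h' : F.Extends R' R'' f') : F.Extends R R'' (f'.comp f) := by
  obtain ⟨g, hg, h1, h2⟩ := h
  obtain ⟨g', hg', h1', h2'⟩ := h'
  refine ⟨g'.comp g, F.comp_mem hg hg', fun x hx => ?_, ?_⟩
  · rw [MonoidHom.comp_apply, MonoidHom.comp_apply]
    refine Eq.trans ?_ (h1' (f ⟨x, hx⟩) (f ⟨x, hx⟩).2)
    exact congrArg (fun w => (g' w : S)) (Subtype.ext (h1 x hx))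
  · rw [img_comp]
    exact (img_mono g' h2).trans h2'

/-- Pairs of centric subgroups the first of which normalizes the second. -/
structure SubPair (F : FusionSystem S) where
  /-- the first subgroup -/
  orb : F.CentricOrb
  /-- the second subgroup -/
  sub : Subgroup S
  centric : F.IsCentric sub
  le : orb.grp ≤ Subgroup.normalizer (sub : Set S)

/-- Morphisms of the orbit category which extend to the product of the two subgroups. -/
@[ext]
structure SubPairHom (x y : F.SubPair) where
  /-- the morphism in the orbit category -/
  hom : x.orb ⟶ y.orb
  exists_extends : ∃ (f : x.orb.grp →* y.orb.grp) (hf : f ∈ F.Mor x.orb.grp y.orb.grp),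
    hom = orbMk f hf ∧ F.Extends x.sub y.sub f

instance subPairCategory : SmallCategory F.SubPair where
  Hom x y := SubPairHom x y
  id x := ⟨𝟙 x.orb, MonoidHom.id _, F.id_mem _, rfl, .id _ _⟩
  comp {x y z} a b := ⟨a.hom ≫ b.hom, by
    obtain ⟨f, hf, e, h⟩ := a.exists_extends
    obtain ⟨f', hf', e', h'⟩ := b.exists_extends
    refine ⟨f'.comp f, F.comp_mem hf hf', ?_, h.comp h'⟩
    rw [e, e']
    rfl⟩
  id_comp a := SubPairHom.ext (Category.id_comp a.hom)
  comp_id a := SubPairHom.ext (Category.comp_id a.hom)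
  assoc a b d := SubPairHom.ext (Category.assoc a.hom b.hom d.hom)

instance [Finite S] : Finite F.SubPair :=
  Finite.of_injective (fun x : F.SubPair => (x.orb, x.sub)) fun x y h => by
    cases x; cases y; cases h; rfl

variable (F) in
/-- The functor `(P, R) ↦ P`. -/
def subPairForget : F.SubPair ⥤ F.CentricOrb where
  obj x := x.orb
  map a := a.hom

/-- The categories `P ↓ subPairForget` are contractible. -/
lemma isContractible_structuredArrow_subPairForget (P : F.CentricOrb) :
    CatCoh.IsContractible (StructuredArrow P (subPairForget F)) := by
  -- The contraction is the zigzag (Q, R) → (Q, RQ) ← (P, P): the left arrow is the identity of Q,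
  -- the right one is the structure map P → Q.
  let E (x : F.SubPair) : F.SubPair := ⟨x.orb, x.sub ⊔ x.orb.grp, x.centric.mono le_sup_left,
    le_sup_right.trans Subgroup.le_normalizer⟩
  let T : StructuredArrow P (subPairForget F) ⥤ StructuredArrow P (subPairForget F) :=
    { obj := fun x => StructuredArrow.mk (Y := E x.right) x.hom
      map := fun {x y} a => StructuredArrow.homMk ⟨a.right.hom, by
        obtain ⟨f, hf, e, g, hg, h1, h2⟩ := a.right.exists_extends
        exact ⟨f, hf, e, .of_mor hg le_rfl le_sup_right h1 (img_le _ _)⟩⟩ (StructuredArrow.w a)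
      map_id := fun _ => rfl
      map_comp := fun _ _ => rfl }
  let e' : F.SubPair := ⟨P, P.grp, P.mem, Subgroup.le_normalizer⟩
  let e : StructuredArrow P (subPairForget F) := StructuredArrow.mk (Y := e') (𝟙 P)
  let α (x : StructuredArrow P (subPairForget F)) : x.right ⟶ E x.right :=
    ⟨𝟙 _, MonoidHom.id _, F.id_mem _, rfl, .of_mor (F.id_mem (x.right.sub ⊔ x.right.orb.grp))
      le_sup_left le_sup_right (fun _ _ => rfl) (img_le _ _)⟩
  let β (x : StructuredArrow P (subPairForget F)) : e' ⟶ E x.right := ⟨x.hom, by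
    obtain ⟨f, hf, hx⟩ := exists_orbMk x.hom
    exact ⟨f, hf, hx, .of_mor hf le_rfl le_rfl (fun _ _ => rfl) ((img_le _ _).trans le_sup_right)⟩⟩
  refine ⟨T, e, Or.inr ⟨⟨?_⟩, ⟨?_⟩⟩⟩
  · exact
      { app := fun x => StructuredArrow.homMk (α x) (Category.comp_id _)
        naturality := fun x y a => StructuredArrow.hom_ext _ _ (SubPairHom.ext
          ((Category.comp_id a.right.hom).trans (Category.id_comp a.right.hom).symm)) }
  · exact
      { app := fun x => StructuredArrow.homMk (β x) (Category.id_comp _)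
        naturality := fun x y a => StructuredArrow.hom_ext _ _ (SubPairHom.ext
          ((Category.id_comp y.hom).trans (StructuredArrow.w a).symm)) }

variable (F) in
/-- The functor `(P, ρ) ↦ (P, ρ₀)` where `ρ₀` is the smallest member of `ρ`. -/
def chainPairBot [Finite S] : F.ChainPair ⥤ F.SubPair where
  obj x := ⟨x.orb, x.chain.bot, x.chain.centric _ x.chain.bot_mem,
    x.le.trans fun _ h => Chain.mem_normalizer.1 h _ x.chain.bot_mem⟩
  map {x y} a := ⟨a.hom, by
    obtain ⟨f, hf, e, τ, hτ, g, hg, h1, h2⟩ := a.carries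
    refine ⟨f, hf, e, .of_mor hg (R := x.chain.bot) ?_ le_sup_right h1 ?_⟩
    · exact (x.chain.bot_le (hτ τ.bot_mem)).trans ((τ.le_top τ.bot_mem).trans le_sup_left)
    · refine le_sInf fun Q hQ => ?_
      obtain ⟨T, hT, rfl⟩ := h2.ge hQ
      exact img_mono g (x.chain.bot_le (hτ hT))⟩

end FusionSystem

/-! ### From a pair of subgroups to a chain: images of pairs -/

namespace FusionSystem

variable {S : Type u} [Group S] {F : FusionSystem S}

lemma img_inclusion_comp {A B B' : Subgroup S} (f : A →* B) (h : B ≤ B') (Q : Subgroup S) :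
    img ((Subgroup.inclusion h).comp f) Q = img f Q := rfl

/-- Extensions to `V` of a morphism on a centric subgroup `P` agree on the subgroups which are
normalized by `P`. -/
lemma img_eq_of_eq_on_centric [Finite S] {p : ℕ} [Fact p.Prime] (hS : IsPGroup p S)
    (hF : F.PAutomorphismsInduced p) {P R V W : Subgroup S} (hP : F.IsCentric P) (hPV : P ≤ V)
    (hRV : R ≤ V) (hPR : P ≤ Subgroup.normalizer (R : Set S)) {φ φ' : V →* W}
    (hφ : φ ∈ F.Mor V W) (hφ' : φ' ∈ F.Mor V W)
    (h : ∀ x (hx : x ∈ P), φ ⟨x, hPV hx⟩ = φ' ⟨x, hPV hx⟩) : img φ R = img φ' R := by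
  obtain ⟨z, hz, -, hz'⟩ := exists_conj_of_eq_on_centric hS hF hP hPV hφ hφ' h
  refine (Subgroup.eq_of_le_of_card_ge (fun y hy => ?_) ?_).symm
  · obtain ⟨x, hA, hx, rfl⟩ := exists_of_mem_img hy
    -- The conjugating element lies in P, which normalizes R; so the extensions may differ on R but
    -- have the same image.
    have hm : z * x * z⁻¹ ∈ R := (Subgroup.mem_normalizer_iff.1 (hPR hz) x).1 hx
    rw [hz' ⟨x, hA⟩ ⟨_, hRV hm⟩ rfl]
    exact apply_mem_img φ _ hm
  · rw [card_img (F.injective_of_mem hφ) hRV, card_img (F.injective_of_mem hφ') hRV]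

/-- A representative of a morphism `(P, R) ⟶ (Q, ρ₀)` together with its extension to `RP`. -/
structure SubPair.Rep (d : F.SubPair) (y : F.ChainPair) where
  /-- the extension -/
  map : ↥(d.sub ⊔ d.orb.grp) →* ↥(y.chain.bot ⊔ y.orb.grp)
  mem : map ∈ F.Mor _ _
  sub_le : img map d.sub ≤ y.chain.bot
  grp_le : img map d.orb.grp ≤ y.orb.grp

namespace SubPair.Rep

variable {d : F.SubPair} {y : F.ChainPair} (r : d.Rep y)

/-- The restriction to the first subgroup. -/
def hom : d.orb.grp →* y.orb.grp :=
  restr r.map le_sup_right fun x => r.grp_le (apply_mem_img r.map _ x.2)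

lemma hom_mem : r.hom ∈ F.Mor d.orb.grp y.orb.grp := restr_mem r.mem _ _

/-- The pair of the image of `P` and the chain obtained from `ρ` by adding the image of `R`. -/
def pair : F.ChainPair where
  orb := ⟨img r.map d.orb.grp, d.orb.mem.img r.mem le_sup_right⟩
  chain := Chain.cons (img r.map d.sub) (d.centric.img r.mem le_sup_left) y.chain r.sub_le
  le := fun z hz => by
    refine Chain.mem_normalizer.2 ?_
    rintro Q (rfl | hQ)
    · obtain ⟨x, hA, hx, rfl⟩ := exists_of_mem_img hz
      exact apply_mem_normalizer_img r.map _ (d.le hx)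
    · exact Chain.mem_normalizer.1 (y.le (r.grp_le hz)) Q hQ

/-- The isomorphism from `P` to its image. -/
def iso : d.orb.grp →* r.pair.orb.grp :=
  restr r.map le_sup_right fun x => apply_mem_img r.map _ x.2

lemma iso_mem : r.iso ∈ F.Mor d.orb.grp r.pair.orb.grp := restr_mem r.mem _ _

lemma bijective_iso : Function.Bijective r.iso := by
  refine ⟨F.injective_of_mem r.iso_mem, fun w => ?_⟩
  obtain ⟨x, hA, hx, hw⟩ := exists_of_mem_img w.2
  exact ⟨⟨x, hx⟩, Subtype.ext hw⟩

variable [Finite S]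

/-- The morphism from `(P, R)` to its image. -/
def arrow : d ⟶ (chainPairBot F).obj r.pair where
  hom := orbMk r.iso r.iso_mem
  exists_extends := ⟨r.iso, r.iso_mem, rfl, .of_mor r.mem le_sup_left le_sup_right
    (fun _ _ => rfl) (Chain.bot_cons (d.centric.img r.mem le_sup_left) y.chain r.sub_le).ge⟩

lemma exists_rep (a : d ⟶ (chainPairBot F).obj y) :
    ∃ r : d.Rep y, a.hom = orbMk r.hom r.hom_mem := by
  obtain ⟨f, hf, e, g, hg, h1, h2⟩ := a.exists_extends
  refine ⟨⟨g, hg, h2, fun z hz => ?_⟩, e.trans (orbMk_congr fun x => Subtype.ext (h1 x x.2))⟩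
  obtain ⟨x, hA, hx, rfl⟩ := exists_of_mem_img hz
  exact (h1 x hx) ▸ (f ⟨x, hx⟩).2

/-- The inclusion of the image. -/
def incl : r.pair ⟶ y where
  hom := orbMk (Subgroup.inclusion r.grp_le) (F.inclusion_mem r.grp_le)
  carries := ⟨_, _, rfl, y.chain, Set.subset_insert _ _,
    .of_mor (F.id_mem (y.chain.top ⊔ y.orb.grp)) le_sup_left (r.grp_le.trans le_sup_right)
      (fun _ _ => rfl) (by
        conv_rhs => rw [← Set.image_id y.chain.carrier]
        exact Set.image_congr fun Q hQ =>
          img_eq_self ((y.chain.le_top hQ).trans le_sup_left) fun _ _ => rfl)⟩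

end SubPair.Rep

/-- The pair `(P, R)` with `R` seen as a chain with one member. -/
def SubPair.single (d : F.SubPair) : F.ChainPair where
  orb := d.orb
  chain := Chain.single d.sub d.centric
  le := d.le.trans fun z hz => Chain.mem_normalizer.2 (by
    rintro Q rfl
    exact hz)

namespace SubPair.Rep

variable [Finite S] {d : F.SubPair} {y : F.ChainPair} (r : d.Rep y)

/-- The inverse of the isomorphism from `(P, R)` to its image. -/
def inverse : r.pair ⟶ d.single where
  hom := orbMk (inverseHom r.iso r.bijective_iso) (inverseHom_mem r.iso_mem _)
  carries := ⟨_, _, rfl, Chain.single (img r.map d.sub) (d.centric.img r.mem le_sup_left),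
    Set.singleton_subset_iff.2 (Set.mem_insert _ _),
    Carries.inverse (.of_mor r.mem ((Chain.top_single d.centric).le.trans le_sup_left) le_sup_right
      (fun _ _ => rfl) (Set.image_singleton)) r.bijective_iso⟩

/-- The passage to the image is functorial. -/
lemma exists_pair_hom {p : ℕ} [Fact p.Prime] (hS : IsPGroup p S)
    (hF : F.PAutomorphismsInduced p) {y' : F.ChainPair} (r' : d.Rep y') (b : y ⟶ y')
    (hb : F.orbComp (orbMk r.hom r.hom_mem) b.hom = orbMk r'.hom r'.hom_mem) :
    ∃ c : r.pair ⟶ r'.pair, F.orbComp (orbMk r.iso r.iso_mem) c.hom =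
      orbMk r'.iso r'.iso_mem := by
  obtain ⟨f, hf, e, τ, hτ, g, hg, h1, h2⟩ := b.carries
  have hb' : orbMk (f.comp r.hom) (F.comp_mem r.hom_mem hf) = orbMk r'.hom r'.hom_mem :=
    (congrArg (F.orbComp (orbMk r.hom r.hom_mem)) e).symm.trans hb
  -- The representatives agree only up to an inner automorphism. The element `q` normalizes every
  -- member of the target chain, so composing with conjugation by it still carries `τ` to that
  -- chain.
  obtain ⟨q, hq⟩ := orbMk_exact hb'
  have hqn : (q : S) ∈ y'.chain.normalizer := y'.le q.2
  let q' : ↥(y'.chain.top ⊔ y'.orb.grp) := ⟨q, Subgroup.mem_sup_right q.2⟩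
  let c : ↥(y'.chain.top ⊔ y'.orb.grp) →* ↥(y'.chain.top ⊔ y'.orb.grp) :=
    (MulAut.conj q').toMonoidHom
  have hc : c ∈ F.Mor _ _ := F.conj_mem c q fun _ => rfl
  let g' : ↥(τ.top ⊔ y.orb.grp) →* ↥(y'.chain.top ⊔ y'.orb.grp) := c.comp g
  have hg' : g' ∈ F.Mor _ _ := F.comp_mem hg hc
  have hcimg : ∀ Q ∈ y'.chain.carrier, img c Q = Q := fun Q hQ => by
    have hn := Chain.mem_normalizer.1 hqn Q hQ
    refine Subgroup.eq_of_le_of_card_ge (fun z hz => ?_) ?_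
    · obtain ⟨x, hA, hx, rfl⟩ := exists_of_mem_img hz
      exact (Subgroup.mem_normalizer_iff.1 hn x).1 hx
    · exact (card_img (F.injective_of_mem hc) ((y'.chain.le_top hQ).trans le_sup_left)).ge
  have himg : img g' '' τ.carrier = y'.chain.carrier := by
    have h3 : img g' '' τ.carrier = img c '' (img g '' τ.carrier) := by
      rw [Set.image_image]
      exact Set.image_congr fun Q _ => img_comp g c Q
    rw [h3, h2]
    conv_rhs => rw [← Set.image_id y'.chain.carrier]
    exact Set.image_congr hcimg
  have hbot : y.chain.bot ≤ τ.top := (y.chain.bot_le (hτ τ.bot_mem)).trans (τ.le_top τ.bot_mem)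
  have hle : y.chain.bot ⊔ y.orb.grp ≤ τ.top ⊔ y.orb.grp := sup_le_sup_right hbot _
  have hbot' : y'.chain.bot ⊔ y'.orb.grp ≤ y'.chain.top ⊔ y'.orb.grp :=
    sup_le_sup_right (y'.chain.le_top y'.chain.bot_mem) _
  let φ : ↥(d.sub ⊔ d.orb.grp) →* ↥(y'.chain.top ⊔ y'.orb.grp) :=
    g'.comp ((Subgroup.inclusion hle).comp r.map)
  let φ' : ↥(d.sub ⊔ d.orb.grp) →* ↥(y'.chain.top ⊔ y'.orb.grp) :=
    (Subgroup.inclusion hbot').comp r'.map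
  have hφ : φ ∈ F.Mor _ _ := F.comp_mem (F.comp_mem r.mem (F.inclusion_mem hle)) hg'
  have hφ' : φ' ∈ F.Mor _ _ := F.comp_mem r'.mem (F.inclusion_mem hbot')
  have hφφ' : ∀ x (hx : x ∈ d.orb.grp), φ ⟨x, Subgroup.mem_sup_right hx⟩ =
      φ' ⟨x, Subgroup.mem_sup_right hx⟩ := fun x hx => by
    refine Subtype.ext (Eq.trans ?_ (congrArg (fun w : y'.orb.grp => (w : S)) (hq ⟨x, hx⟩)).symm)
    have h4 := h1 (r.hom ⟨x, hx⟩) (r.hom ⟨x, hx⟩).2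
    exact congrArg (fun w : S => (q : S) * w * (q : S)⁻¹) h4
  -- The two ways to extend from P agree on P, so they have the same image of R. Hence the image of
  -- R can be added to both chains compatibly.
  have hsub : img g' (img r.map d.sub) = img r'.map d.sub := by
    have h5 := img_eq_of_eq_on_centric hS hF d.orb.mem le_sup_right le_sup_left d.le hφ hφ' hφφ'
    have h6 : img φ d.sub = img g' (img r.map d.sub) := by
      rw [img_comp, img_inclusion_comp]
    rw [← h6, h5, img_inclusion_comp]
  have hgrp (x : S) (hx : x ∈ img r.map d.orb.grp) :
      (g' ⟨x, Subgroup.mem_sup_right (r.grp_le hx)⟩ : S) ∈ img r'.map d.orb.grp := by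
    obtain ⟨w, hA, hw, rfl⟩ := exists_of_mem_img hx
    have h7 := congrArg Subtype.val (hφφ' w hw)
    refine (show _ = _ from h7) ▸ ?_
    exact apply_mem_img r'.map _ hw
  let h : r.pair.orb.grp →* r'.pair.orb.grp :=
    restr g' (r.grp_le.trans le_sup_right) fun x => hgrp x x.2
  have hh : h ∈ F.Mor _ _ := restr_mem hg' _ _
  have hτ' : img r.map d.sub ≤ τ.bot :=
    r.sub_le.trans (y.chain.bot_le (hτ τ.bot_mem))
  refine ⟨⟨orbMk h hh, h, hh, rfl, Chain.cons _ (d.centric.img r.mem le_sup_left) τ hτ',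
    Set.insert_subset_insert hτ, .of_mor hg' ?_ (r.grp_le.trans le_sup_right) (fun _ _ => rfl) ?_⟩,
    orbMk_congr fun x => Subtype.ext ?_⟩
  · refine sSup_le ?_
    rintro Q (rfl | hQ)
    · exact (r.sub_le.trans hbot).trans le_sup_left
    · exact (τ.le_top hQ).trans le_sup_left
  · refine (Set.image_insert_eq).trans ?_
    rw [himg, hsub]
    rfl
  · exact (congrArg Subtype.val (hφφ' x x.2)).symm

end SubPair.Rep

end FusionSystem

/-! ### The abutment and the theorem -/

namespace FusionSystem

variable {S : Type u} [Group S] {F : FusionSystem S} [Finite S] {p : ℕ} [Fact p.Prime]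

/-- The categories `(P, R) ↓ chainPairBot` are contractible. -/
lemma isContractible_structuredArrow_chainPairBot (hS : IsPGroup p S)
    (hF : F.PAutomorphismsInduced p) (d : F.SubPair) :
    CatCoh.IsContractible (StructuredArrow d (chainPairBot F)) := by
  -- An arrow to (Q, ρ) is contracted through the image of P with the chain obtained by adding the
  -- image of R to ρ. Representatives are arbitrary; uniqueness of morphisms out of the resulting
  -- objects makes the construction functorial.
  choose r hr using fun x : StructuredArrow d (chainPairBot F) => SubPair.Rep.exists_rep x.hom
  let i : d ⟶ (chainPairBot F).obj d.single := ⟨𝟙 d.orb, MonoidHom.id _, F.id_mem _, rfl,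
    .of_mor (F.id_mem (d.sub ⊔ d.orb.grp)) le_sup_left le_sup_right (fun _ _ => rfl)
      ((img_eq_self le_sup_left fun _ _ => rfl).trans (Chain.bot_single d.centric).symm).le⟩
  refine CatCoh.isContractible_of_subsingleton
    (fun x => StructuredArrow.mk (Y := (r x).pair) (r x).arrow) (StructuredArrow.mk i)
    (fun x y => ⟨fun a b => ?_⟩) (fun {x y} a => ?_) (fun x => ?_) fun x => ?_
  -- P maps isomorphically to its image, so a morphism out of the image is determined by its
  -- composite from P.
  · refine StructuredArrow.hom_ext _ _ (ChainPairHom.ext ?_)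
    exact orbComp_left_cancel (r x).bijective_iso
      (congrArg SubPairHom.hom ((StructuredArrow.w a).trans (StructuredArrow.w b).symm))
  · obtain ⟨c, hc⟩ := (r x).exists_pair_hom hS hF (r y) a.right (by
      rw [← hr x, ← hr y]
      exact congrArg SubPairHom.hom (StructuredArrow.w a))
    exact ⟨StructuredArrow.homMk c (SubPairHom.ext hc)⟩
  -- The two legs of the contraction: passing to the subchain ρ leads back to the given arrow, and
  -- keeping only the added member leads to (P, R), with R as a one-member chain.
  · exact ⟨StructuredArrow.homMk (r x).incl (SubPairHom.ext (hr x).symm)⟩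
  · exact ⟨StructuredArrow.homMk (r x).inverse (SubPairHom.ext
      (orb_comp_eq_id (inverseHom_apply _ (r x).bijective_iso)))⟩

/-- The cohomology of the category of pairs `(P, ρ)` is that of the centric orbit category. -/
lemma nonempty_coh_chainPair_equiv (hS : IsPGroup p S) (hF : F.PAutomorphismsInduced p)
    {k : Type} [CommRing k] (M : CatCoh.RMod k F.CentricOrb) (n : ℕ) :
    Nonempty (CatCoh.coh ((chainPairForget F).op ⋙ M : CatCoh.RMod k F.ChainPair) n ≃ₗ[k]
      CatCoh.coh M n) := by
  have h1 := CatCoh.isIso_cohMap (subPairForget F) isContractible_structuredArrow_subPairForget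
    (N := M) (𝟙 _) n
  have h2 := CatCoh.isIso_cohMap (chainPairBot F)
    (isContractible_structuredArrow_chainPairBot hS hF) (N := (subPairForget F).op ⋙ M) (𝟙 _) n
  exact ⟨(asIso (CatCoh.cohMap (subPairForget F) (N := M) (𝟙 _) n) ≪≫
    asIso (CatCoh.cohMap (chainPairBot F) (N := (subPairForget F).op ⋙ M)
      (𝟙 _) n)).symm.toLinearEquiv⟩

end FusionSystem

theorem theorem1p3 {p : ℕ} [Fact p.Prime] {S : Type u} [Group S] [Finite S] (hS : IsPGroup p S)
    (F : FusionSystem S) (hF : F.IsSaturated p) (M : CatCoh.RMod (ZMod p) F.CentricOrb) :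
    -- every conjugacy class of chains contains a fully normalized chain
    (∀ c : F.SdBar, ∃ σ : F.Chain, σ.IsFullyNormalized ∧ σ.cls = c) ∧
    -- the value of the coefficient system at `[σ]` is `H^t(𝒪^c(N_F(σ)); M)`
    (∀ σ : F.Chain, σ.IsFullyNormalized →
      (∃ M' : CatCoh.RMod (ZMod p) (FusionSystem.normalizerSystem σ).CentricOrb,
        Nonempty ((FusionSystem.normOrbIncl σ).op ⋙ M' ≅
          (FusionSystem.normOrbForget σ).op ⋙ M)) ∧
      ∀ t : ℕ, IsIso (FusionSystem.classRes M σ t) ∧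
        ∀ (M' : CatCoh.RMod (ZMod p) (FusionSystem.normalizerSystem σ).CentricOrb)
          (e : (FusionSystem.normOrbIncl σ).op ⋙ M' ≅ (FusionSystem.normOrbForget σ).op ⋙ M),
          ∃ γ : (FusionSystem.normalizerCoeff M t).obj (op σ.cls) ≅ CatCoh.coh M' t,
            γ.hom ≫ FusionSystem.centricRes M σ M' e t = FusionSystem.classRes M σ t) ∧
    -- the spectral sequence
    ∃ E : E₂CohomologicalSpectralSequenceNat (ModuleCat.{u} (ZMod p)),
      (∀ s t : ℕ, Nonempty ((E.page 2).X (s, t) ≅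
        CatCoh.coh (FusionSystem.normalizerCoeff M t) s)) ∧
      SpectralSequenceConverges E (fun n => CatCoh.coh M n) := by
  refine ⟨FusionSystem.Chain.exists_isFullyNormalized, fun σ hσ =>
    ⟨FusionSystem.exists_extension_module M σ, fun t => ?_⟩, ?_⟩
  · have h1 := FusionSystem.isIso_classRes M hS hF hσ t
    refine ⟨h1, fun M' e => ?_⟩
    have h2 := FusionSystem.isIso_centricRes M hS hF hσ M' e t
    exact ⟨asIso (FusionSystem.classRes M σ t) ≪≫
      (asIso (FusionSystem.centricRes M σ M' e t)).symm, by simp⟩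
  · obtain ⟨E, hE, hE'⟩ := FusionSystem.exists_chainPair_spectralSequence M
    exact ⟨E, hE _, hE'.of_equiv
      (FusionSystem.nonempty_coh_chainPair_equiv hS hF.pAutomorphismsInduced M)⟩
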